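/- Work on a real RAM with unit-cost instructions: natural numbers, used as indices and counters, can be added, subtracted and compared; real numbers can be added, subtracted, multiplied, divided and compared exactly; program constants are natural or rational numbers; variables and arrays of both kinds are available, and there is no conversion from reals to naturals. For two non-vertical lines $\ell_1,\ell_2$ in $\mathbb{R}^2$ with the slope of $\ell_1$ smaller than that of $\ell_2$, the \emph{bowtie double wedge} of $\ell_1,\ell_2$ is the closed region $\mathcal{W}_B(\ell_1,\ell_2)=(\ell_1^+\cap\ell_2^-)\cup(\ell_1^-\cap\ell_2^+)$, where $\ell^+$ and $\ell^-$ are the closed halfplanes above and below $\ell$. For a finite set $R$ of red points, the number of \emph{red outliers} is $k_R(\ell_1,\ell_2)=|R\cap\operatorname{int}\mathcal{W}_B(\ell_1,\ell_2)|$. \textbf{Theorem.} There are a single real RAM program and a constant $C$ such that the following holds for every $n\ge 1$ and all disjoint sets $B,R\subset\mathbb{R}^2$ of $n$ points each such that $B\cup R$ is in general position (no two points have the same $x$-coordinate or the same $y$-coordinate, and no three are collinear). Given $n$ and the coordinates of the points of $B$ and of $R$, listed in arbitrary order, the program halts after at most $C\,n^2$ steps and outputs (as slopes and intercepts) two lines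 $\ell_1,\ell_2$, the slope of $\ell_1$ being smaller than that of $\ell_2$, such that $B\subseteq\mathcal{W}_B(\ell_1,\ell_2)$ and $k_R(\ell_1,\ell_2)$ is minimum among all pairs of lines whose bowtie double wedge contains $B$. -/

import Mathlib

noncomputable section

/-! ### Real RAM programs

Programs for a unit-cost real RAM. The machine has natural-number variables and arrays (used for
counters, indices and pointers) and real variables and arrays; variables and arrays are named by
natural numbers, so that a program mentions only finitely many of them. Naturals can only be added,
subtracted and compared, reals can be added, subtracted, multiplied, divided and compared exactly.
There is no conversion from reals to naturals (no rounding). -/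

namespace RealRAM

/-- A memory content. -/
structure State where
  nat : ℕ → ℕ
  real : ℕ → ℝ
  natArr : ℕ → ℕ → ℕ
  realArr : ℕ → ℕ → ℝ

/-- Natural-number expressions; `get a i` reads cell `i` of array `a`, `sub` is truncated. -/
inductive NExpr : Type
  | const (k : ℕ)
  | var (x : ℕ)
  | get (a : ℕ) (i : NExpr)
  | add (e₁ e₂ : NExpr)
  | sub (e₁ e₂ : NExpr)

/-- Real expressions; the only constants are rational. -/
inductive RExpr : Type
  | const (q : ℚ)
  | var (x : ℕ)
  | get (a : ℕ) (i : NExpr)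
  | add (e₁ e₂ : RExpr)
  | sub (e₁ e₂ : RExpr)
  | mul (e₁ e₂ : RExpr)
  | div (e₁ e₂ : RExpr)

/-- Tests. -/
inductive BExpr : Type
  | natEq (e₁ e₂ : NExpr)
  | natLt (e₁ e₂ : NExpr)
  | realEq (e₁ e₂ : RExpr)
  | realLt (e₁ e₂ : RExpr)
  | not (c : BExpr)
  | and (c₁ c₂ : BExpr)
  | or (c₁ c₂ : BExpr)

/-- Programs. `putNat a i e` and `putReal a i e` write the value of `e` to cell `i` of array `a`. -/
inductive Prog : Type
  | skip
  | setNat (x : ℕ) (e : NExpr)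
  | setReal (x : ℕ) (e : RExpr)
  | putNat (a : ℕ) (i e : NExpr)
  | putReal (a : ℕ) (i : NExpr) (e : RExpr)
  | seq (p q : Prog)
  | ite (c : BExpr) (p q : Prog)
  | loop (c : BExpr) (p : Prog)

/-- The value of a natural-number expression. -/
def NExpr.eval (s : State) : NExpr → ℕ
  | .const k => k
  | .var x => s.nat x
  | .get a i => s.natArr a (i.eval s)
  | .add e₁ e₂ => e₁.eval s + e₂.eval s
  | .sub e₁ e₂ => e₁.eval s - e₂.eval s

/-- The value of a real expression (a division by zero yields zero). -/
def RExpr.eval (s : State) : RExpr → ℝ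
  | .const q => (q : ℝ)
  | .var x => s.real x
  | .get a i => s.realArr a (i.eval s)
  | .add e₁ e₂ => e₁.eval s + e₂.eval s
  | .sub e₁ e₂ => e₁.eval s - e₂.eval s
  | .mul e₁ e₂ => e₁.eval s * e₂.eval s
  | .div e₁ e₂ => e₁.eval s / e₂.eval s

/-- The truth of a test. -/
def BExpr.Holds (s : State) : BExpr → Prop
  | .natEq e₁ e₂ => e₁.eval s = e₂.eval s
  | .natLt e₁ e₂ => e₁.eval s < e₂.eval s
  | .realEq e₁ e₂ => e₁.eval s = e₂.eval s
  | .realLt e₁ e₂ => e₁.eval s < e₂.eval s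
  | .not c => ¬ c.Holds s
  | .and c₁ c₂ => c₁.Holds s ∧ c₂.Holds s
  | .or c₁ c₂ => c₁.Holds s ∨ c₂.Holds s

/-- The cost of evaluating an expression: one step per constant, memory access and operation. -/
def NExpr.cost : NExpr → ℕ
  | .const _ => 1
  | .var _ => 1
  | .get _ i => i.cost + 1
  | .add e₁ e₂ => e₁.cost + e₂.cost + 1
  | .sub e₁ e₂ => e₁.cost + e₂.cost + 1

/-- The cost of evaluating a real expression. -/
def RExpr.cost : RExpr → ℕ
  | .const _ => 1
  | .var _ => 1
  | .get _ i => i.cost + 1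
  | .add e₁ e₂ => e₁.cost + e₂.cost + 1
  | .sub e₁ e₂ => e₁.cost + e₂.cost + 1
  | .mul e₁ e₂ => e₁.cost + e₂.cost + 1
  | .div e₁ e₂ => e₁.cost + e₂.cost + 1

/-- The cost of evaluating a test. -/
def BExpr.cost : BExpr → ℕ
  | .natEq e₁ e₂ => e₁.cost + e₂.cost + 1
  | .natLt e₁ e₂ => e₁.cost + e₂.cost + 1
  | .realEq e₁ e₂ => e₁.cost + e₂.cost + 1
  | .realLt e₁ e₂ => e₁.cost + e₂.cost + 1
  | .not c => c.cost + 1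
  | .and c₁ c₂ => c₁.cost + c₂.cost + 1
  | .or c₁ c₂ => c₁.cost + c₂.cost + 1

/-- Assignment to a natural-number variable. -/
def State.setNat (s : State) (x v : ℕ) : State :=
  { s with nat := Function.update s.nat x v }

/-- Assignment to a real variable. -/
def State.setReal (s : State) (x : ℕ) (v : ℝ) : State :=
  { s with real := Function.update s.real x v }

/-- Assignment to a cell of a natural-number array. -/
def State.putNat (s : State) (a i v : ℕ) : State :=
  { s with natArr := Function.update s.natArr a (Function.update (s.natArr a) i v) }

/-- Assignment to a cell of a real array. -/
def State.putReal (s : State) (a i : ℕ) (v : ℝ) : State :=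
  { s with realArr := Function.update s.realArr a (Function.update (s.realArr a) i v) }

/-- `Exec p s s' t`: started in the memory `s`, the program `p` halts after exactly `t` steps,
leaving the memory `s'`. -/
inductive Exec : Prog → State → State → ℕ → Prop
  | skip (s : State) : Exec .skip s s 1
  | setNat (s : State) (x : ℕ) (e : NExpr) :
      Exec (.setNat x e) s (s.setNat x (e.eval s)) (e.cost + 1)
  | setReal (s : State) (x : ℕ) (e : RExpr) :
      Exec (.setReal x e) s (s.setReal x (e.eval s)) (e.cost + 1)
  | putNat (s : State) (a : ℕ) (i e : NExpr) :
      Exec (.putNat a i e) s (s.putNat a (i.eval s) (e.eval s)) (i.cost + e.cost + 1)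
  | putReal (s : State) (a : ℕ) (i : NExpr) (e : RExpr) :
      Exec (.putReal a i e) s (s.putReal a (i.eval s) (e.eval s)) (i.cost + e.cost + 1)
  | seq {p q : Prog} {s s' s'' : State} {t t' : ℕ} :
      Exec p s s' t → Exec q s' s'' t' → Exec (.seq p q) s s'' (t + t')
  | iteTrue {c : BExpr} {p q : Prog} {s s' : State} {t : ℕ} :
      c.Holds s → Exec p s s' t → Exec (.ite c p q) s s' (c.cost + 1 + t)
  | iteFalse {c : BExpr} {p q : Prog} {s s' : State} {t : ℕ} :
      ¬ c.Holds s → Exec q s s' t → Exec (.ite c p q) s s' (c.cost + 1 + t)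
  | loopTrue {c : BExpr} {p : Prog} {s s' s'' : State} {t t' : ℕ} :
      c.Holds s → Exec p s s' t → Exec (.loop c p) s' s'' t' →
      Exec (.loop c p) s s'' (c.cost + 1 + t + t')
  | loopFalse {c : BExpr} {p : Prog} {s : State} :
      ¬ c.Holds s → Exec (.loop c p) s s (c.cost + 1)

/-- The machine is deterministic: the final memory and the number of steps are unique. -/
theorem Exec.deterministic {p : Prog} {s s₁ s₂ : State} {t₁ t₂ : ℕ}
    (h₁ : Exec p s s₁ t₁) (h₂ : Exec p s s₂ t₂) : s₁ = s₂ ∧ t₁ = t₂ := by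
  induction h₁ generalizing s₂ t₂ with
  | skip | setNat | setReal | putNat | putReal => cases h₂; exact ⟨rfl, rfl⟩
  | seq _ _ ih ih' =>
    cases h₂ with
    | seq k k' =>
      obtain ⟨rfl, rfl⟩ := ih k
      obtain ⟨rfl, rfl⟩ := ih' k'
      exact ⟨rfl, rfl⟩
  | iteTrue hc _ ih =>
    cases h₂ with
    | iteTrue _ k => obtain ⟨rfl, rfl⟩ := ih k; exact ⟨rfl, rfl⟩
    | iteFalse hc' _ => exact absurd hc hc'
  | iteFalse hc _ ih =>
    cases h₂ with
    | iteTrue hc' _ => exact absurd hc' hc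
    | iteFalse _ k => obtain ⟨rfl, rfl⟩ := ih k; exact ⟨rfl, rfl⟩
  | loopTrue hc _ _ ih ih' =>
    cases h₂ with
    | loopTrue _ k k' =>
      obtain ⟨rfl, rfl⟩ := ih k
      obtain ⟨rfl, rfl⟩ := ih' k'
      exact ⟨rfl, rfl⟩
    | loopFalse hc' => exact absurd hc hc'
  | loopFalse hc =>
    cases h₂ with
    | loopTrue hc' _ _ => exact absurd hc' hc
    | loopFalse _ => exact ⟨rfl, rfl⟩

end RealRAM

/-! ### Bowtie double wedges -/

namespace Bowtie

/-- The non-vertical line `y = slope * x + intercept`. -/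
structure Line where
  slope : ℝ
  intercept : ℝ

/-- The closed halfplane on and above a line. -/
def Line.above (l : Line) : Set (ℝ × ℝ) := {p | l.slope * p.1 + l.intercept ≤ p.2}

/-- The closed halfplane on and below a line. -/
def Line.below (l : Line) : Set (ℝ × ℝ) := {p | p.2 ≤ l.slope * p.1 + l.intercept}

/-- The east wedge of two lines, the first of which has the smaller slope. -/
def east (l₁ l₂ : Line) : Set (ℝ × ℝ) := l₁.above ∩ l₂.below

/-- The west wedge of two lines, the first of which has the smaller slope. -/
def west (l₁ l₂ : Line) : Set (ℝ × ℝ) := l₁.below ∩ l₂.above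

/-- The (closed) bowtie double wedge of two lines, the first of which has the smaller slope. -/
def bowtie (l₁ l₂ : Line) : Set (ℝ × ℝ) := east l₁ l₂ ∪ west l₁ l₂

/-- The number of red outliers: red points in the interior of the bowtie double wedge. -/
def redOutliers (R : Finset (ℝ × ℝ)) (l₁ l₂ : Line) : ℕ :=
  ((R : Set (ℝ × ℝ)) ∩ interior (bowtie l₁ l₂)).ncard

/-- The lines `l₁`, `l₂` bound a bowtie double wedge that contains all blue points. -/
def Feasible (B : Finset (ℝ × ℝ)) (l₁ l₂ : Line) : Prop :=
  l₁.slope < l₂.slope ∧ (B : Set (ℝ × ℝ)) ⊆ bowtie l₁ l₂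

/-- Among the bowtie double wedges that contain all blue points, the one of `l₁`, `l₂` has the
fewest red outliers. -/
def Optimal (B R : Finset (ℝ × ℝ)) (l₁ l₂ : Line) : Prop :=
  Feasible B l₁ l₂ ∧
    ∀ k₁ k₂ : Line, Feasible B k₁ k₂ → redOutliers R l₁ l₂ ≤ redOutliers R k₁ k₂

/-- No two points share an `x`-coordinate or a `y`-coordinate, and no three are collinear. -/
def GeneralPosition (S : Set (ℝ × ℝ)) : Prop :=
  S.InjOn Prod.fst ∧ S.InjOn Prod.snd ∧
    ∀ p ∈ S, ∀ q ∈ S, ∀ r ∈ S, p ≠ q → q ≠ r → p ≠ r → ¬ Collinear ℝ {p, q, r}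

/-- The input: variable `0` holds `n`, the real arrays `0` and `1` hold the `x`- and
`y`-coordinates of the blue points, the real arrays `2` and `3` those of the red points. Every
other cell is zero. -/
def input {n : ℕ} (b r : Fin n → ℝ × ℝ) : RealRAM.State where
  nat x := if x = 0 then n else 0
  real _ := 0
  natArr _ _ := 0
  realArr a i :=
    if h : i < n then
      match a with
      | 0 => (b ⟨i, h⟩).1
      | 1 => (b ⟨i, h⟩).2
      | 2 => (r ⟨i, h⟩).1
      | 3 => (r ⟨i, h⟩).2
      | _ => 0
    else 0

/-- The first line of the output: slope in the real variable `0`, intercept in `1`. -/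
def outputFst (s : RealRAM.State) : Line := ⟨s.real 0, s.real 1⟩

/-- The second line of the output: slope in the real variable `2`, intercept in `3`. -/
def outputSnd (s : RealRAM.State) : Line := ⟨s.real 2, s.real 3⟩

end Bowtie

end

/-!
An optimal double wedge can be found among finitely many candidates, and these can be evaluated in amortized
constant time each.

*Candidates.* The lines of a feasible double wedge split the blue points, ordered by their `x`-coordinates, into
a prefix in the west wedge and a suffix in the east wedge. Each line can be moved towards the other one until
it touches a blue point, and then be turned slightly such that it avoids all other points. The double wedge
shrinks in the first step and gains no red point in the second (`BlueList.exists_tangents`). Hence there are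
`n` splits, where the two cases with an empty wedge are the same up to an exchange of the lines. For
each of them, there are two lines that touch one of the two wedges each, which gives four chains of tangents.
Reflections turn every chain into the lower tangents of a set of near blue points with the far blue points
below them.

*Sorted slopes.* For each point, the other points are sorted by the slopes of the connecting lines. In the dual
plane, this is the construction of a line arrangement. The lines are inserted one by one, by a walk along the
faces that the new line meets. The walk has linear length, since each old line contributes at most one
vertex of each kind (`WalkCount`), so that all lists take quadratic time (`runs_listsProg`).

*Sweeps.* With these lists, the tangents of a chain are swept in the order of their slopes in linear time, since
every point changes its side at most once (`ChainState`). The red points that do not lie between the two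
wedges are counted on the way. Whether a red point in the gap between the wedges is an outlier depends on both
lines. Such a point gets the time at which the sweep passes it as a stamp, and for each of these times only the
tangents with the largest count are recorded.

*Combination.* The number of red points outside the double wedge of two tangents is the sum of the two counts,
which refer to disjoint sets, and of the number of gap points that lie on the same side of both lines
(`Split.card_unsep`). The latter can be read off from the stamps, and is updated in constant time from one pair of
times to the next one. A gap of `m` points thus costs `O((m + 1) ^ 2)` steps (`runs_comboProg`), and as the gaps of
different splits are disjoint, all splits take quadratic time (`runs_splitsProg`). Finally, two slopes are
chosen within the best pair of edges (`run_outProg`).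
-/

namespace RealRAM

/-! ### Reasoning about programs -/

/-- `Runs p s T Q`: started in `s`, the program `p` halts after at most `T` steps in a memory that
satisfies `Q`. -/
def Runs (p : Prog) (s : State) (T : ℕ) (Q : State → Prop) : Prop :=
  ∃ s' t, Exec p s s' t ∧ t ≤ T ∧ Q s'

theorem Runs.mono {p : Prog} {s : State} {T T' : ℕ} {Q Q' : State → Prop}
    (h : Runs p s T Q) (hT : T ≤ T') (hQ : ∀ s', Q s' → Q' s') : Runs p s T' Q' := by
  obtain ⟨s', t, h1, h2, h3⟩ := h
  exact ⟨s', t, h1, h2.trans hT, hQ _ h3⟩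

theorem Runs.seq {p q : Prog} {s : State} {T T' : ℕ} {P Q : State → Prop}
    (h : Runs p s T P) (h' : ∀ s', P s' → Runs q s' T' Q) : Runs (.seq p q) s (T + T') Q := by
  obtain ⟨s', t, h1, h2, h3⟩ := h
  obtain ⟨s'', t', k1, k2, k3⟩ := h' _ h3
  exact ⟨s'', t + t', .seq h1 k1, by omega, k3⟩

/-- Programs without loops. -/
def Prog.loopFree : Prog → Bool
  | .seq p q => p.loopFree && q.loopFree
  | .ite _ p q => p.loopFree && q.loopFree
  | .loop _ _ => false
  | _ => true

/-- A bound on the number of steps of a loop-free program; the value for loops is junk. -/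
def Prog.time : Prog → ℕ
  | .skip => 1
  | .setNat _ e => e.cost + 1
  | .setReal _ e => e.cost + 1
  | .putNat _ i e => i.cost + e.cost + 1
  | .putReal _ i e => i.cost + e.cost + 1
  | .seq p q => p.time + q.time
  | .ite c p q => c.cost + 1 + p.time + q.time
  | .loop _ _ => 0

open Classical in
/-- The final memory of a loop-free program; loops are treated like `skip`. -/
noncomputable def Prog.run : Prog → State → State
  | .skip, s => s
  | .setNat x e, s => s.setNat x (e.eval s)
  | .setReal x e, s => s.setReal x (e.eval s)
  | .putNat a i e, s => s.putNat a (i.eval s) (e.eval s)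
  | .putReal a i e, s => s.putReal a (i.eval s) (e.eval s)
  | .seq p q, s => q.run (p.run s)
  | .ite c p q, s => if c.Holds s then p.run s else q.run s
  | .loop _ _, s => s

/-- A loop-free program is executed symbolically: it suffices to check its final memory. -/
theorem Runs.of_loopFree {p : Prog} (hp : p.loopFree = true) {s : State} {Q : State → Prop}
    (hQ : Q (p.run s)) : Runs p s p.time Q := by
  suffices h : ∃ t, Exec p s (p.run s) t ∧ t ≤ p.time by
    obtain ⟨t, h1, h2⟩ := h
    exact ⟨_, t, h1, h2, hQ⟩
  clear hQ
  induction p generalizing s with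
  | skip => exact ⟨_, .skip s, le_rfl⟩
  | setNat x e => exact ⟨_, .setNat s x e, le_rfl⟩
  | setReal x e => exact ⟨_, .setReal s x e, le_rfl⟩
  | putNat a i e => exact ⟨_, .putNat s a i e, le_rfl⟩
  | putReal a i e => exact ⟨_, .putReal s a i e, le_rfl⟩
  | seq p q ihp ihq =>
    simp only [Prog.loopFree, Bool.and_eq_true] at hp
    obtain ⟨t, h1, h2⟩ := ihp hp.1 (s := s)
    obtain ⟨t', k1, k2⟩ := ihq hp.2 (s := p.run s)
    exact ⟨_, .seq h1 k1, by simp only [Prog.time]; omega⟩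
  | ite c p q ihp ihq =>
    simp only [Prog.loopFree, Bool.and_eq_true] at hp
    by_cases hc : c.Holds s
    · obtain ⟨t, h1, h2⟩ := ihp hp.1 (s := s)
      refine ⟨c.cost + 1 + t, ?_, ?_⟩
      · simp only [Prog.run, if_pos hc]
        exact .iteTrue hc h1
      · simp only [Prog.time]; omega
    · obtain ⟨t, h1, h2⟩ := ihq hp.2 (s := s)
      refine ⟨c.cost + 1 + t, ?_, ?_⟩
      · simp only [Prog.run, if_neg hc]
        exact .iteFalse hc h1
      · simp only [Prog.time]; omega
  | loop c p => simp [Prog.loopFree] at hp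

/-- The rule for a loop whose body takes at most `K` steps: `I f` is the invariant, and the fuel `f`
bounds the number of iterations that are left. -/
theorem Runs.loop {c : BExpr} {p : Prog} {K : ℕ} {I : ℕ → State → Prop} {Q : State → Prop}
    (step : ∀ f s, I f s → c.Holds s → ∃ f' < f, Runs p s K (I f'))
    (done : ∀ f s, I f s → ¬ c.Holds s → Q s) {f : ℕ} {s : State} (h : I f s) :
    Runs (.loop c p) s ((f + 1) * (c.cost + 1 + K)) Q := by
  induction f using Nat.strong_induction_on generalizing s with
  | _ f ih =>
    by_cases hc : c.Holds s
    · obtain ⟨f', hf, s', t, h1, h2, h3⟩ := step f s h hc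
      obtain ⟨s'', t', k1, k2, k3⟩ := ih f' hf h3
      refine ⟨s'', _, .loopTrue hc h1 k1, ?_, k3⟩
      have : (f' + 1 + 1) * (c.cost + 1 + K) ≤ (f + 1) * (c.cost + 1 + K) :=
        Nat.mul_le_mul_right _ (by omega)
      rw [Nat.add_mul _ 1] at this
      omega
    · refine ⟨s, _, .loopFalse hc, ?_, done f s h hc⟩
      have : 1 * (c.cost + 1 + K) ≤ (f + 1) * (c.cost + 1 + K) :=
        Nat.mul_le_mul_right _ (by omega)
      omega

/-- The counting loop `while v < e do (p; v := v + 1)`; the bound `e` is evaluated in every round. -/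
def Prog.upto (v : ℕ) (e : NExpr) (p : Prog) : Prog :=
  .loop (.natLt (.var v) e) (.seq p (.setNat v (.add (.var v) (.const 1))))

/-- The rule for counting loops, with a body whose time may depend on the counter. -/
theorem Runs.upto_sum {v : ℕ} {e : NExpr} {p : Prog} {T : ℕ → ℕ} {I : ℕ → State → Prop} {K a : ℕ}
    (he : ∀ k s, k ≤ K → I k s → s.nat v = k → e.eval s = K)
    (hp : ∀ k s, a ≤ k → k < K → I k s → s.nat v = k →
      Runs p s (T k) fun s' => s'.nat v = k ∧ I (k + 1) (s'.setNat v (k + 1)))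
    (ha : a ≤ K) {s : State} (hs : s.nat v = a) (h : I a s) :
    Runs (Prog.upto v e p) s (∑ k ∈ Finset.Ico a K, (T k + (e.cost + 7)) + (e.cost + 3))
      fun s' => s'.nat v = K ∧ I K s' := by
  obtain ⟨d, rfl⟩ := Nat.exists_eq_add_of_le ha
  induction d generalizing a s with
  | zero =>
    refine ⟨s, _, .loopFalse ?_, ?_, hs, h⟩
    · simp only [BExpr.Holds, NExpr.eval, he a s le_rfl h hs, hs]; omega
    · simp [BExpr.cost, NExpr.cost]; omega
  | succ d ih =>
    obtain ⟨s₁, t, h1, h2, h3, h4⟩ := hp a s le_rfl (by omega) h hs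
    have hadd : a + 1 + d = a + (d + 1) := by omega
    obtain ⟨s₂, t', k1, k2, k3⟩ := ih (a := a + 1) (s := s₁.setNat v (a + 1))
      (by simp [State.setNat]) h4
      (fun k s hk hI hv => by rw [hadd] at hk ⊢; exact he k s hk hI hv)
      (fun k s hk hk' => hp k s (by omega) (by omega)) (by omega)
    have hc : (BExpr.natLt (.var v) e).Holds s := by
      simp only [BExpr.Holds, NExpr.eval, he a s (by omega) h hs, hs]; omega
    have e1 := Exec.setNat s₁ v (.add (.var v) (.const 1))
    simp only [NExpr.eval, h3] at e1
    refine ⟨s₂, _, .loopTrue hc (.seq h1 e1) k1, ?_, ?_⟩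
    · rw [Finset.sum_eq_sum_Ico_succ_bot (by omega), ← hadd]
      simp only [BExpr.cost, NExpr.cost]
      omega
    · rw [hadd] at k3; exact k3

/-- The rule for counting loops that start at `0` and whose body takes at most `T` steps. -/
theorem Runs.upto {v : ℕ} {e : NExpr} {p : Prog} {T : ℕ} {I : ℕ → State → Prop} {K : ℕ}
    (he : ∀ k s, k ≤ K → I k s → s.nat v = k → e.eval s = K)
    (hp : ∀ k s, k < K → I k s → s.nat v = k →
      Runs p s T fun s' => s'.nat v = k ∧ I (k + 1) (s'.setNat v (k + 1)))
    {s : State} (hs : s.nat v = 0) (h : I 0 s) :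
    Runs (Prog.upto v e p) s ((K + 1) * (T + (e.cost + 7)))
      fun s' => s'.nat v = K ∧ I K s' := by
  refine (Runs.upto_sum (T := fun _ => T) he (fun k s _ => hp k s) (Nat.zero_le _) hs h).mono ?_
    fun _ h => h
  simp only [Finset.sum_const, Nat.card_Ico, smul_eq_mul, Nat.sub_zero, Nat.add_mul]
  omega

/-- The natural-number variables that a program may change. -/
def Prog.natVars : Prog → List ℕ
  | .setNat x _ => [x]
  | .seq p q => p.natVars ++ q.natVars
  | .ite _ p q => p.natVars ++ q.natVars
  | .loop _ p => p.natVars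
  | _ => []

/-- The natural-number arrays that a program may change. -/
def Prog.natArrs : Prog → List ℕ
  | .putNat a _ _ => [a]
  | .seq p q => p.natArrs ++ q.natArrs
  | .ite _ p q => p.natArrs ++ q.natArrs
  | .loop _ p => p.natArrs
  | _ => []

/-- The real arrays that a program may change. -/
def Prog.realArrs : Prog → List ℕ
  | .putReal a _ _ => [a]
  | .seq p q => p.realArrs ++ q.realArrs
  | .ite _ p q => p.realArrs ++ q.realArrs
  | .loop _ p => p.realArrs
  | _ => []

/-- The memories `s` and `s'` agree wherever `p` does not write, real variables excepted. -/
structure Frame (p : Prog) (s s' : State) : Prop where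
  nat : ∀ v, v ∉ p.natVars → s'.nat v = s.nat v
  arr : ∀ a, a ∉ p.natArrs → s'.natArr a = s.natArr a
  realArr : ∀ a, a ∉ p.realArrs → s'.realArr a = s.realArr a

theorem Exec.frame {p : Prog} {s s' : State} {t : ℕ} (h : Exec p s s' t) : Frame p s s' := by
  induction h with
  | skip => exact ⟨fun _ _ => rfl, fun _ _ => rfl, fun _ _ => rfl⟩
  | setNat s x e =>
    exact ⟨fun v hv => Function.update_of_ne (by simpa [Prog.natVars] using hv) _ _, fun _ _ => rfl,
      fun _ _ => rfl⟩
  | setReal s x e => exact ⟨fun _ _ => rfl, fun _ _ => rfl, fun _ _ => rfl⟩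
  | putNat s a i e =>
    exact ⟨fun _ _ => rfl, fun v hv => Function.update_of_ne (by simpa [Prog.natArrs] using hv) _ _,
      fun _ _ => rfl⟩
  | putReal s a i e =>
    exact ⟨fun _ _ => rfl, fun _ _ => rfl,
      fun v hv => Function.update_of_ne (by simpa [Prog.realArrs] using hv) _ _⟩
  | seq _ _ ih ih' =>
    refine ⟨fun v hv => ?_, fun v hv => ?_, fun v hv => ?_⟩ <;>
      simp only [Prog.natVars, Prog.natArrs, Prog.realArrs, List.mem_append, not_or] at hv
    · rw [ih'.nat v hv.2, ih.nat v hv.1]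
    · rw [ih'.arr v hv.2, ih.arr v hv.1]
    · rw [ih'.realArr v hv.2, ih.realArr v hv.1]
  | iteTrue _ _ ih =>
    refine ⟨fun v hv => ?_, fun v hv => ?_, fun v hv => ?_⟩ <;>
      simp only [Prog.natVars, Prog.natArrs, Prog.realArrs, List.mem_append, not_or] at hv
    · exact ih.nat v hv.1
    · exact ih.arr v hv.1
    · exact ih.realArr v hv.1
  | iteFalse _ _ ih =>
    refine ⟨fun v hv => ?_, fun v hv => ?_, fun v hv => ?_⟩ <;>
      simp only [Prog.natVars, Prog.natArrs, Prog.realArrs, List.mem_append, not_or] at hv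
    · exact ih.nat v hv.2
    · exact ih.arr v hv.2
    · exact ih.realArr v hv.2
  | loopTrue _ _ _ ih ih' =>
    refine ⟨fun v hv => ?_, fun v hv => ?_, fun v hv => ?_⟩
    · rw [ih'.nat v hv, ih.nat v hv]
    · rw [ih'.arr v hv, ih.arr v hv]
    · rw [ih'.realArr v hv, ih.realArr v hv]
  | loopFalse => exact ⟨fun _ _ => rfl, fun _ _ => rfl, fun _ _ => rfl⟩

theorem Runs.frame {p : Prog} {s : State} {T : ℕ} {Q : State → Prop} (h : Runs p s T Q) :
    Runs p s T fun s' => Q s' ∧ Frame p s s' := by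
  obtain ⟨s', t, h1, h2, h3⟩ := h
  exact ⟨s', t, h1, h2, h3, h1.frame⟩

theorem Frame.of_loopFree {p : Prog} (hp : p.loopFree = true) (s : State) : Frame p s (p.run s) := by
  obtain ⟨_, _, h1, _, rfl⟩ := Runs.of_loopFree hp (Q := fun s' => s' = p.run s) rfl
  exact h1.frame

end RealRAM

namespace Bowtie

/-! ### Slopes and heights -/

/-- The slope of the line through the points `b` and `d`. -/
noncomputable def slopeAt (x y : ℕ → ℝ) (b d : ℕ) : ℝ := (y d - y b) / (x d - x b)

/-- The height of the point `d` above the line of slope `m` through the point `b`. -/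
def ht (x y : ℕ → ℝ) (b : ℕ) (m : ℝ) (d : ℕ) : ℝ := y d - y b - m * (x d - x b)

theorem slopeAt_comm (x y : ℕ → ℝ) (b d : ℕ) : slopeAt x y b d = slopeAt x y d b := by
  unfold slopeAt
  rw [← neg_sub (y b), ← neg_sub (x b), neg_div_neg_eq]

section

variable {x y : ℕ → ℝ} {b c d : ℕ} {m : ℝ}

theorem ht_pos_iff_of_lt (h : x b < x d) : 0 < ht x y b m d ↔ m < slopeAt x y b d := by
  unfold ht slopeAt
  rw [lt_div_iff₀ (sub_pos.2 h), sub_pos]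

theorem ht_pos_iff_of_gt (h : x d < x b) : 0 < ht x y b m d ↔ slopeAt x y b d < m := by
  unfold ht slopeAt
  rw [div_lt_iff_of_neg (sub_neg.2 h), sub_pos]

theorem ht_eq_zero_iff (h : x b ≠ x d) : ht x y b m d = 0 ↔ m = slopeAt x y b d := by
  unfold ht slopeAt
  rw [eq_div_iff (sub_ne_zero.2 h.symm), sub_eq_zero, eq_comm]

theorem ht_neg_comm : ht x y d m b = - ht x y b m d := by unfold ht; ring

theorem ht_sub (a : ℕ) : ht x y b m d = ht x y a m d - ht x y a m b := by unfold ht; ring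

theorem ht_self : ht x y b m b = 0 := by unfold ht; ring

theorem ht_slopeAt_comm (h : x b ≠ x c) :
    ht x y b (slopeAt x y b c) d = ht x y c (slopeAt x y c b) d := by
  rw [slopeAt_comm x y c b, ht_sub (b := b) c, (ht_eq_zero_iff h.symm).2 (slopeAt_comm x y b c),
    sub_zero]

end

/-- The first `N` points have distinct `x`-coordinates and no three of them are collinear. -/
structure GenPos (N : ℕ) (x y : ℕ → ℝ) : Prop where
  inj : ∀ i < N, ∀ j < N, i ≠ j → x i ≠ x j
  slope : ∀ i < N, ∀ j < N, ∀ k < N, i ≠ j → i ≠ k → j ≠ k → slopeAt x y i j ≠ slopeAt x y i k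

/-- The lines through the point `b` whose slope is slightly larger than that of the line through `b`
and `q` (very small, if `q` is the end marker `N`) pass below the point `d`: a point `d` to the right of
`b` lies above these lines unless their slopes exceed that of the line through `b` and `d`, and a point
to the left of `b` behaves in the opposite way. -/
def Abv (N : ℕ) (x y : ℕ → ℝ) (b q d : ℕ) : Prop :=
  x b < x d ↔ ¬ (q ≠ N ∧ slopeAt x y b d ≤ slopeAt x y b q)

section

variable {N : ℕ} {x y : ℕ → ℝ}

theorem abv_iff_ht {b q d : ℕ} (h : GenPos N x y) (hb : b < N) (hq : q < N) (hd : d < N)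
    (hbq : b ≠ q) (hbd : b ≠ d) (hqd : q ≠ d) :
    Abv N x y b q d ↔ 0 < ht x y b (slopeAt x y b q) d := by
  have h2 := h.slope b hb q hq d hd hbq hbd hqd
  unfold Abv
  rcases lt_or_gt_of_ne (h.inj b hb d hd hbd) with h1 | h1
  · rw [ht_pos_iff_of_lt h1]
    simp only [h1, true_iff, hq.ne, ne_eq, not_false_eq_true, true_and, not_le]
  · rw [ht_pos_iff_of_gt h1]
    simp only [h1.not_gt, false_iff, hq.ne, ne_eq, not_false_eq_true, true_and, not_not]
    exact ⟨fun h => lt_of_le_of_ne h h2.symm, le_of_lt⟩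

/-- Whether `d` lies above the line through `b` and `c` can be read off at either point. -/
theorem abv_turn {b c d : ℕ} (h : GenPos N x y) (hb : b < N) (hc : c < N) (hd : d < N)
    (hbc : b ≠ c) (hbd : b ≠ d) (hcd : c ≠ d) : Abv N x y b c d ↔ Abv N x y c b d := by
  rw [abv_iff_ht h hb hc hd hbc hbd hcd, abv_iff_ht h hc hb hd hbc.symm hcd hbd,
    ht_slopeAt_comm (h.inj b hb c hc hbc)]

/-- If `c` follows `q` in the order of the slopes at `b`, then the lines just after `c` have every point
`d ≠ c` on the same side as the lines just after `q`. -/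
theorem abv_next {b q c d : ℕ} (h : GenPos N x y) (hb : b < N) (hc : c < N) (hd : d < N)
    (hbc : b ≠ c) (hbd : b ≠ d) (hcd : c ≠ d)
    (hnext : (q = N ∨ slopeAt x y b q < slopeAt x y b d) ↔ slopeAt x y b c ≤ slopeAt x y b d) :
    Abv N x y b c d ↔ Abv N x y b q d := by
  have h2 := h.slope b hb c hc d hd hbc hbd hcd
  have h3 : (c ≠ N ∧ slopeAt x y b d ≤ slopeAt x y b c) ↔
      (q ≠ N ∧ slopeAt x y b d ≤ slopeAt x y b q) := by
    rw [← not_iff_not, not_and_or, not_and_or, not_not, not_not, not_le, not_le, hnext]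
    constructor
    · rintro (h | h)
      · omega
      · exact h.le
    · exact fun h => Or.inr (lt_of_le_of_ne h h2)
  unfold Abv
  rw [h3]

/-- For points `i`, `j`, `k` from left to right, the slope of `ik` is between those of `ij`, `jk`. -/
theorem slopeAt_lt_of_lt {i j k : ℕ} (hij : x i < x j) (hjk : x j < x k)
    (h : slopeAt x y i j < slopeAt x y j k) :
    slopeAt x y i j < slopeAt x y i k ∧ slopeAt x y i k < slopeAt x y j k := by
  unfold slopeAt at *
  rw [div_lt_div_iff₀ (by linarith) (by linarith)] at h
  constructor <;> rw [div_lt_div_iff₀ (by linarith) (by linarith)] <;> nlinarith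

theorem slopeAt_gt_of_gt {i j k : ℕ} (hij : x i < x j) (hjk : x j < x k)
    (h : slopeAt x y j k < slopeAt x y i j) :
    slopeAt x y i k < slopeAt x y i j ∧ slopeAt x y j k < slopeAt x y i k := by
  unfold slopeAt at *
  rw [div_lt_div_iff₀ (by linarith) (by linarith)] at h
  constructor <;> rw [div_lt_div_iff₀ (by linarith) (by linarith)] <;> nlinarith

end

/-! ### Circular linked lists -/

/-- `nx` links the elements of `S`, sorted by `key`, into a circular list with the marker `e`: the
elements after `q` are those at or after `nx q`. This form of the condition says at once that no element
of `S` lies between `q` and `nx q`, and that the marker stands for both ends of the list. -/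
def Linked (e : ℕ) (key : ℕ → ℝ) (S : Set ℕ) (nx : ℕ → ℕ) : Prop :=
  ∀ q, (q = e ∨ q ∈ S) → (nx q = e ∨ nx q ∈ S) ∧
    ∀ j ∈ S, ((q = e ∨ key q < key j) ↔ (nx q ≠ e ∧ key (nx q) ≤ key j))

theorem Linked.congr {e : ℕ} {key : ℕ → ℝ} {S S' : Set ℕ} {nx nx' : ℕ → ℕ}
    (h : Linked e key S nx) (hS : S = S') (hn : ∀ q, (q = e ∨ q ∈ S) → nx' q = nx q) :
    Linked e key S' nx' := by
  subst hS
  intro q hq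
  rw [hn q hq]
  exact h q hq

theorem Linked.empty {e : ℕ} {key : ℕ → ℝ} {nx : ℕ → ℕ} (h : nx e = e) : Linked e key ∅ nx := by
  intro q hq
  simp only [Set.mem_empty_iff_false, or_false] at hq
  subst hq
  simp [h]

/-- Insertion of `v` between `q` and `nx q`. -/
theorem Linked.insert {e v q : ℕ} {key : ℕ → ℝ} {S : Set ℕ} {nx nx' : ℕ → ℕ}
    (h : Linked e key S nx) (hve : v ≠ e)
    (hinj : ∀ a ∈ S, ∀ b ∈ S, a ≠ b → key a ≠ key b)
    (hq : q = e ∨ q ∈ S) (hqv : q ≠ e → key q < key v) (hvn : nx q ≠ e → key v < key (nx q))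
    (h1 : nx' q = v) (h2 : nx' v = nx q)
    (h3 : ∀ z, (z = e ∨ z ∈ S) → z ≠ q → z ≠ v → nx' z = nx z) (hvS : v ∉ S) :
    Linked e key (insert v S) nx' := by
  intro z hz
  obtain ⟨hq1, hq2⟩ := h q hq
  by_cases hzv : z = v
  · subst hzv
    rw [h2]
    refine ⟨by grind, ?_⟩
    intro j hj
    rcases hj with rfl | hj
    · simp only [hve, lt_self_iff_false, or_self, false_iff, not_and, not_le]
      exact hvn
    · rw [← hq2 j hj]
      constructor
      · rintro (h | h)
        · exact absurd h hve
        · by_cases hqe : q = e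
          · exact Or.inl hqe
          · exact Or.inr ((hqv hqe).trans h)
      · intro h
        obtain ⟨h4, h5⟩ := (hq2 j hj).1 h
        exact Or.inr ((hvn h4).trans_le h5)
  by_cases hzq : z = q
  · subst hzq
    rw [h1]
    refine ⟨by simp, ?_⟩
    intro j hj
    rcases hj with rfl | hj
    · simp only [ne_eq, hve, not_false_eq_true, le_refl, and_self, iff_true]
      by_cases hqe : z = e
      · exact Or.inl hqe
      · exact Or.inr (hqv hqe)
    · rw [hq2 j hj]
      constructor
      · rintro ⟨h4, h5⟩
        exact ⟨hve, (hvn h4).le.trans h5⟩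
      · rintro ⟨_, h5⟩
        rw [← hq2 j hj]
        by_cases hqe : z = e
        · exact Or.inl hqe
        · exact Or.inr ((hqv hqe).trans_le h5)
  · have hz' : z = e ∨ z ∈ S := by grind
    rw [h3 z hz' hzq hzv]
    obtain ⟨hz1, hz2⟩ := h z hz'
    refine ⟨by grind, ?_⟩
    intro j hj
    rcases hj with rfl | hj
    · constructor
      · intro hlt
        have key1 : z = e ∨ (q ≠ e ∧ key z < key q) := by
          by_contra hcon
          push Not at hcon
          have hzS : z ∈ S := hz'.resolve_left hcon.1
          have hzlt := hlt.resolve_left hcon.1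
          have : q = e ∨ key q < key z := by
            by_cases hqe : q = e
            · exact Or.inl hqe
            · exact Or.inr (lt_of_le_of_ne (hcon.2 hqe)
                (hinj q (hq.resolve_left hqe) z hzS (Ne.symm hzq)))
          obtain ⟨h4, h5⟩ := (hq2 z hzS).1 this
          linarith [hvn h4]
        by_cases hqe : q = e
        · grind
        · obtain ⟨h4, h5⟩ := (hz2 q (hq.resolve_left hqe)).1 (by tauto)
          exact ⟨h4, h5.trans (hqv hqe).le⟩
      · rintro ⟨h4, h5⟩
        rcases (hz2 _ (hz1.resolve_left h4)).2 ⟨h4, le_rfl⟩ with h | h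
        · exact Or.inl h
        · exact Or.inr (h.trans_le h5)
    · exact hz2 j hj

end Bowtie

namespace Bowtie

/-! ### Insertion of a line into an arrangement

The point `(a, c)` is dual to the line `v = c - a u`, whose height at `u` is the intercept of the line of
slope `u` through the point. The lines dual to the points `i` and `j` cross at `u = slopeAt x y i j`, and
`Abv N x y j q d` says that the line `d` lies above the line `j` just to the right of the crossing of `j`
and `q`. The points are sorted by their `x`-coordinates, so that a new line `l` is steeper, downwards, than
the lines `0, …, l - 1`. It starts above all of them and crosses each of them once. -/

/-- The state of the walk along a new line `l` through the arrangement of the lines dual to the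
points `0, …, l - 1`. `X` is the set of lines that `l` has crossed so far, and the walk is on the
edge of the line `j` just to the right of its crossing with `q` (at its left end if `q = N`); this edge
lies on the boundary of the face that `l` is in after these crossings: on its lower boundary if `j ∉ X`, and
on its upper boundary if `j ∈ X`. -/
structure Walk (N l : ℕ) (x y : ℕ → ℝ) (X : Finset ℕ) (j q : ℕ) : Prop where
  hj : j < l
  hq : q = N ∨ (q < l ∧ q ≠ j)
  hX : X ⊆ Finset.range l
  rel : ∀ c < l, c ≠ j → (c ∈ X ↔ Abv N x y j q c)
  lt : q ≠ N → slopeAt x y j q < slopeAt x y j l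
  init : ∀ c ∈ X, ∀ d < l, d ∉ X → slopeAt x y l c < slopeAt x y l d

section

variable {N l j q k : ℕ} {x y : ℕ → ℝ} {X Y D E : Finset ℕ}

theorem Walk.rel_turn (h : GenPos N x y) (hl : l < N) (w : Walk N l x y X j q)
    (hq : q < N) (c : ℕ) (hc : c < l) (hcj : c ≠ j) (hcq : c ≠ q) :
    c ∈ X ↔ Abv N x y q j c := by
  have := w.hj
  have := w.hq
  rw [w.rel c hc hcj, abv_turn h] <;> omega

theorem Walk.mem_iff (hm : ∀ i < N, ∀ j < N, (x i < x j ↔ i < j)) (hl : l < N)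
    (w : Walk N l x y X j q) (hq : q < N) : q ∈ X ↔ q < j := by
  have := w.hj
  have := w.hq
  rw [w.rel q (by omega) (by omega)]
  unfold Abv
  rw [hm j (by omega) q hq]
  simp only [hq.ne, ne_eq, not_false_eq_true, le_refl, and_self, not_true_eq_false, iff_false]
  omega

/-- The walk turns at a vertex of the lower boundary of the face. -/
theorem Walk.lower_bend (h : GenPos N x y) (hm : ∀ i < N, ∀ j < N, (x i < x j ↔ i < j))
    (hl : l < N) (w : Walk N l x y X j q) (hjX : j ∉ X) (hk : k < l) (hkj : k ≠ j)
    (hnext : ∀ d < l, d ≠ j →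
      ((q = N ∨ slopeAt x y j q < slopeAt x y j d) ↔ slopeAt x y j k ≤ slopeAt x y j d))
    (hlt : slopeAt x y j k < slopeAt x y j l) : k < j ∧ k ∉ X ∧ Walk N l x y X k j := by
  have hj := w.hj
  have hkX : k ∈ X ↔ j < k := by
    rw [w.rel k hk hkj]
    unfold Abv
    rw [hm j (by omega) k (by omega)]
    have := (hnext k hk hkj).2 le_rfl
    rw [← not_lt]
    grind
  have hlt' : k < j := by
    by_contra hcon
    have hjk : j < k := by omega
    have h1 := (slopeAt_lt_of_lt ((hm j (by omega) k (by omega)).2 hjk)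
      ((hm k (by omega) l (by omega)).2 hk) (by
        by_contra hcon
        rcases lt_or_eq_of_le (not_lt.1 hcon) with h3 | h3
        · have := (slopeAt_gt_of_gt ((hm j (by omega) k (by omega)).2 hjk)
            ((hm k (by omega) l (by omega)).2 hk) h3).1
          linarith
        · rw [slopeAt_comm x y j k] at h3
          exact h.slope k (by omega) l (by omega) j (by omega) (by omega) (by omega) (by omega) h3)).2
    have h2 := w.init k (hkX.2 hjk) j hj hjX
    rw [slopeAt_comm x y l k, slopeAt_comm x y l j] at h2
    linarith
  have hkX' : k ∉ X := by rw [hkX]; omega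
  refine ⟨hlt', hkX', hk, Or.inr ⟨hj, by omega⟩, w.hX, ?_, ?_, w.init⟩
  · intro c hc hck
    by_cases hcj : c = j
    · subst hcj
      refine iff_of_false hjX ?_
      unfold Abv
      rw [hm k (by omega) c (by omega)]
      simp only [hlt', (show c ≠ N by omega), ne_eq, not_false_eq_true, le_refl, and_self,
        not_true_eq_false, iff_false]
    · rw [w.rel c hc hcj, ← abv_turn h (by omega) (by omega) (by omega) hkj.symm (by omega) (by omega),
        abv_next h (by omega) (by omega) (by omega) (by omega) (by omega) (by omega)
          (hnext c hc hcj)]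
  · intro _
    have hx1 := (hm k (by omega) j (by omega)).2 hlt'
    have hx2 := (hm j (by omega) l (by omega)).2 hj
    rw [slopeAt_comm x y j k] at hlt
    exact (slopeAt_lt_of_lt hx1 hx2 hlt).1

/-- The new line crosses the edge on which the walk is. -/
theorem Walk.exit (h : GenPos N x y) (hm : ∀ i < N, ∀ j < N, (x i < x j ↔ i < j))
    (hl : l < N) (w : Walk N l x y X j q) (hjX : j ∉ X) (hk : k = N ∨ (k < l ∧ k ≠ j))
    (hnext : ∀ d < l, d ≠ j → ((q = N ∨ slopeAt x y j q < slopeAt x y j d) ↔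
      (k ≠ N ∧ slopeAt x y j k ≤ slopeAt x y j d)))
    (hlt : k ≠ N → slopeAt x y j l < slopeAt x y j k) :
    Walk N l x y (insert j X) j q ∧ ∀ c ∈ X, slopeAt x y l c < slopeAt x y l j := by
  have hj := w.hj
  have hbef : ∀ d < l, d ≠ j → ((q ≠ N ∧ slopeAt x y j d ≤ slopeAt x y j q) ↔
      slopeAt x y j d < slopeAt x y j l) := by
    intro d hd hdj
    constructor
    · rintro ⟨h1, h2⟩
      exact h2.trans_lt (w.lt h1)
    · intro h1
      by_contra hcon
      obtain ⟨h2, h3⟩ := (hnext d hd hdj).1 (by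
        by_cases hqN : q = N
        · exact Or.inl hqN
        · exact Or.inr (not_le.1 fun h => hcon ⟨hqN, h⟩))
      linarith [hlt h2]
  have key : ∀ d < l, d ≠ j → (d ∈ X ↔ slopeAt x y l d < slopeAt x y l j) := by
    intro d hd hdj
    rw [w.rel d hd hdj]
    unfold Abv
    rw [hbef d hd hdj, hm j (by omega) d (by omega), slopeAt_comm x y l d, slopeAt_comm x y l j]
    have hxd := (hm d (by omega) l (by omega)).2 hd
    have hxj := (hm j (by omega) l (by omega)).2 hj
    have hne : slopeAt x y j d ≠ slopeAt x y j l :=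
      h.slope j (by omega) d (by omega) l (by omega) (by omega) (by omega) (by omega)
    have hne' : slopeAt x y d j ≠ slopeAt x y d l :=
      h.slope d (by omega) j (by omega) l (by omega) (by omega) (by omega) (by omega)
    rcases lt_or_gt_of_ne hdj with hlt | hlt
    · have hx := (hm d (by omega) j (by omega)).2 hlt
      simp only [hlt.not_gt, false_iff, not_not]
      rw [slopeAt_comm x y j d] at hne ⊢
      rcases lt_or_gt_of_ne hne with h1 | h1
      · have := slopeAt_lt_of_lt hx hxj h1
        exact iff_of_true h1 this.2
      · have := slopeAt_gt_of_gt hx hxj h1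
        exact iff_of_false h1.not_gt this.2.not_gt
    · have hx := (hm j (by omega) d (by omega)).2 hlt
      simp only [hlt, true_iff]
      rw [slopeAt_comm x y d j] at hne'
      rcases lt_or_gt_of_ne hne' with h1 | h1
      · have := slopeAt_lt_of_lt hx hxd h1
        exact iff_of_false (not_not.2 this.1) this.2.not_gt
      · have := slopeAt_gt_of_gt hx hxd h1
        exact iff_of_true (not_lt.2 this.1.le) (by linarith)
  refine ⟨⟨hj, w.hq, ?_, ?_, w.lt, ?_⟩, ?_⟩
  · intro c hc
    rcases Finset.mem_insert.1 hc with rfl | hc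
    · exact Finset.mem_range.2 hj
    · exact w.hX hc
  · intro c hc hcj
    rw [← w.rel c hc hcj, Finset.mem_insert]
    tauto
  · intro c hc d hd hdX
    rw [Finset.mem_insert, not_or] at hdX
    rcases Finset.mem_insert.1 hc with rfl | hc
    · have := mt (key d hd hdX.1).2 hdX.2
      refine lt_of_le_of_ne (not_lt.1 this) ?_
      exact h.slope l hl c (by omega) d (by omega) (by omega) (by omega) (Ne.symm hdX.1)
    · exact w.init c hc d hd hdX.2
  · intro c hc
    have := Finset.mem_range.1 (w.hX hc)
    exact (key c this (by rintro rfl; exact hjX hc)).1 hc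

/-- The walk turns at a vertex of the upper boundary of the face, where it moves to the left. -/
theorem Walk.upper_bend (h : GenPos N x y) (hm : ∀ i < N, ∀ j < N, (x i < x j ↔ i < j))
    (hl : l < N) (w : Walk N l x y X j q) (hjX : j ∈ X) (hqj : q < j)
    (hk : k = N ∨ (k ≤ l ∧ k ≠ q))
    (hprev : ∀ d ≤ l, d ≠ q → (slopeAt x y q d < slopeAt x y q j ↔
      (k ≠ N ∧ slopeAt x y q d ≤ slopeAt x y q k))) :
    q ∈ X ∧ Walk N l x y X q k := by
  have hj := w.hj
  have hqX : q ∈ X := (w.mem_iff hm hl (by omega)).2 hqj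
  have hlt : slopeAt x y q j < slopeAt x y q l := by
    have h1 := w.lt (by omega)
    rw [slopeAt_comm x y j q] at h1
    exact (slopeAt_lt_of_lt ((hm q (by omega) j (by omega)).2 hqj)
      ((hm j (by omega) l (by omega)).2 hj) h1).1
  have hkl : k ≠ N → slopeAt x y q k < slopeAt x y q j := fun hkN =>
    (hprev k (by omega) (by omega)).2 ⟨hkN, le_rfl⟩
  refine ⟨hqX, by omega, ?_, w.hX, ?_, fun hkN => (hkl hkN).trans hlt, w.init⟩
  · rcases hk with hk | ⟨hk, hk'⟩
    · exact Or.inl hk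
    · refine Or.inr ⟨lt_of_le_of_ne hk ?_, hk'⟩
      rintro rfl
      linarith [hkl (by omega)]
  · intro c hc hcq
    by_cases hcj : c = j
    · subst hcj
      refine iff_of_true hjX ?_
      unfold Abv
      rw [hm q (by omega) c (by omega), ← hprev c (by omega) (by omega)]
      simp [hqj]
    · rw [w.rel_turn h hl (by omega) c hc hcj hcq]
      unfold Abv
      rw [← hprev c (by omega) hcq]
      have hne : slopeAt x y q c ≠ slopeAt x y q j :=
        h.slope q (by omega) c (by omega) j (by omega) (by omega) (by omega) (by omega)
      have h1 : slopeAt x y q c < slopeAt x y q j ↔ slopeAt x y q c ≤ slopeAt x y q j :=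
        ⟨le_of_lt, fun h => lt_of_le_of_ne h hne⟩
      rw [h1]
      simp only [ne_eq, (show j ≠ N by omega), not_false_eq_true, true_and]

/-- The walk passes the leftmost vertex of the face. -/
theorem Walk.turn (h : GenPos N x y) (hm : ∀ i < N, ∀ j < N, (x i < x j ↔ i < j))
    (hl : l < N) (w : Walk N l x y X j q) (hjX : j ∈ X) (hqN : q ≠ N) (hqj : ¬ q < j) :
    q ∉ X ∧ Walk N l x y X q j := by
  have hj := w.hj
  have hq := w.hq.resolve_left hqN
  have hqX : q ∉ X := mt (w.mem_iff hm hl (by omega)).1 hqj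
  refine ⟨hqX, hq.1, Or.inr ⟨hj, hq.2.symm⟩, w.hX, ?_, ?_, w.init⟩
  · intro c hc hcq
    by_cases hcj : c = j
    · subst hcj
      refine iff_of_true hjX ?_
      unfold Abv
      rw [hm q (by omega) c (by omega)]
      simp [hqj, (show c ≠ N by omega)]
    · rw [w.rel_turn h hl (by omega) c hc hcj hcq]
  · intro _
    have h1 := w.lt hqN
    have hx1 := (hm j (by omega) q (by omega)).2 (by omega)
    have hx2 := (hm q (by omega) l (by omega)).2 hq.1
    rw [slopeAt_comm x y q j]
    have hne : slopeAt x y q j ≠ slopeAt x y q l :=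
      h.slope q (by omega) j (by omega) l (by omega) (by omega) (by omega) (by omega)
    rw [slopeAt_comm x y q j] at hne
    rcases lt_or_gt_of_ne hne with h2 | h2
    · exact h2
    · linarith [slopeAt_gt_of_gt hx1 hx2 h2]

/-- The walk enters the lower boundary of a face that is unbounded to the left. -/
theorem Walk.turn_left_end (hm : ∀ i < N, ∀ j < N, (x i < x j ↔ i < j))
    (hl : l < N) (w : Walk N l x y X j N) (hjX : j ∈ X) (hcard : X.card < l) :
    j - 1 ∉ X ∧ Walk N l x y X (j - 1) N := by
  have hj := w.hj
  have hX : ∀ c < l, (c ∈ X ↔ j ≤ c) := by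
    intro c hc
    by_cases hcj : c = j
    · subst hcj; simp [hjX]
    · rw [w.rel c hc hcj]
      unfold Abv
      rw [hm j (by omega) c (by omega)]
      simp
      omega
  have hj0 : j ≠ 0 := by
    rintro rfl
    have : X = Finset.range l := by
      ext c
      constructor
      · exact fun h => w.hX h
      · exact fun h => (hX c (Finset.mem_range.1 h)).2 (Nat.zero_le _)
    simp [this] at hcard
  refine ⟨by rw [hX _ (by omega)]; omega, by omega, Or.inl rfl, w.hX, ?_, by simp, w.init⟩
  intro c hc hcj
  rw [hX c hc]
  unfold Abv
  rw [hm _ (by omega) c (by omega)]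
  simp
  omega

theorem Walk.start (hm : ∀ i < N, ∀ j < N, (x i < x j ↔ i < j)) (hl : l < N) (h0 : 0 < l) :
    Walk N l x y ∅ (l - 1) N := by
  refine ⟨by omega, Or.inl rfl, by simp, ?_, by simp, by simp⟩
  intro c hc hcj
  unfold Abv
  rw [hm _ (by omega) c (by omega)]
  simp
  omega

/-- An upper vertex is determined by the line that ends there: `q` is the last line before `l` that
crosses `j` and starts below it. -/
theorem Walk.upper_unique {q' : ℕ} (h : GenPos N x y) (hm : ∀ i < N, ∀ j < N, (x i < x j ↔ i < j))
    (hl : l < N) (w : Walk N l x y X j q) (w' : Walk N l x y Y j q') (hjX : j ∈ X) (hjY : j ∈ Y)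
    (hq : q < j) (hq' : q' < j) : X = Y := by
  have hj := w.hj
  have key : ∀ {Z : Finset ℕ} {p : ℕ}, Walk N l x y Z j p → j ∈ Z → p < j →
      ∀ c < j, slopeAt x y j c < slopeAt x y j l → slopeAt x y j c ≤ slopeAt x y j p := by
    intro Z p wz hjZ hp c hc hlt
    have hcZ : c ∈ Z := by
      by_contra hcon
      have h1 := wz.init j hjZ c (by omega) hcon
      rw [slopeAt_comm x y j c] at hlt
      rw [slopeAt_comm x y l j, slopeAt_comm x y l c] at h1
      linarith [slopeAt_lt_of_lt ((hm c (by omega) j (by omega)).2 hc)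
        ((hm j (by omega) l (by omega)).2 hj) hlt]
    have h1 := (wz.rel c (by omega) (by omega)).1 hcZ
    unfold Abv at h1
    rw [hm _ (by omega) c (by omega)] at h1
    have h2 : ¬ (j < c) := by omega
    simp only [h2, false_iff, not_not] at h1
    exact h1.2
  have hqq : q = q' := by
    by_contra hne
    exact h.slope j (by omega) q (by omega) q' (by omega) (by omega) (by omega) hne
      (le_antisymm (key w' hjY hq' q hq (w.lt (by omega))) (key w hjX hq q' hq' (w'.lt (by omega))))
  subst hqq
  ext c
  by_cases hc : c < l
  · by_cases hcj : c = j
    · subst hcj; simp [hjX, hjY]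
    · rw [w.rel c hc hcj, w'.rel c hc hcj]
  · have h1 : c ∉ X := fun hcX => hc (Finset.mem_range.1 (w.hX hcX))
    have h2 : c ∉ Y := fun hcX => hc (Finset.mem_range.1 (w'.hX hcX))
    simp [h1, h2]

/-- A lower vertex is determined by the line that starts there. -/
theorem Walk.lower_unique {q' : ℕ} (h : GenPos N x y) (hm : ∀ i < N, ∀ j < N, (x i < x j ↔ i < j))
    (hl : l < N) (w : Walk N l x y X j q) (w' : Walk N l x y Y j q') (hjX : j ∉ X) (hjY : j ∉ Y)
    (hq : j < q) (hq' : j < q') (hqN : q ≠ N) (hqN' : q' ≠ N) : X = Y := by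
  have hj := w.hj
  have hql := w.hq
  have hql' := w'.hq
  have key : ∀ {Z : Finset ℕ} {p : ℕ}, Walk N l x y Z j p → j ∉ Z → j < p → p ≠ N →
      ∀ c < l, j < c → slopeAt x y j c < slopeAt x y j l → slopeAt x y j c ≤ slopeAt x y j p := by
    intro Z p wz hjZ hp hpN c hcl hc hlt
    have hcZ : c ∉ Z := by
      intro hcon
      have h1 := wz.init c hcon j hj hjZ
      rw [slopeAt_comm x y l j, slopeAt_comm x y l c] at h1
      have hx1 := (hm j (by omega) c (by omega)).2 hc
      have hx2 := (hm c (by omega) l (by omega)).2 hcl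
      have hne : slopeAt x y c j ≠ slopeAt x y c l :=
        h.slope c (by omega) j (by omega) l (by omega) (by omega) (by omega) (by omega)
      rw [slopeAt_comm x y c j] at hne
      rcases lt_or_gt_of_ne hne with h2 | h2
      · linarith [slopeAt_lt_of_lt hx1 hx2 h2]
      · linarith [slopeAt_gt_of_gt hx1 hx2 h2]
    have h1 := mt (wz.rel c (by omega) (by omega)).2 hcZ
    unfold Abv at h1
    rw [hm _ (by omega) c (by omega)] at h1
    simp only [hc, true_iff, not_not] at h1
    exact h1.2
  have hqq : q = q' := by
    by_contra hne
    exact h.slope j (by omega) q (by omega) q' (by omega) (by omega) (by omega) hne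
      (le_antisymm (key w' hjY hq' hqN' q (by omega) hq (w.lt hqN))
        (key w hjX hq hqN q' (by omega) hq' (w'.lt hqN')))
  subst hqq
  ext c
  by_cases hc : c < l
  · by_cases hcj : c = j
    · subst hcj; simp [hjX, hjY]
    · rw [w.rel c hc hcj, w'.rel c hc hcj]
  · have h1 : c ∉ X := fun hcX => hc (Finset.mem_range.1 (w.hX hcX))
    have h2 : c ∉ Y := fun hcX => hc (Finset.mem_range.1 (w'.hX hcX))
    simp [h1, h2]

end

end Bowtie

namespace Bowtie

/-! ### The lists of crossings, and the length of the walk -/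

/-- The lines that the line `c` meets in the arrangement of the lines `0, …, l - 1` and the part of
the line `l` on which it crosses the lines of `X`. -/
def nbr (l : ℕ) (X : Finset ℕ) (c : ℕ) : Set ℕ :=
  {d | (d < l ∧ c < l ∧ d ≠ c) ∨ (c = l ∧ d ∈ X) ∨ (d = l ∧ c ∈ X)}

/-- For every line `c`, the lists `nx c` and `pv c` hold its crossings in increasing and in
decreasing order of slope. -/
def Lists (N l : ℕ) (x y : ℕ → ℝ) (X : Finset ℕ) (nx pv : ℕ → ℕ → ℕ) : Prop :=
  ∀ c ≤ l, Linked N (slopeAt x y c) (nbr l X c) (nx c) ∧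
    Linked N (fun d => - slopeAt x y c d) (nbr l X c) (pv c)

section

variable {N l j q k tl : ℕ} {x y : ℕ → ℝ} {X Y D E : Finset ℕ} {nx pv nx' pv' : ℕ → ℕ → ℕ}

theorem nbr_insert_of_ne {c : ℕ} (hcj : c ≠ j) (hcl : c ≠ l) : nbr l (insert j X) c = nbr l X c := by
  ext d
  simp [nbr, hcj, hcl]

theorem nbr_insert_old (hj : j < l) : nbr l (insert j X) j = insert l (nbr l X j) := by
  ext d
  simp [nbr, hj, hj.ne]
  tauto

theorem nbr_insert_new (hX : X ⊆ Finset.range l) (hj : j < l) :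
    nbr l (insert j X) l = insert j (nbr l X l) := by
  have : l ∉ X := fun h => by simpa using hX h
  ext d
  simp [nbr, hj.ne', this]

/-- The crossing of `l` and `j` is entered into the lists of both lines. In the list of `l` it is the last
one, as `l` is followed from left to right. -/
theorem Lists.exit (h : GenPos N x y) (hl : l < N) (hL : Lists N l x y X nx pv)
    (w : Walk N l x y X j q) (hjX : j ∉ X) (hk : k = nx j q) (htl : tl = pv l N)
    (hlt : k ≠ N → slopeAt x y j l < slopeAt x y j k)
    (hmax : ∀ c ∈ X, slopeAt x y l c < slopeAt x y l j)
    (hn : ∀ c ≤ l, ∀ d ≤ N, nx' c d = if c = l ∧ d = j then N else if c = l ∧ d = tl then j else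
      if c = j ∧ d = l then k else if c = j ∧ d = q then l else nx c d)
    (hp : ∀ c ≤ l, ∀ d ≤ N, pv' c d = if c = l ∧ d = N then j else if c = l ∧ d = j then tl else
      if c = j ∧ d = k then l else if c = j ∧ d = l then pv j k else pv c d) :
    Lists N l x y (insert j X) nx' pv' := by
  have hj := w.hj
  have hXl : ∀ c ∈ X, c < l := fun c hc => Finset.mem_range.1 (w.hX hc)
  have hle : ∀ c ≤ l, ∀ z, (z = N ∨ z ∈ nbr l X c) → z ≤ N := by
    rintro c hc z (rfl | hz)
    · exact le_rfl
    · rcases hz with ⟨h1, -⟩ | ⟨-, h1⟩ | ⟨h1, -⟩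
      · omega
      · have := hXl z h1; omega
      · omega
  have hinj : ∀ c ≤ l, ∀ a ∈ nbr l X c, ∀ b ∈ nbr l X c, a ≠ b →
      slopeAt x y c a ≠ slopeAt x y c b := by
    intro c hc a ha b hb hab
    have hca : ∀ a ∈ nbr l X c, a < N ∧ c ≠ a := by
      intro a ha
      rcases ha with ⟨h1, h2, h3⟩ | ⟨h2, h1⟩ | ⟨h1, h2⟩
      · exact ⟨by omega, by omega⟩
      · have := hXl a h1; exact ⟨by omega, by omega⟩
      · have := hXl c h2; exact ⟨by omega, by omega⟩
    exact h.slope c (by omega) a (hca a ha).1 b (hca b hb).1 (hca a ha).2 (hca b hb).2 hab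
  intro c hc
  by_cases hcj : c = j
  · subst hcj
    obtain ⟨hn1, hp1⟩ := hL c hc
    have hcl : c ≠ l := by omega
    have hqS : q = N ∨ q ∈ nbr l X c := by
      rcases w.hq with h | h
      · exact Or.inl h
      · exact Or.inr (Or.inl ⟨h.1, hj, h.2⟩)
    have hql : q ≠ l := by rcases w.hq with h | h <;> omega
    have hlS : l ∉ nbr l X c := by simp [nbr, hjX, hcl]
    obtain ⟨hkS, hk2⟩ := hn1 q hqS
    rw [← hk] at hkS hk2
    have hkN := hle c hc k hkS
    rw [nbr_insert_old hj]
    constructor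
    · refine hn1.insert (v := l) (q := q) (by omega) (hinj c hc) hqS w.lt (hk ▸ hlt) ?_ ?_ ?_ hlS
      · rw [hn c hc q (hle c hc q hqS)]; simp [hcl, hql]
      · rw [hn c hc l (by omega)]; simp [hcl, hk]
      · intro z hz hzq hzl
        rw [hn c hc z (hle c hc z hz)]; simp [hcl, hzq, hzl]
    · refine hp1.insert (v := l) (q := k) (by omega)
        (fun a ha b hb hab => by simpa using hinj c hc a ha b hb hab) hkS
        (fun hkN => neg_lt_neg (hlt hkN)) ?_ ?_ ?_ ?_ hlS
      · intro hpN
        obtain ⟨hp2, hp3⟩ := hp1 k hkS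
        have hpS := hp2.resolve_left hpN
        have h1 := (hp3 _ hpS).2 ⟨hpN, le_rfl⟩
        simp only [neg_lt_neg_iff] at h1 ⊢
        have hpl : pv c k ≠ l := fun h => hlS (h ▸ hpS)
        have h2 := hk2 _ hpS
        by_contra hcon
        obtain ⟨h3, h4⟩ := h2.1 (by
          by_cases hqN : q = N
          · exact Or.inl hqN
          · exact Or.inr ((w.lt hqN).trans_le (not_lt.1 hcon)))
        have h5 := h1.resolve_left h3
        linarith
      · rw [hp c hc k hkN]; simp [hcl]
      · rw [hp c hc l (by omega)]
        have : l ≠ k := by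
          rintro rfl
          rcases hkS with h | h
          · omega
          · exact hlS h
        simp [hcl, this]
      · intro z hz hzq hzl
        rw [hp c hc z (hle c hc z hz)]; simp [hcl, hzq, hzl]
  by_cases hcl : c = l
  · subst hcl
    obtain ⟨hn1, hp1⟩ := hL c hc
    obtain ⟨htS, ht2⟩ := hp1 N (Or.inl rfl)
    rw [← htl] at htS ht2
    have hS : ∀ d, d ∈ nbr c X c ↔ d ∈ X := by
      intro d
      have : c ∉ X := fun h => (hXl c h).false
      simp [nbr, this]
    have hjS : j ∉ nbr c X c := by rwa [hS]
    have hjtl : j ≠ tl := by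
      rintro rfl
      rcases htS with h | h
      · omega
      · exact hjS h
    have hnt : nx c tl = N := by
      obtain ⟨hn2, hn3⟩ := hn1 tl htS
      by_contra hcon
      have hm := hn2.resolve_left hcon
      have h1 := (hn3 _ hm).2 ⟨hcon, le_rfl⟩
      have h2 := (ht2 _ hm).1 (Or.inl rfl)
      have h3 := h1.resolve_left h2.1
      linarith [h2.2]
    rw [nbr_insert_new w.hX hj]
    constructor
    · refine hn1.insert (v := j) (q := tl) (by omega) (hinj c hc) htS ?_ (by simp [hnt]) ?_ ?_ ?_ hjS
      · intro htN
        exact hmax _ ((hS _).1 (htS.resolve_left htN))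
      · rw [hn c hc tl (hle c hc tl htS)]; simp [hjtl.symm]
      · rw [hn c hc j (by omega)]; simp [hnt]
      · intro z hz hzq hzl
        rw [hn c hc z (hle c hc z hz)]; simp [hzq, hzl, hcj]
    · refine hp1.insert (v := j) (q := N) (by omega)
        (fun a ha b hb hab => by simpa using hinj c hc a ha b hb hab) (Or.inl rfl) (by simp)
        ?_ ?_ ?_ ?_ hjS
      · rw [← htl]
        intro htN
        exact neg_lt_neg (hmax _ ((hS _).1 (htS.resolve_left htN)))
      · rw [hp c hc N le_rfl]; simp
      · rw [hp c hc j (by omega)]; simp [htl, (show j ≠ N by omega)]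
      · intro z hz hzq hzl
        rw [hp c hc z (hle c hc z hz)]; simp [hzq, hzl, hcj]
  · obtain ⟨hn1, hp1⟩ := hL c hc
    constructor
    · refine hn1.congr (nbr_insert_of_ne hcj hcl).symm ?_
      intro z hz
      rw [hn c hc z (hle c hc z hz)]; simp [hcj, hcl]
    · refine hp1.congr (nbr_insert_of_ne hcj hcl).symm ?_
      intro z hz
      rw [hp c hc z (hle c hc z hz)]; simp [hcj, hcl]

/-- Starting the list of a new line `l`. -/
theorem Lists.start (hL : ∀ c < l, Linked N (slopeAt x y c) {d | d < l ∧ d ≠ c} (nx c) ∧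
      Linked N (fun d => - slopeAt x y c d) {d | d < l ∧ d ≠ c} (pv c))
    (hn : nx l N = N) (hp : pv l N = N) : Lists N l x y ∅ nx pv := by
  intro c hc
  by_cases hcl : c = l
  · subst hcl
    have : nbr c ∅ c = ∅ := by ext d; simp [nbr]
    rw [this]
    exact ⟨Linked.empty hn, Linked.empty hp⟩
  · have : {d | d < l ∧ d ≠ c} = nbr l ∅ c := by
      ext d; simp [nbr]; omega
    rw [← this]
    exact hL c (by omega)

theorem Lists.finish (hL : Lists N l x y (Finset.range l) nx pv) (c : ℕ) (hc : c < l + 1) :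
    Linked N (slopeAt x y c) {d | d < l + 1 ∧ d ≠ c} (nx c) ∧
      Linked N (fun d => - slopeAt x y c d) {d | d < l + 1 ∧ d ≠ c} (pv c) := by
  have : {d | d < l + 1 ∧ d ≠ c} = nbr l (Finset.range l) c := by
    ext d; simp [nbr]; omega
  rw [this]
  exact hL c (by omega)

/-- The state of the walk, with the set `D` of the lines at which an upper vertex was passed, and the
set `E` of the lines at which a lower vertex was passed. Each line is counted at most once in each of
them, which bounds the length of the walk, and amounts to the zone theorem. Indeed, a vertex at which `j`
enters `D` or `E` determines `X`, by `Walk.upper_unique` and `Walk.lower_unique`, and while `X` does not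
change, the walk proceeds along each of the two boundaries through lines of decreasing index. -/
structure WalkCount (N l : ℕ) (x y : ℕ → ℝ) (X D E : Finset ℕ) (j q mode : ℕ) : Prop where
  walk : Walk N l x y X j q
  mode_iff : j ∈ X ↔ mode ≠ 0
  hD : ∀ d ∈ D, ∃ p Y, Walk N l x y Y d p ∧ d ∈ Y ∧ p < d ∧ Y ⊆ X ∧ (Y = X → mode = 0 ∨ j < d)
  hE : ∀ d ∈ E, ∃ p Y, Walk N l x y Y d p ∧ d ∉ Y ∧ d < p ∧ p ≠ N ∧ Y ⊆ X ∧
    (Y = X → mode = 0 ∧ j ≤ d)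

/-- A bound on the number of steps of the walk that are left. Every step adds an element to one of the three
sets, or else switches from mode `1` to mode `0`, and only a crossing sets the mode to `1`. -/
def walkFuel (l : ℕ) (X D E : Finset ℕ) (mode : ℕ) : ℕ :=
  3 * (l - X.card) + (l - D.card) + (l - E.card) + mode

theorem WalkCount.card_le {mode : ℕ} (w : WalkCount N l x y X D E j q mode) :
    X.card ≤ l ∧ D.card ≤ l ∧ E.card ≤ l := by
  refine ⟨?_, ?_, ?_⟩
  · simpa using Finset.card_le_card w.walk.hX
  · have : D ⊆ Finset.range l := fun d hd => by
      obtain ⟨p, Y, h, -⟩ := w.hD d hd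
      exact Finset.mem_range.2 h.hj
    simpa using Finset.card_le_card this
  · have : E ⊆ Finset.range l := fun d hd => by
      obtain ⟨p, Y, h, -⟩ := w.hE d hd
      exact Finset.mem_range.2 h.hj
    simpa using Finset.card_le_card this

theorem WalkCount.lower_bend (h : GenPos N x y) (hm : ∀ i < N, ∀ j < N, (x i < x j ↔ i < j))
    (hl : l < N) (w : WalkCount N l x y X D E j q 0) (hkj : k < j) (hkX : k ∉ X)
    (wk : Walk N l x y X k j) :
    WalkCount N l x y X D (insert k E) k j 0 ∧ k ∉ E := by
  have hj := w.walk.hj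
  refine ⟨⟨wk, by simp [hkX], ?_, ?_⟩, ?_⟩
  · intro d hd
    obtain ⟨p, Y, h1, h2, h3, h4, h5⟩ := w.hD d hd
    exact ⟨p, Y, h1, h2, h3, h4, fun _ => Or.inl rfl⟩
  · intro d hd
    rcases Finset.mem_insert.1 hd with rfl | hd
    · exact ⟨j, X, wk, hkX, hkj, by omega, subset_rfl, fun _ => ⟨rfl, le_rfl⟩⟩
    · obtain ⟨p, Y, h1, h2, h3, h4, h5, h6⟩ := w.hE d hd
      exact ⟨p, Y, h1, h2, h3, h4, h5, fun h => ⟨rfl, hkj.le.trans (h6 h).2⟩⟩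
  · intro hkE
    obtain ⟨p, Y, h1, h2, h3, h4, h5, h6⟩ := w.hE k hkE
    have := h6 (Walk.lower_unique h hm hl h1 wk h2 hkX h3 hkj h4 (by omega))
    omega

theorem WalkCount.exit (hjX : j ∉ X) (w : WalkCount N l x y X D E j q 0)
    (wk : Walk N l x y (insert j X) j q) : WalkCount N l x y (insert j X) D E j q 1 := by
  have hss : ∀ {Y : Finset ℕ}, Y ⊆ X → Y = insert j X → False := by
    rintro Y hY rfl
    exact hjX (hY (Finset.mem_insert_self _ _))
  refine ⟨wk, by simp, ?_, ?_⟩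
  · intro d hd
    obtain ⟨p, Y, h1, h2, h3, h4, h5⟩ := w.hD d hd
    exact ⟨p, Y, h1, h2, h3, h4.trans (Finset.subset_insert _ _), fun h => (hss h4 h).elim⟩
  · intro d hd
    obtain ⟨p, Y, h1, h2, h3, h4, h5, h6⟩ := w.hE d hd
    exact ⟨p, Y, h1, h2, h3, h4, h5.trans (Finset.subset_insert _ _), fun h => (hss h5 h).elim⟩

theorem WalkCount.turn {j' q' : ℕ} (w : WalkCount N l x y X D E j q 1) (hjX : j' ∉ X)
    (wk : Walk N l x y X j' q') : WalkCount N l x y X D E j' q' 0 := by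
  refine ⟨wk, by simp [hjX], ?_, ?_⟩
  · intro d hd
    obtain ⟨p, Y, h1, h2, h3, h4, h5⟩ := w.hD d hd
    exact ⟨p, Y, h1, h2, h3, h4, fun _ => Or.inl rfl⟩
  · intro d hd
    obtain ⟨p, Y, h1, h2, h3, h4, h5, h6⟩ := w.hE d hd
    exact ⟨p, Y, h1, h2, h3, h4, h5, fun h => by simpa using (h6 h).1⟩

theorem WalkCount.upper_bend (h : GenPos N x y) (hm : ∀ i < N, ∀ j < N, (x i < x j ↔ i < j))
    (hl : l < N) (w : WalkCount N l x y X D E j q 1) (hqj : q < j) (hqX : q ∈ X)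
    (wk : Walk N l x y X q k) :
    WalkCount N l x y X (insert j D) E q k 1 ∧ j ∉ D := by
  have hj := w.walk.hj
  have hjX : j ∈ X := w.mode_iff.2 (by simp)
  refine ⟨⟨wk, by simp [hqX], ?_, ?_⟩, ?_⟩
  · intro d hd
    rcases Finset.mem_insert.1 hd with rfl | hd
    · exact ⟨q, X, w.walk, hjX, hqj, subset_rfl, fun _ => Or.inr hqj⟩
    · obtain ⟨p, Y, h1, h2, h3, h4, h5⟩ := w.hD d hd
      refine ⟨p, Y, h1, h2, h3, h4, fun h => Or.inr ?_⟩
      rcases h5 h with h | h <;> omega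
  · intro d hd
    obtain ⟨p, Y, h1, h2, h3, h4, h5, h6⟩ := w.hE d hd
    exact ⟨p, Y, h1, h2, h3, h4, h5, fun h => by simpa using (h6 h).1⟩
  · intro hjD
    obtain ⟨p, Y, h1, h2, h3, h4, h5⟩ := w.hD j hjD
    have := h5 (Walk.upper_unique h hm hl h1 w.walk h2 hjX h3 hqj)
    omega

end

end Bowtie

namespace Bowtie

open RealRAM

/-! ### The program: memory layout

The names of natural-number variables start with `v`, those of natural-number arrays with `a`, and those
of real arrays with `r`. There are `vn` blue points and `vN` points altogether, which are stored in `rX` and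
`rY` in the order of their `x`-coordinates, with their colours (`1` for blue, `0` for red) in `aCol`. The
two-dimensional arrays `aNx` and `aPv` hold the successors and predecessors in the sorted lists of
crossings, and `vN` also serves as the end marker of these lists. -/

notation "vn" => (0 : ℕ)
notation "vN" => (1 : ℕ)
notation "vW" => (2 : ℕ)
notation "vu" => (3 : ℕ)
notation "vv" => (4 : ℕ)
notation "vcnt" => (5 : ℕ)
notation "vl" => (6 : ℕ)
notation "vj" => (7 : ℕ)
notation "vq" => (8 : ℕ)
notation "vmode" => (9 : ℕ)
notation "vX" => (10 : ℕ)
notation "vtl" => (11 : ℕ)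
notation "vk" => (12 : ℕ)

notation "aCol" => (0 : ℕ)
notation "aOff" => (1 : ℕ)
notation "aNx" => (2 : ℕ)
notation "aPv" => (3 : ℕ)
notation "rX" => (6 : ℕ)
notation "rY" => (7 : ℕ)

/-- The cell of row `r` and column `c` of a two-dimensional array. The machine does not multiply natural
numbers, so the starts of the rows are tabulated in `aOff`. -/
def cellAt (r c : NExpr) : NExpr := .add (.get aOff r) c

/-- The slope of the line through two points. -/
def slopeExpr (j k : NExpr) : RExpr :=
  .div (.sub (.get rY k) (.get rY j)) (.sub (.get rX k) (.get rX j))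

/-- The entry `(c, d)` of a two-dimensional array with rows of length `N + 1`. -/
def row (s : State) (N a c d : ℕ) : ℕ := s.natArr a (c * (N + 1) + d)

/-- The part of the memory that is never changed after the points have been sorted. -/
structure Base (n N : ℕ) (x y : ℕ → ℝ) (col : ℕ → ℕ) (s : State) : Prop where
  n_eq : s.nat vn = n
  N_eq : s.nat vN = N
  x_eq : s.realArr rX = x
  y_eq : s.realArr rY = y
  col_eq : s.natArr aCol = col
  off_eq : ∀ r < N, s.natArr aOff r = r * (N + 1)

theorem addr_inj {N c d a b : ℕ} (ha : a ≤ N) (hb : b ≤ N) :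
    c * (N + 1) + a = d * (N + 1) + b ↔ c = d ∧ a = b := by
  constructor
  · intro h
    have h1 := congrArg (· / (N + 1)) h
    have h2 := congrArg (· % (N + 1)) h
    simp only [mul_comm _ (N + 1), Nat.mul_add_div (Nat.succ_pos N),
      Nat.mul_add_mod, Nat.div_eq_of_lt (Nat.lt_succ_of_le ha), Nat.div_eq_of_lt (Nat.lt_succ_of_le hb),
      Nat.mod_eq_of_lt (Nat.lt_succ_of_le ha), Nat.mod_eq_of_lt (Nat.lt_succ_of_le hb)] at h1 h2
    exact ⟨h1, h2⟩
  · rintro ⟨rfl, rfl⟩; rfl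

attribute [local simp] NExpr.eval RExpr.eval BExpr.Holds State.setNat State.setReal State.putNat
  State.putReal Prog.run Function.update_apply cellAt slopeExpr

theorem Base.frame {n N : ℕ} {x y : ℕ → ℝ} {col : ℕ → ℕ} {s s' : State} (h : Base n N x y col s)
    (h0 : s'.nat vn = s.nat vn) (h1 : s'.nat vN = s.nat vN) (hx : s'.realArr rX = s.realArr rX)
    (hy : s'.realArr rY = s.realArr rY) (hc : s'.natArr aCol = s.natArr aCol)
    (ho : s'.natArr aOff = s.natArr aOff) : Base n N x y col s' :=
  ⟨h0.trans h.n_eq, h1.trans h.N_eq, hx.trans h.x_eq, hy.trans h.y_eq, hc.trans h.col_eq,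
    fun r hr => by rw [ho]; exact h.off_eq r hr⟩

/-! ### The program: the sorted lists of crossings -/

/-- The new line `l` crosses the line `j` between `q` and `k`. -/
def crossProg : Prog :=
  .seq (.setNat vtl (.get aPv (cellAt (.var vl) (.var vN))))
  (.seq (.putNat aPv (cellAt (.var vj) (.var vl)) (.get aPv (cellAt (.var vj) (.var vk))))
  (.seq (.putNat aPv (cellAt (.var vj) (.var vk)) (.var vl))
  (.seq (.putNat aPv (cellAt (.var vl) (.var vj)) (.var vtl))
  (.seq (.putNat aPv (cellAt (.var vl) (.var vN)) (.var vj))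
  (.seq (.putNat aNx (cellAt (.var vj) (.var vq)) (.var vl))
  (.seq (.putNat aNx (cellAt (.var vj) (.var vl)) (.var vk))
  (.seq (.putNat aNx (cellAt (.var vl) (.var vtl)) (.var vj))
  (.seq (.putNat aNx (cellAt (.var vl) (.var vj)) (.var vN))
  (.seq (.setNat vX (.add (.var vX) (.const 1)))
  (.setNat vmode (.const 1)))))))))))

/-- One step on the lower boundary of a face, with mode `0`: the walk turns at the right end `vk` of the edge,
unless the new line crosses the edge before. -/
def lowerProg : Prog :=
  .seq (.setNat vk (.get aNx (cellAt (.var vj) (.var vq))))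
  (.ite (.and (.not (.natEq (.var vk) (.var vN)))
      (.realLt (slopeExpr (.var vj) (.var vk)) (slopeExpr (.var vj) (.var vl))))
    (.seq (.setNat vq (.var vj)) (.setNat vj (.var vk)))
    crossProg)

/-- One step on the upper boundary of a face, with mode `1`: the face is unbounded to the left, or the walk
moves to the next edge on the left, or it passes the leftmost vertex of the face. -/
def upperProg : Prog :=
  .ite (.natEq (.var vq) (.var vN))
    (.seq (.setNat vj (.sub (.var vj) (.const 1))) (.setNat vmode (.const 0)))
    (.ite (.natLt (.var vq) (.var vj))
      (.seq (.setNat vk (.get aPv (cellAt (.var vq) (.var vj))))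
        (.seq (.setNat vj (.var vq)) (.setNat vq (.var vk))))
      (.seq (.setNat vk (.var vj))
        (.seq (.setNat vj (.var vq)) (.seq (.setNat vq (.var vk)) (.setNat vmode (.const 0))))))

/-- One step of the walk along the new line. -/
def walkProg : Prog := .ite (.natEq (.var vmode) (.const 0)) lowerProg upperProg

/-- The start of the walk along the new line `l`, at the left end of the line `l - 1`. -/
def insertInit : Prog :=
  .seq (.putNat aNx (cellAt (.var vl) (.var vN)) (.var vN))
  (.seq (.putNat aPv (cellAt (.var vl) (.var vN)) (.var vN))
  (.seq (.setNat vX (.const 0))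
  (.seq (.setNat vj (.sub (.var vl) (.const 1)))
  (.seq (.setNat vq (.var vN))
  (.setNat vmode (.const 0))))))

/-- Insertion of the line `l`, until it has crossed all `l` lines. -/
def insertProg : Prog := .seq insertInit (.loop (.natLt (.var vX) (.var vl)) walkProg)

/-- The construction of all sorted lists. -/
def listsProg : Prog := .seq (.setNat vl (.const 0)) (Prog.upto vl (.var vN) insertProg)

/-- The invariant of the walk along the line `l`, with fuel `f`. -/
def WalkInv (n N l : ℕ) (x y : ℕ → ℝ) (col : ℕ → ℕ) (f : ℕ) (s : State) : Prop :=
  Base n N x y col s ∧ s.nat vl = l ∧ ∃ X D E : Finset ℕ, s.nat vX = X.card ∧ X ⊆ Finset.range l ∧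
    s.nat vmode ≤ 1 ∧ Lists N l x y X (row s N aNx) (row s N aPv) ∧
    (0 < l → WalkCount N l x y X D E (s.nat vj) (s.nat vq) (s.nat vmode)) ∧
    walkFuel l X D E (s.nat vmode) = f

section

variable {n N l : ℕ} {x y : ℕ → ℝ} {col : ℕ → ℕ}

theorem walk_step (h : GenPos N x y) (hm : ∀ i < N, ∀ j < N, (x i < x j ↔ i < j))
    (hl : l < N) (f : ℕ) (s : State) (hI : WalkInv n N l x y col f s) (hc : s.nat vX < s.nat vl) :
    ∃ f' < f, WalkInv n N l x y col f' (walkProg.run s) := by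
  obtain ⟨hB, hsl, X, D, E, hX, hXr, hmode1, hL, hw, hf⟩ := hI
  rw [hX, hsl] at hc
  have w := hw (by omega)
  obtain ⟨cX, cD, cE⟩ := w.card_le
  have hj := w.walk.hj
  have hq := w.walk.hq
  have hoj := hB.off_eq (s.nat vj) (by omega)
  have hol := hB.off_eq l hl
  have hN := hB.N_eq
  have hx := hB.x_eq
  have hy := hB.y_eq
  have hqS : s.nat vq = N ∨ s.nat vq ∈ nbr l X (s.nat vj) := by
    rcases hq with h | h
    · exact Or.inl h
    · exact Or.inr (Or.inl ⟨h.1, hj, h.2⟩)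
  unfold walkFuel at hf
  by_cases hmode : s.nat vmode = 0
  · have hjX : s.nat vj ∉ X := by rw [w.mode_iff]; simp [hmode]
    rw [hmode] at w hf
    obtain ⟨hkS, hk2⟩ := (hL (s.nat vj) hj.le).1 _ hqS
    set k := row s N aNx (s.nat vj) (s.nat vq) with hk
    have hSj : ∀ d, d ∈ nbr l X (s.nat vj) ↔ d < l ∧ d ≠ s.nat vj := by
      intro d
      simp [nbr, hj, hj.ne, hjX]
    have hk' : s.natArr aNx (s.natArr aOff (s.nat vj) + s.nat vq) = k := by
      rw [hoj, hk]; rfl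
    by_cases hcond : k ≠ N ∧ slopeAt x y (s.nat vj) k < slopeAt x y (s.nat vj) l
    · have hkl := (hSj k).1 (hkS.resolve_left hcond.1)
      obtain ⟨h1, h2, h3⟩ := w.walk.lower_bend h hm hl hjX hkl.1 hkl.2
        (fun d hd hdj => by
          rw [hk2 d ((hSj d).2 ⟨hd, hdj⟩)]; simp [hcond.1]) hcond.2
      obtain ⟨h4, h5⟩ := w.lower_bend h hm hl h1 h2 h3
      have h6 := h4.card_le
      rw [Finset.card_insert_of_notMem h5] at h6
      have hc1 : ¬ k = N := hcond.1
      have hc2 : (y k - y (s.nat vj)) / (x k - x (s.nat vj)) <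
        (y l - y (s.nat vj)) / (x l - x (s.nat vj)) := hcond.2
      have hrun : walkProg.run s = ((s.setNat vk k).setNat vq (s.nat vj)).setNat vj k := by
        simp [walkProg, lowerProg, hmode, hk', hN, hsl, hx, hy, hc1, hc2]
      rw [hrun]
      refine ⟨_, ?_, hB.frame ?_ ?_ ?_ ?_ ?_ ?_, ?_, X, D, insert k E, ?_, hXr,
        ?_, ?_, ?_, rfl⟩ <;>
        try simp [hsl]
      · simp only [walkFuel, Finset.card_insert_of_notMem h5, hmode]
        omega
      · exact hX
      · exact hmode1
      · exact hL
      · intro _; rw [hmode]; exact h4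
    · obtain ⟨h1, h2⟩ := w.walk.exit h hm hl hjX (by rw [hSj] at hkS; exact hkS)
        (fun d hd hdj => by rw [hk2 d ((hSj d).2 ⟨hd, hdj⟩)])
        (fun hkN => by
          have hkl := (hSj k).1 (hkS.resolve_left hkN)
          refine lt_of_le_of_ne (not_lt.1 fun hlt => hcond ⟨hkN, hlt⟩) ?_
          exact h.slope _ (by omega) l hl k (by omega) (by omega) (by omega) (by omega))
      have h3 := w.exit hjX h1
      have h4 := h3.card_le
      rw [Finset.card_insert_of_notMem hjX] at h4
      have hqN : s.nat vq ≤ N := by omega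
      have hkN : k ≤ N := by rw [hSj] at hkS; omega
      obtain ⟨htS, -⟩ := (hL l le_rfl).2 N (Or.inl rfl)
      have htN : row s N aPv l N ≤ N := by
        have hlX : l ∉ X := fun h => by simpa using hXr h
        rcases htS with h | h
        · omega
        · simp [nbr, hlX] at h
          have := Finset.mem_range.1 (hXr h)
          omega
      obtain ⟨tl, hT⟩ : ∃ tl, row s N aPv l N = tl := ⟨_, rfl⟩
      have htl : s.natArr aPv (l * (N + 1) + N) = tl := hT
      rw [hT] at htN
      have hc2 : ¬ k = N → ¬ (y k - y (s.nat vj)) / (x k - x (s.nat vj)) <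
        (y l - y (s.nat vj)) / (x l - x (s.nat vj)) := fun h1 h2 => hcond ⟨h1, h2⟩
      have hrun : walkProg.run s = crossProg.run (s.setNat vk k) := by
        simp [walkProg, lowerProg, hmode, hk', hN, hsl, hx, hy]
        intro h1 h2
        exact absurd h2 (hc2 h1)
      rw [hrun]
      refine ⟨_, ?_, hB.frame ?_ ?_ ?_ ?_ ?_ ?_, ?_, insert (s.nat vj) X, D, E, ?_, h1.hX,
        ?_, hL.exit h hl w.walk hjX hk hT.symm ?_ h2 ?_ ?_, ?_, rfl⟩
      · simp only [walkFuel, Finset.card_insert_of_notMem hjX]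
        simp [crossProg]
        omega
      · simp [crossProg]
      · simp [crossProg]
      · simp [crossProg]
      · simp [crossProg]
      · simp [crossProg]
      · simp [crossProg]
      · simp [crossProg, hsl]
      · simp [crossProg, Finset.card_insert_of_notMem hjX, hX]
      · simp [crossProg]
      · intro hkN
        have hkl := (hSj k).1 (hkS.resolve_left hkN)
        refine lt_of_le_of_ne (not_lt.1 fun hlt => hcond ⟨hkN, hlt⟩) ?_
        exact h.slope _ (by omega) l hl k (by omega) (by omega) (by omega) (by omega)
      · intro c hc d hd
        simp [row, crossProg, hsl, hN, hoj, hol, htl, addr_inj, hd, hl.le, hj.le.trans hl.le, htN, hqN]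
      · intro c hc d hd
        simp [row, crossProg, hsl, hN, hoj, hol, htl, addr_inj, hd, hl.le, hj.le.trans hl.le, hkN]
      · intro _
        simp [crossProg]
        exact h3
  · have hjX : s.nat vj ∈ X := w.mode_iff.2 hmode
    have hmode1 : s.nat vmode = 1 := by omega
    rw [hmode1] at w hf
    by_cases hqN : s.nat vq = N
    · have hw1 := w.walk
      rw [hqN] at hw1
      obtain ⟨h1, h2⟩ := hw1.turn_left_end hm hl hjX hc
      have h3 := w.turn h1 h2
      have hrun : walkProg.run s = (s.setNat vj (s.nat vj - 1)).setNat vmode 0 := by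
        simp [walkProg, upperProg, hmode1, hqN, hN]
      rw [hrun]
      refine ⟨_, ?_, hB.frame ?_ ?_ ?_ ?_ ?_ ?_, ?_, X, D, E, ?_, hXr, ?_, ?_, ?_, rfl⟩ <;>
        try simp [hsl]
      · simp only [walkFuel]
        omega
      · exact hX
      · exact hL
      · intro _; rw [hqN]; exact h3
    · have hq' := hq.resolve_left hqN
      by_cases hqj : s.nat vq < s.nat vj
      · have hqX := (w.walk.mem_iff hm hl (by omega)).2 hqj
        have hSq : ∀ d, d ∈ nbr l X (s.nat vq) ↔ d ≤ l ∧ d ≠ s.nat vq := by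
          intro d
          simp [nbr, hq'.1, hq'.1.ne, hqX]
          omega
        obtain ⟨hkS, hk2⟩ := (hL (s.nat vq) hq'.1.le).2 (s.nat vj)
          (Or.inr ((hSq _).2 ⟨hj.le, by omega⟩))
        set k := row s N aPv (s.nat vq) (s.nat vj) with hk
        have hk' : s.natArr aPv (s.natArr aOff (s.nat vq) + s.nat vj) = k := by
          rw [hB.off_eq (s.nat vq) (by omega), hk]; rfl
        obtain ⟨h1, h2⟩ := w.walk.upper_bend h hm hl hjX hqj (by rw [hSq] at hkS; exact hkS)
          (fun d hd hdq => by
            have := hk2 d ((hSq d).2 ⟨hd, hdq⟩)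
            simp only [neg_lt_neg_iff, neg_le_neg_iff] at this
            rw [← this]
            simp [(show s.nat vj ≠ N by omega)])
        obtain ⟨h3, h4⟩ := w.upper_bend h hm hl hqj h1 h2
        have h5 := h3.card_le
        rw [Finset.card_insert_of_notMem h4] at h5
        have hrun : walkProg.run s =
            ((s.setNat vk k).setNat vj (s.nat vq)).setNat vq k := by
          simp [walkProg, upperProg, hmode1, hqN, hN, hqj, hk']
        rw [hrun]
        refine ⟨_, ?_, hB.frame ?_ ?_ ?_ ?_ ?_ ?_, ?_, X, insert (s.nat vj) D, E, ?_, hXr,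
          ?_, ?_, ?_, rfl⟩ <;> try simp [hsl]
        · simp only [walkFuel, Finset.card_insert_of_notMem h4, hmode1]
          omega
        · exact hX
        · omega
        · exact hL
        · intro _; rw [hmode1]; exact h3
      · obtain ⟨h1, h2⟩ := w.walk.turn h hm hl hjX hqN hqj
        have h3 := w.turn h1 h2
        have hrun : walkProg.run s = (((s.setNat vk (s.nat vj)).setNat vj (s.nat vq)).setNat vq
            (s.nat vj)).setNat vmode 0 := by
          simp [walkProg, upperProg, hmode1, hqN, hN, hqj]
        rw [hrun]
        refine ⟨_, ?_, hB.frame ?_ ?_ ?_ ?_ ?_ ?_, ?_, X, D, E, ?_, hXr, ?_, ?_, ?_, rfl⟩ <;>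
          try simp [hsl]
        · simp only [walkFuel]
          omega
        · exact hX
        · exact hL
        · intro _; exact h3

/-- The lists of all crossings of the lines `0, …, l - 1`. -/
def ListsUpTo (N l : ℕ) (x y : ℕ → ℝ) (nx pv : ℕ → ℕ → ℕ) : Prop :=
  ∀ c < l, Linked N (slopeAt x y c) {d | d < l ∧ d ≠ c} (nx c) ∧
    Linked N (fun d => - slopeAt x y c d) {d | d < l ∧ d ≠ c} (pv c)

theorem runs_insertProg (h : GenPos N x y) (hm : ∀ i < N, ∀ j < N, (x i < x j ↔ i < j))
    (hl : l < N) (s : State) (hB : Base n N x y col s) (hsl : s.nat vl = l)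
    (hL : ListsUpTo N l x y (row s N aNx) (row s N aPv)) :
    Runs insertProg s (insertInit.time + (5 * N + 1) * (4 + walkProg.time)) fun s' =>
      Base n N x y col s' ∧ s'.nat vl = l ∧
        ListsUpTo N (l + 1) x y (row s' N aNx) (row s' N aPv) := by
  have hol := hB.off_eq l hl
  have hN := hB.N_eq
  refine Runs.seq (P := WalkInv n N l x y col (5 * l)) (Runs.of_loopFree rfl ?_) fun s' hs' => ?_
  · refine ⟨hB.frame ?_ ?_ ?_ ?_ ?_ ?_, ?_, ∅, ∅, ∅, ?_, by simp, ?_, ?_, ?_, ?_⟩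
    · simp [insertInit]
    · simp [insertInit]
    · simp [insertInit]
    · simp [insertInit]
    · simp [insertInit]
    · simp [insertInit]
    · simp [insertInit, hsl]
    · simp [insertInit]
    · simp [insertInit]
    · refine Lists.start (fun c hc => ?_) ?_ ?_
      · obtain ⟨h1, h2⟩ := hL c hc
        have hz : ∀ z, (z = N ∨ z ∈ {d | d < l ∧ d ≠ c}) → z ≤ N := by
          rintro z (rfl | ⟨hz, -⟩) <;> omega
        refine ⟨h1.congr rfl fun z hz' => ?_, h2.congr rfl fun z hz' => ?_⟩ <;>
          simp [row, insertInit, hN, hsl, hol, addr_inj, hz z hz', hc.ne]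
      · simp [row, insertInit, hN, hsl, hol]
      · simp [row, insertInit, hN, hsl, hol]
    · intro h0
      have w := Walk.start (x := x) (y := y) hm hl h0
      refine ⟨?_, ?_, by simp, by simp⟩
      · simpa [insertInit, hN, hsl] using w
      · simp [insertInit]
    · simp [insertInit, walkFuel]
      omega
  · refine (Runs.loop (I := WalkInv n N l x y col) (Q := _) (K := walkProg.time)
      (fun f s hI hc => ?_) (fun f s hI hc => ?_) hs').mono ?_ fun _ h => h
    · obtain ⟨f', hf', hI'⟩ := walk_step h hm hl f s hI hc
      exact ⟨f', hf', Runs.of_loopFree rfl hI'⟩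
    · obtain ⟨hB, hsl, X, D, E, hX, hXr, hmode1, hL, hw, hf⟩ := hI
      simp only [BExpr.Holds, NExpr.eval, hX, hsl, not_lt] at hc
      have : X = Finset.range l := Finset.eq_of_subset_of_card_le hXr (by simpa using hc)
      subst this
      exact ⟨hB, hsl, hL.finish⟩
    · simp only [BExpr.cost, NExpr.cost]
      exact Nat.mul_le_mul (by omega) (by omega)

theorem runs_listsProg : ∃ K, ∀ (n N : ℕ) (x y : ℕ → ℝ) (col : ℕ → ℕ) (s : State),
    GenPos N x y → (∀ i < N, ∀ j < N, (x i < x j ↔ i < j)) → Base n N x y col s →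
    Runs listsProg s (K * (N + 1) ^ 2) fun s' => Base n N x y col s' ∧
      ListsUpTo N N x y (row s' N aNx) (row s' N aPv) := by
  refine ⟨2 + 8 + insertInit.time + 5 * (4 + walkProg.time), fun n N x y col s h hm hB => ?_⟩
  refine (Runs.seq (P := fun s => s.nat vl = 0 ∧ Base n N x y col s) (Runs.of_loopFree rfl ?_)
    fun s' hs' => Runs.upto (T := insertInit.time + (5 * N + 1) * (4 + walkProg.time))
      (K := N) (I := fun k s => Base n N x y col s ∧
      ListsUpTo N k x y (row s N aNx) (row s N aPv)) ?_ ?_ hs'.1 ?_).mono ?_ ?_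
  · exact ⟨by simp, hB.frame (by simp) (by simp) (by simp) (by simp) (by simp) (by simp)⟩
  · intro k s _ hs _
    exact hs.1.N_eq
  · intro k s hk hs hv
    refine (runs_insertProg h hm hk s hs.1 hv hs.2).mono le_rfl ?_
    rintro s' ⟨h1, h2, h3⟩
    exact ⟨h2, h1.frame (by simp) (by simp) (by simp) (by simp) (by simp) (by simp), h3⟩
  · exact ⟨hs'.2, by simp [ListsUpTo]⟩
  · simp only [Prog.time, NExpr.cost]
    generalize walkProg.time = a
    generalize insertInit.time = b
    have h1 : (N + 1) * (b + (5 * N + 1) * (4 + a) + (1 + 7)) ≤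
        (N + 1) * ((8 + b + 5 * (4 + a)) * (N + 1)) := by
      refine Nat.mul_le_mul_left _ ?_
      nlinarith [Nat.zero_le (a * N), Nat.zero_le (b * N)]
    nlinarith
  · rintro s' ⟨-, h1, h2⟩
    exact ⟨h1, h2⟩

end

end Bowtie

namespace Bowtie

/-! ### Sweeping the tangents of one chain

A chain consists of the lines through near blue points that have the near blue points above them and the
far blue points below them. As the slope increases, the contact point moves from left to right along the
lower hull of the near blue points. The sweep follows the edges of this chain in the dual arrangement:
at the successor `c` of `q` in the sorted list of the contact point `b`, it passes a red point, turns at a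
near blue point, or ends at a far one. -/

/-- The situation swept by a chain. Points of type `e` are near, those of type `2` lie in the gap, and
the others are far; far points lie to the left of near ones, and a gap point does not lie between two
near points. The lists `nx` are sorted by slope. The blue points (colour `1`) are near or far. -/
structure ChainHyp (N : ℕ) (X Y : ℕ → ℝ) (col ty : ℕ → ℕ) (e : ℕ) (nx : ℕ → ℕ → ℕ) : Prop where
  gp : GenPos N X Y
  nx : ∀ b < N, Linked N (slopeAt X Y b) {d | d < N ∧ d ≠ b} (nx b)
  blue : ∀ d < N, col d = 1 → ty d ≠ 2
  far : ∀ d < N, ty d ≠ e → ty d ≠ 2 → ∀ b < N, ty b = e → X d < X b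
  gap : ∀ d < N, ty d = 2 →
    (∀ b < N, ty b = e → X d < X b) ∨ (∀ b < N, ty b = e → X b < X d)

/-- The point `d` lies to the left of all near points. -/
def LeftOf (N : ℕ) (X : ℕ → ℝ) (ty : ℕ → ℕ) (e d : ℕ) : Prop := ∀ b < N, ty b = e → X d < X b

/-- The lines through `b` on the edge after `q` have the far blue points below them, and the near blue
points above them. -/
structure EdgeTan (N : ℕ) (X Y : ℕ → ℝ) (col ty : ℕ → ℕ) (e b q : ℕ) : Prop where
  b_lt : b < N
  b_col : col b = 1
  b_ty : ty b = e
  q_mem : q = N ∨ (q < N ∧ q ≠ b)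
  side : ∀ d < N, d ≠ b → col d = 1 → (Abv N X Y b q d ↔ ty d = e)

/-- The line of slope `m` through `b` contains no other point, has the far blue points below it, and
the near blue points above it. -/
structure LineTan (N : ℕ) (X Y : ℕ → ℝ) (col ty : ℕ → ℕ) (e b : ℕ) (m : ℝ) : Prop where
  b_lt : b < N
  b_col : col b = 1
  b_ty : ty b = e
  ne : ∀ d < N, d ≠ b → m ≠ slopeAt X Y b d
  near : ∀ d < N, col d = 1 → ty d = e → 0 ≤ ht X Y b m d
  far : ∀ d < N, col d = 1 → ty d ≠ e → ht X Y b m d ≤ 0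

open Classical in
/-- The red points outside the gap that the tangents of an edge exclude: far points above the line
and near points below it. -/
noncomputable def edgeGood (N : ℕ) (X Y : ℕ → ℝ) (col ty : ℕ → ℕ) (e b q : ℕ) : Finset ℕ :=
  {d ∈ Finset.range N | col d ≠ 1 ∧ ty d ≠ 2 ∧ (Abv N X Y b q d ↔ ty d ≠ e)}

open Classical in
/-- The red points outside the gap that a tangent excludes. -/
noncomputable def lineGood (N : ℕ) (X Y : ℕ → ℝ) (col ty : ℕ → ℕ) (e b : ℕ) (m : ℝ) : Finset ℕ :=
  {d ∈ Finset.range N | col d ≠ 1 ∧ ty d ≠ 2 ∧ (0 < ht X Y b m d ↔ ty d ≠ e)}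

/-- A record `(b, q, g)` for the time stamp `t`: an edge whose tangents exclude `g` red points outside
the gap, and that the sweep reaches after it has passed the gap points with stamps below `t`. A gap point is
passed at most once, and changes its side then: the points to the left of the near points are below the
tangents before, and the other ones above them. -/
structure ChainRec (N : ℕ) (X Y : ℕ → ℝ) (col ty : ℕ → ℕ) (e : ℕ) (st : ℕ → ℕ) (t b q g : ℕ) :
    Prop where
  tan : EdgeTan N X Y col ty e b q
  good : g = (edgeGood N X Y col ty e b q).card
  flip : ∀ d < N, ty d = 2 → (st d < t ↔ (LeftOf N X ty e d ↔ Abv N X Y b q d))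

/-- Some record with a stamp up to `τ` is at least as good as the given tangent: it excludes at least as many
red points outside the gap, and has the gap points on the same sides. -/
def Covered (N : ℕ) (X Y : ℕ → ℝ) (col ty : ℕ → ℕ) (e : ℕ) (st bg : ℕ → ℕ) (τ b : ℕ) (m : ℝ) :
    Prop :=
  ∃ t ≤ τ, (lineGood N X Y col ty e b m).card ≤ bg t ∧
    ∀ d < N, ty d = 2 → (st d < t ↔ (LeftOf N X ty e d ↔ 0 < ht X Y b m d))

/-- The tables of a sweep: `st` stamps the gap points in the order in which they are passed, `ev` is
its inverse, and `bb`, `bq`, `bg` hold the best record for every stamp. -/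
structure ChainTable (N : ℕ) (X Y : ℕ → ℝ) (col ty : ℕ → ℕ) (e : ℕ) (st ev bg bb bq : ℕ → ℕ)
    (τ : ℕ) : Prop where
  st_ev : ∀ t < τ, ev t < N ∧ ty (ev t) = 2 ∧ st (ev t) = t
  ev_st : ∀ d < N, ty d = 2 → st d < τ → ev (st d) = d
  recs : ∀ t ≤ τ, ChainRec N X Y col ty e st t (bb t) (bq t) (bg t)

/-- The state of a sweep on the edge of `b` after `q`, at the time `τ`. The tangents of this edge exclude `g` red
points outside the gap, gap points that have not been passed carry the stamp `N`, and all tangents with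
slopes below the next event are covered. -/
structure ChainState (N : ℕ) (X Y : ℕ → ℝ) (col ty : ℕ → ℕ) (e : ℕ) (nx : ℕ → ℕ → ℕ)
    (st ev bg bb bq : ℕ → ℕ) (τ b q g : ℕ) : Prop where
  table : ChainTable N X Y col ty e st ev bg bb bq τ
  cur : ChainRec N X Y col ty e st τ b q g
  rest : ∀ d < N, ty d = 2 → ¬ st d < τ → st d = N
  le : g ≤ bg τ
  compl : ∀ b' m, LineTan N X Y col ty e b' m → (nx b q = N ∨ m < slopeAt X Y b (nx b q)) →
    Covered N X Y col ty e st bg τ b' m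

open Classical in
/-- A weight of the points, whose sum decreases in every step of a sweep: a point that is passed is on the right
of the contact point and moves below the tangents, or on the left of it and moves above them. -/
noncomputable def chainWeight (N : ℕ) (X Y : ℕ → ℝ) (b q d : ℕ) : ℕ :=
  if d = b then 1 else if Abv N X Y b q d then (if X d < X b then 0 else 2) else 1

section

variable {N : ℕ} {X Y : ℕ → ℝ} {col ty : ℕ → ℕ} {e : ℕ} {nx : ℕ → ℕ → ℕ}
  {st ev bg bb bq : ℕ → ℕ} {τ b q g c : ℕ}

theorem ChainTable.le_card (h : ChainTable N X Y col ty e st ev bg bb bq τ) :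
    τ ≤ ((Finset.range N).filter fun d => ty d = 2).card := by
  have h1 : (Finset.range τ).image ev ⊆ (Finset.range N).filter fun d => ty d = 2 := by
    intro d hd
    obtain ⟨t, ht, rfl⟩ := Finset.mem_image.1 hd
    have := h.st_ev t (Finset.mem_range.1 ht)
    simp [this.1, this.2.1]
  have h2 := Finset.card_le_card h1
  rwa [Finset.card_image_of_injOn, Finset.card_range] at h2
  intro t ht t' ht' heq
  rw [← (h.st_ev t (by simpa using ht)).2.2, ← (h.st_ev t' (by simpa using ht')).2.2, heq]

theorem ChainTable.lt_of_rest (h : ChainTable N X Y col ty e st ev bg bb bq τ) {d : ℕ} (hd : d < N)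
    (hst : ¬ st d < τ) : τ < N := by
  have h1 : (Finset.range τ).image ev ⊂ Finset.range N := by
    refine (Finset.ssubset_iff_of_subset ?_).2 ⟨d, Finset.mem_range.2 hd, ?_⟩
    · intro d hd
      obtain ⟨t, ht, rfl⟩ := Finset.mem_image.1 hd
      exact Finset.mem_range.2 (h.st_ev t (Finset.mem_range.1 ht)).1
    · intro hd
      obtain ⟨t, ht, rfl⟩ := Finset.mem_image.1 hd
      have ht' := Finset.mem_range.1 ht
      rw [(h.st_ev t ht').2.2] at hst
      exact hst ht'
  have h2 := Finset.card_lt_card h1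
  rwa [Finset.card_image_of_injOn, Finset.card_range, Finset.card_range] at h2
  intro t ht t' ht' heq
  rw [← (h.st_ev t (by simpa using ht)).2.2, ← (h.st_ev t' (by simpa using ht')).2.2, heq]

/-- On an open edge, the side of a point can be read off from the order of the slopes. -/
theorem abv_iff_of_edge (h : ChainHyp N X Y col ty e nx) (hb : b < N) (hq : q = N ∨ (q < N ∧ q ≠ b))
    {m : ℝ} (h1 : q = N ∨ slopeAt X Y b q < m) (h2 : nx b q = N ∨ m < slopeAt X Y b (nx b q))
    {d : ℕ} (hd : d < N) (hdb : d ≠ b) :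
    (Abv N X Y b q d ↔ 0 < ht X Y b m d) ∧ ht X Y b m d ≠ 0 := by
  obtain ⟨h3, h4⟩ := h.nx b hb q (by simpa using hq)
  have h5 := h4 d ⟨hd, hdb⟩
  have hx := h.gp.inj b hb d hd hdb.symm
  have key : (q ≠ N ∧ slopeAt X Y b d ≤ slopeAt X Y b q) ↔ slopeAt X Y b d < m := by
    constructor
    · rintro ⟨h6, h7⟩
      exact h7.trans_lt (h1.resolve_left h6)
    · intro h6
      by_contra hcon
      obtain ⟨h7, h8⟩ := h5.1 (by
        by_cases hqN : q = N
        · exact Or.inl hqN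
        · exact Or.inr (not_le.1 fun h => hcon ⟨hqN, h⟩))
      linarith [h2.resolve_left h7]
  have hne : m ≠ slopeAt X Y b d := by
    rintro rfl
    have h6 : q = N ∨ slopeAt X Y b q < slopeAt X Y b d := h1
    obtain ⟨h7, h8⟩ := h5.1 h6
    linarith [h2.resolve_left h7]
  refine ⟨?_, mt (ht_eq_zero_iff hx).1 hne⟩
  unfold Abv
  rw [key]
  rcases lt_or_gt_of_ne hx with hlt | hlt
  · rw [ht_pos_iff_of_lt hlt]
    simp only [hlt, true_iff, not_lt]
    exact ⟨fun h => lt_of_le_of_ne h hne, le_of_lt⟩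
  · rw [ht_pos_iff_of_gt hlt]
    simp only [hlt.not_gt, false_iff, not_not]

/-- A tangent that passes the current edge lies on it. -/
theorem covered_of_edge (h : ChainHyp N X Y col ty e nx)
    (hr : ChainRec N X Y col ty e st τ b q g) (hg : g ≤ bg τ) {b' : ℕ} {m : ℝ}
    (ht' : LineTan N X Y col ty e b' m) (h1 : q = N ∨ slopeAt X Y b q ≤ m)
    (h2 : nx b q = N ∨ m < slopeAt X Y b (nx b q)) : Covered N X Y col ty e st bg τ b' m := by
  obtain ⟨hb, hbc, hbt, hq, hside⟩ := hr.tan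
  have hbb : b' = b := by
    by_contra hne
    have hx := h.gp.inj b hb b' ht'.b_lt (Ne.symm hne)
    have h3 := ht'.near b hb hbc hbt
    rw [ht_neg_comm, neg_nonneg] at h3
    have hz : ht X Y b m b' ≠ 0 := by
      rw [Ne, ht_eq_zero_iff hx, slopeAt_comm]
      exact ht'.ne b hb (Ne.symm hne)
    have h4 : 0 < ht X Y b m b' := by
      have habv := (hside b' ht'.b_lt hne ht'.b_col).2 ht'.b_ty
      have h5 := (h.nx b hb q (by simpa using hq)).2 b' ⟨ht'.b_lt, hne⟩
      unfold Abv at habv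
      rcases lt_or_gt_of_ne hx with hlt | hlt
      · rw [ht_pos_iff_of_lt hlt]
        have h6 := habv.1 hlt
        obtain ⟨h7, h8⟩ := h5.1 (by
          by_cases hqN : q = N
          · exact Or.inl hqN
          · exact Or.inr (not_le.1 fun h => h6 ⟨hqN, h⟩))
        exact (h2.resolve_left h7).trans_le h8
      · rw [ht_pos_iff_of_gt hlt]
        simp only [hlt.not_gt, false_iff, not_not] at habv
        refine lt_of_le_of_ne (habv.2.trans (h1.resolve_left habv.1)) ?_
        intro heq
        exact hz ((ht_eq_zero_iff hx).2 heq.symm)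
    linarith
  subst hbb
  have h1' : q = N ∨ slopeAt X Y b' q < m := by
    rcases hq with hq | hq
    · exact Or.inl hq
    · exact Or.inr (lt_of_le_of_ne (h1.resolve_left (by omega)) (ht'.ne q hq.1 hq.2).symm)
  have key := fun d hd hdb => abv_iff_of_edge h hb hq h1' h2 (d := d) hd hdb
  refine ⟨τ, le_rfl, ?_, ?_⟩
  · refine le_trans (le_of_eq ?_) hg
    rw [hr.good]
    congr 1
    unfold lineGood edgeGood
    classical
    refine Finset.filter_congr fun d hd => ?_
    by_cases hdb : d = b'
    · subst hdb; simp [hbc]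
    · rw [(key d (Finset.mem_range.1 hd) hdb).1]
  · intro d hd hty
    have hdb : d ≠ b' := by
      rintro rfl
      exact h.blue d hd hbc hty
    rw [hr.flip d hd hty, (key d hd hdb).1]

theorem ChainState.next (h : ChainHyp N X Y col ty e nx)
    (hs : ChainState N X Y col ty e nx st ev bg bb bq τ b q g) (hc : c = nx b q) (hcN : c ≠ N) :
    c < N ∧ c ≠ b ∧ (Abv N X Y b q c ↔ X b < X c) ∧ (Abv N X Y b c c ↔ ¬ X b < X c) ∧
      ∀ d < N, d ≠ b → d ≠ c → (Abv N X Y b c d ↔ Abv N X Y b q d) := by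
  obtain ⟨hb, hbc, hbt, hq, hside⟩ := hs.cur.tan
  obtain ⟨h3, h4⟩ := h.nx b hb q (by simpa using hq)
  rw [← hc] at h3 h4
  obtain ⟨hc1, hc2⟩ := h3.resolve_left hcN
  refine ⟨hc1, hc2, ?_, ?_, ?_⟩
  · have h5 := (h4 c ⟨hc1, hc2⟩).2 ⟨hcN, le_rfl⟩
    have : ¬ (q ≠ N ∧ slopeAt X Y b c ≤ slopeAt X Y b q) := by
      rintro ⟨h6, h7⟩
      linarith [h5.resolve_left h6]
    unfold Abv
    simp only [this, not_false_eq_true, iff_true]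
  · unfold Abv
    simp [hcN]
  · intro d hd hdb hdc
    refine abv_next h.gp hb hc1 hd hc2.symm hdb.symm hdc.symm ?_
    rw [h4 d ⟨hd, hdb⟩]
    simp [hcN]

theorem EdgeTan.red_step (h : ChainHyp N X Y col ty e nx)
    (hs : ChainState N X Y col ty e nx st ev bg bb bq τ b q g) (hc : c = nx b q) (hcN : c ≠ N)
    (hcol : col c ≠ 1) : EdgeTan N X Y col ty e b c := by
  obtain ⟨hc1, hc2, hc3, hc4, hc5⟩ := hs.next h hc hcN
  obtain ⟨hb, hbc, hbt, hq, hside⟩ := hs.cur.tan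
  refine ⟨hb, hbc, hbt, Or.inr ⟨hc1, hc2⟩, fun d hd hdb hdc => ?_⟩
  rw [hc5 d hd hdb (by rintro rfl; exact hcol hdc), hside d hd hdb hdc]

/-- The tangents with slopes below the next event stay covered when the tables grow, and those with
larger slopes are covered by the new edge. -/
theorem compl_step (h : ChainHyp N X Y col ty e nx)
    (hs : ChainState N X Y col ty e nx st ev bg bb bq τ b q g) (hc : c = nx b q)
    {st' bg' : ℕ → ℕ} {τ' b' q' g' : ℕ}
    (hold : ∀ b m, Covered N X Y col ty e st bg τ b m → Covered N X Y col ty e st' bg' τ' b m)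
    (hr : ChainRec N X Y col ty e st' τ' b' q' g') (hg : g' ≤ bg' τ')
    (hq : slopeAt X Y b' q' = slopeAt X Y b c) (b'' : ℕ) (m : ℝ)
    (ht' : LineTan N X Y col ty e b'' m) (hm : nx b' q' = N ∨ m < slopeAt X Y b' (nx b' q')) :
    Covered N X Y col ty e st' bg' τ' b'' m := by
  by_cases hlt : m < slopeAt X Y b c
  · exact hold _ _ (hs.compl _ _ ht' (Or.inr (hc ▸ hlt)))
  · exact covered_of_edge h hr hg ht' (Or.inr (hq ▸ not_lt.1 hlt)) hm

/-- The sweep passes a red point in the gap. -/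
theorem ChainState.gap_step (h : ChainHyp N X Y col ty e nx)
    (hs : ChainState N X Y col ty e nx st ev bg bb bq τ b q g) (hc : c = nx b q) (hcN : c ≠ N)
    (hty : ty c = 2) :
    ChainState N X Y col ty e nx (Function.update st c τ) (Function.update ev τ c)
      (Function.update bg (τ + 1) g) (Function.update bb (τ + 1) b) (Function.update bq (τ + 1) c)
      (τ + 1) b c g := by
  obtain ⟨hc1, hc2, hc3, hc4, hc5⟩ := hs.next h hc hcN
  have hcol : col c ≠ 1 := fun hcol => h.blue c hc1 hcol hty
  obtain ⟨hb, hbc, hbt, hq, hside⟩ := hs.cur.tan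
  have hleft : LeftOf N X ty e c ↔ X c < X b := by
    constructor
    · exact fun hl => hl b hb hbt
    · intro hlt
      rcases h.gap c hc1 hty with h1 | h1
      · exact h1
      · linarith [h1 b hb hbt]
  have hx := h.gp.inj b hb c hc1 hc2.symm
  have hxx : ¬ X b < X c ↔ X c < X b := ⟨fun h => lt_of_le_of_ne (not_lt.1 h) hx.symm, fun h => h.not_gt⟩
  have hcst : ¬ st c < τ := by
    rw [hs.cur.flip c hc1 hty, hleft, hc3, ← hxx]
    tauto
  have hcN' := hs.rest c hc1 hty hcst
  have hτ := hs.table.lt_of_rest hc1 hcst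
  have hst : ∀ d t, t ≤ τ → (Function.update st c τ d < t ↔ st d < t) := by
    intro d t ht
    by_cases hd : d = c
    · subst hd; simp; omega
    · simp [hd]
  have hrec : ∀ {t b q g : ℕ}, t ≤ τ → ChainRec N X Y col ty e st t b q g →
      ChainRec N X Y col ty e (Function.update st c τ) t b q g := by
    intro t b q g ht hr
    exact ⟨hr.tan, hr.good, fun d hd hd2 => by rw [hst d t ht, hr.flip d hd hd2]⟩
  have hcur : ChainRec N X Y col ty e (Function.update st c τ) (τ + 1) b c g := by
    refine ⟨EdgeTan.red_step h hs hc hcN hcol, ?_, ?_⟩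
    · rw [hs.cur.good]
      congr 1
      unfold edgeGood
      classical
      refine Finset.filter_congr fun d hd => ?_
      by_cases hdb : d = b
      · subst hdb; simp [hbc]
      by_cases hdc : d = c
      · subst hdc; simp [hty]
      · rw [hc5 d (Finset.mem_range.1 hd) hdb hdc]
    · intro d hd hd2
      by_cases hdc : d = c
      · subst hdc
        rw [hleft, hc4, ← hxx]
        simp
      · have hdb : d ≠ b := by
          rintro rfl
          exact h.blue d hd hbc hd2
        rw [hc5 d hd hdb hdc, ← hs.cur.flip d hd hd2, Function.update_of_ne hdc]
        constructor
        · intro h1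
          by_contra h2
          have := hs.rest d hd hd2 h2
          omega
        · omega
  refine ⟨⟨?_, ?_, ?_⟩, hcur, ?_, by simp, ?_⟩
  · intro t ht
    by_cases htt : t = τ
    · subst htt; simp [hc1, hty]
    · obtain ⟨h1, h2, h3⟩ := hs.table.st_ev t (by omega)
      rw [Function.update_of_ne htt]
      refine ⟨h1, h2, ?_⟩
      rw [Function.update_of_ne, h3]
      intro h4
      rw [h4] at h3
      omega
  · intro d hd hd2 hdt
    by_cases hdc : d = c
    · subst hdc; simp
    · rw [Function.update_of_ne hdc] at hdt ⊢
      have h1 : st d < τ := by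
        by_contra h2
        have := hs.rest d hd hd2 h2
        omega
      rw [Function.update_of_ne h1.ne, hs.table.ev_st d hd hd2 h1]
  · intro t ht
    by_cases htt : t = τ + 1
    · subst htt; simpa using hcur
    · rw [Function.update_of_ne htt, Function.update_of_ne htt, Function.update_of_ne htt]
      exact hrec (by omega) (hs.table.recs t (by omega))
  · intro d hd hd2 hdt
    by_cases hdc : d = c
    · subst hdc; simp at hdt
    · rw [Function.update_of_ne hdc] at hdt ⊢
      exact hs.rest d hd hd2 (by omega)
  · refine compl_step h hs hc ?_ hcur (by simp) rfl
    rintro b' m ⟨t, ht, h1, h2⟩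
    refine ⟨t, by omega, ?_, fun d hd hd2 => ?_⟩
    · rw [Function.update_of_ne (by omega)]; exact h1
    · rw [hst d t ht, h2 d hd hd2]

/-- The sweep passes a red point outside the gap, and the record is improved if possible. -/
theorem ChainState.red_step (h : ChainHyp N X Y col ty e nx)
    (hs : ChainState N X Y col ty e nx st ev bg bb bq τ b q g) (hc : c = nx b q) (hcN : c ≠ N)
    (hcol : col c ≠ 1) (hty : ty c ≠ 2) {g' : ℕ}
    (hg : g' = if ty c = ty b ∧ X c < X b then g - 1 else g + 1) :
    (bg τ < g' → ChainState N X Y col ty e nx st ev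
      (Function.update bg τ g') (Function.update bb τ b) (Function.update bq τ c) τ b c g') ∧
    (¬ bg τ < g' → ChainState N X Y col ty e nx st ev bg bb bq τ b c g') := by
  obtain ⟨hc1, hc2, hc3, hc4, hc5⟩ := hs.next h hc hcN
  obtain ⟨hb, hbc, hbt, hq, hside⟩ := hs.cur.tan
  have hx := h.gp.inj b hb c hc1 hc2.symm
  have hxx : ¬ X b < X c ↔ X c < X b := ⟨fun h => lt_of_le_of_ne (not_lt.1 h) hx.symm, fun h => h.not_gt⟩
  have hother : ∀ d < N, col d ≠ 1 → d ≠ c → (Abv N X Y b c d ↔ Abv N X Y b q d) := by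
    intro d hd hdc hne
    exact hc5 d hd (by rintro rfl; exact hdc hbc) hne
  have hcur : ChainRec N X Y col ty e st τ b c g' := by
    refine ⟨EdgeTan.red_step h hs hc hcN hcol, ?_, ?_⟩
    · rw [hg, hs.cur.good, hbt]
      by_cases hcase : ty c = e ∧ X c < X b
      · rw [if_pos hcase]
        have : edgeGood N X Y col ty e b c = (edgeGood N X Y col ty e b q).erase c := by
          ext d
          simp only [edgeGood, Finset.mem_filter, Finset.mem_erase, Finset.mem_range]
          by_cases hdc : d = c
          · subst hdc
            simp only [hc4, hxx, hcase.1, hcase.2]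
            simp
          · constructor
            · rintro ⟨h1, h2, h3⟩
              exact ⟨hdc, h1, h2, by rw [← hother d h1 h2 hdc]; exact h3⟩
            · rintro ⟨-, h1, h2, h3⟩
              exact ⟨h1, h2, by rw [hother d h1 h2 hdc]; exact h3⟩
        rw [this, Finset.card_erase_of_mem]
        simp only [edgeGood, Finset.mem_filter, Finset.mem_range]
        refine ⟨hc1, hcol, hty, ?_⟩
        rw [hc3]
        simp [hcase.1, hcase.2.le]
      · rw [if_neg hcase]
        have hgood : (Abv N X Y b c c ↔ ty c ≠ e) := by
          rw [hc4, hxx]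
          constructor
          · exact fun h1 h2 => hcase ⟨h2, h1⟩
          · exact fun h1 => h.far c hc1 h1 hty b hb hbt
        have : edgeGood N X Y col ty e b c = insert c (edgeGood N X Y col ty e b q) := by
          ext d
          simp only [edgeGood, Finset.mem_filter, Finset.mem_insert, Finset.mem_range]
          by_cases hdc : d = c
          · subst hdc
            simp only [true_or, iff_true]
            exact ⟨hc1, hcol, hty, hgood⟩
          · simp only [hdc, false_or]
            constructor
            · rintro ⟨h1, h2, h3⟩
              exact ⟨h1, h2, by rw [← hother d h1 h2 hdc]; exact h3⟩
            · rintro ⟨h1, h2, h3⟩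
              exact ⟨h1, h2, by rw [hother d h1 h2 hdc]; exact h3⟩
        rw [this, Finset.card_insert_of_notMem]
        simp only [edgeGood, Finset.mem_filter, Finset.mem_range, not_and]
        intro _ _ _ h4
        rw [hc3] at h4
        rw [hc4] at hgood
        tauto
    · intro d hd hd2
      rw [hother d hd (fun hdc => h.blue d hd hdc hd2) (by rintro rfl; exact hty hd2),
        hs.cur.flip d hd hd2]
  constructor
  · intro hlt
    refine ⟨⟨hs.table.st_ev, hs.table.ev_st, ?_⟩, hcur, hs.rest, by simp, ?_⟩
    · intro t ht
      by_cases htt : t = τ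
      · subst htt; simpa using hcur
      · rw [Function.update_of_ne htt, Function.update_of_ne htt, Function.update_of_ne htt]
        exact hs.table.recs t ht
    · refine compl_step h hs hc ?_ hcur (by simp) rfl
      rintro b' m ⟨t, ht, h1, h2⟩
      refine ⟨t, ht, ?_, h2⟩
      by_cases htt : t = τ
      · subst htt; simp; omega
      · rw [Function.update_of_ne htt]; exact h1
  · intro hlt
    exact ⟨hs.table, hcur, hs.rest, by omega, compl_step h hs hc (fun _ _ h => h) hcur (by omega) rfl⟩

theorem ChainState.abv_turn (h : ChainHyp N X Y col ty e nx)
    (hs : ChainState N X Y col ty e nx st ev bg bb bq τ b q g) (hc : c = nx b q) (hcN : c ≠ N)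
    {d : ℕ} (hd : d < N) (hdb : d ≠ b) (hdc : d ≠ c) : Abv N X Y c b d ↔ Abv N X Y b q d := by
  obtain ⟨hc1, hc2, hc3, hc4, hc5⟩ := hs.next h hc hcN
  rw [Bowtie.abv_turn h.gp hc1 hs.cur.tan.b_lt hd hc2 hdc.symm hdb.symm, hc5 d hd hdb hdc]

/-- The sweep turns at a near blue point. -/
theorem ChainState.blue_step (h : ChainHyp N X Y col ty e nx)
    (hs : ChainState N X Y col ty e nx st ev bg bb bq τ b q g) (hc : c = nx b q) (hcN : c ≠ N)
    (hcol : col c = 1) (hty : ty c = ty b) :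
    X b < X c ∧ ChainState N X Y col ty e nx st ev bg bb bq τ c b g := by
  obtain ⟨hc1, hc2, hc3, hc4, hc5⟩ := hs.next h hc hcN
  obtain ⟨hb, hbc, hbt, hq, hside⟩ := hs.cur.tan
  have hlt : X b < X c := by
    rw [← hc3, hside c hc1 hc2 hcol, hty, hbt]
  have hother := fun d => hs.abv_turn h hc hcN (d := d)
  have hcur : ChainRec N X Y col ty e st τ c b g := by
    refine ⟨⟨hc1, hcol, hty.trans hbt, Or.inr ⟨hb, hc2.symm⟩, ?_⟩, ?_, ?_⟩
    · intro d hd hdc hd1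
      by_cases hdb : d = b
      · subst hdb
        unfold Abv
        simp only [hlt.not_gt, hb.ne, ne_eq, not_false_eq_true, le_refl, and_self, not_true_eq_false,
          hbt]
      · rw [hother d hd hdb hdc, hside d hd hdb hd1]
    · rw [hs.cur.good]
      congr 1
      unfold edgeGood
      classical
      refine Finset.filter_congr fun d hd => ?_
      by_cases hdb : d = b
      · subst hdb; simp [hbc]
      by_cases hdc : d = c
      · subst hdc; simp [hcol]
      · rw [hother d (Finset.mem_range.1 hd) hdb hdc]
    · intro d hd hd2
      rw [hs.cur.flip d hd hd2, hother d hd]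
      · rintro rfl; exact h.blue d hd hbc hd2
      · rintro rfl; exact h.blue d hd hcol hd2
  exact ⟨hlt, hs.table, hcur, hs.rest, hs.le,
    compl_step h hs hc (fun _ _ h => h) hcur hs.le (slopeAt_comm _ _ _ _)⟩

/-- No tangent has a slope beyond the crossing with a far blue point. -/
theorem ChainState.finish (h : ChainHyp N X Y col ty e nx)
    (hs : ChainState N X Y col ty e nx st ev bg bb bq τ b q g) (hc : c = nx b q)
    (hfar : c = N ∨ (col c = 1 ∧ ty c ≠ ty b)) (b' : ℕ) (m : ℝ)
    (ht' : LineTan N X Y col ty e b' m) : Covered N X Y col ty e st bg τ b' m := by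
  by_cases hcN : c = N
  · exact hs.compl b' m ht' (Or.inl (hc ▸ hcN))
  obtain ⟨hcol, hty⟩ := hfar.resolve_left hcN
  obtain ⟨hc1, hc2, -⟩ := hs.next h hc hcN
  obtain ⟨hb, hbc, hbt, hq, hside⟩ := hs.cur.tan
  refine hs.compl b' m ht' (Or.inr ?_)
  rw [← hc]
  have h1 := ht'.near b hb hbc hbt
  have h2 := ht'.far c hc1 hcol (hbt ▸ hty)
  have hx : X c < X b := h.far c hc1 (hbt ▸ hty) (h.blue c hc1 hcol) b hb hbt
  have h3 : ht X Y b m c ≤ 0 := by rw [ht_sub b']; linarith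
  have hne := h.gp.inj b hb c hc1 hc2.symm
  by_contra hcon
  have h4 : ¬ slopeAt X Y b c < m := by
    rw [← ht_pos_iff_of_gt hx]
    exact not_lt.2 h3
  have h5 : m = slopeAt X Y b c := le_antisymm (not_lt.1 h4) (not_lt.1 hcon)
  have h6 := (ht_eq_zero_iff hne).2 h5
  rw [ht_sub b'] at h6
  have h7 : ht X Y b' m b = 0 := by linarith
  by_cases hbb : b = b'
  · subst hbb
    exact ht'.ne c hc1 hc2 h5
  · exact ht'.ne b hb hbb ((ht_eq_zero_iff (h.gp.inj b' ht'.b_lt b hb (Ne.symm hbb))).1 h7)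

theorem chainWeight_red (h : ChainHyp N X Y col ty e nx)
    (hs : ChainState N X Y col ty e nx st ev bg bb bq τ b q g) (hc : c = nx b q) (hcN : c ≠ N) :
    ∑ d ∈ Finset.range N, chainWeight N X Y b c d < ∑ d ∈ Finset.range N, chainWeight N X Y b q d := by
  obtain ⟨hc1, hc2, hc3, hc4, hc5⟩ := hs.next h hc hcN
  have hx := h.gp.inj b hs.cur.tan.b_lt c hc1 hc2.symm
  have hcc : chainWeight N X Y b c c < chainWeight N X Y b q c := by
    unfold chainWeight
    rw [if_neg hc2, if_neg hc2]
    simp only [hc3, hc4]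
    rcases lt_or_gt_of_ne hx with hlt | hlt
    · simp [hlt, hlt.not_gt]
    · simp [hlt, hlt.not_gt]
      try simp [hlt.le]
  refine Finset.sum_lt_sum (fun d hd => ?_) ⟨c, Finset.mem_range.2 hc1, hcc⟩
  by_cases hdc : d = c
  · subst hdc; exact hcc.le
  by_cases hdb : d = b
  · subst hdb; simp [chainWeight]
  have h1 := hc5 d (Finset.mem_range.1 hd) hdb hdc
  unfold chainWeight
  simp only [if_neg hdb]
  split_ifs <;> first | omega | tauto

theorem chainWeight_blue (h : ChainHyp N X Y col ty e nx)
    (hs : ChainState N X Y col ty e nx st ev bg bb bq τ b q g) (hc : c = nx b q) (hcN : c ≠ N)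
    (hlt : X b < X c) :
    ∑ d ∈ Finset.range N, chainWeight N X Y c b d < ∑ d ∈ Finset.range N, chainWeight N X Y b q d := by
  obtain ⟨hc1, hc2, hc3, hc4, hc5⟩ := hs.next h hc hcN
  have hb := hs.cur.tan.b_lt
  have hcc : chainWeight N X Y c b c < chainWeight N X Y b q c := by
    unfold chainWeight
    rw [if_neg hc2]
    simp only [hc3]
    simp [hlt, hlt.not_gt]
  refine Finset.sum_lt_sum (fun d hd => ?_) ⟨c, Finset.mem_range.2 hc1, hcc⟩
  by_cases hdc : d = c
  · subst hdc; exact hcc.le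
  by_cases hdb : d = b
  · subst hdb
    have : Abv N X Y c d d := by
      unfold Abv
      simp [hlt.not_gt, hb.ne]
    unfold chainWeight
    rw [if_neg hdc]
    simp [this, hlt]
  have h1 := hs.abv_turn h hc hcN (Finset.mem_range.1 hd) hdb hdc
  unfold chainWeight
  simp only [if_neg hdb, if_neg hdc]
  split_ifs <;> first | omega | tauto | linarith

theorem chainWeight_le : ∑ d ∈ Finset.range N, chainWeight N X Y b q d ≤ 2 * N := by
  calc _ ≤ ∑ d ∈ Finset.range N, 2 := Finset.sum_le_sum fun d _ => by
        unfold chainWeight; split_ifs <;> omega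
    _ = 2 * N := by simp [mul_comm]

/-- The start of a sweep, at the leftmost near point and slope `-∞`. -/
theorem ChainState.start (h : ChainHyp N X Y col ty e nx) (hb : b < N) (hbc : col b = 1)
    (hbt : ty b = e) (hmin : ∀ d < N, ty d = e → d ≠ b → X b < X d)
    (hst : ∀ d < N, st d = N) (hg : bg 0 = 0) (hbb : bb 0 = b) (hbq : bq 0 = N) :
    ChainState N X Y col ty e nx st ev bg bb bq 0 b N 0 := by
  have habv : ∀ d, Abv N X Y b N d ↔ X b < X d := by
    intro d; unfold Abv; simp
  have hcur : ChainRec N X Y col ty e st 0 b N 0 := by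
    refine ⟨⟨hb, hbc, hbt, Or.inl rfl, ?_⟩, ?_, ?_⟩
    · intro d hd hdb hd1
      rw [habv]
      constructor
      · intro hlt
        by_contra hcon
        linarith [h.far d hd hcon (h.blue d hd hd1) b hb hbt]
      · exact fun hty => hmin d hd hty hdb
    · symm
      rw [Finset.card_eq_zero]
      unfold edgeGood
      classical
      rw [Finset.filter_eq_empty_iff]
      rintro d hd ⟨h1, h2, h3⟩
      rw [habv] at h3
      have hd := Finset.mem_range.1 hd
      by_cases hty : ty d = e
      · exact h3.1 (hmin d hd hty (by rintro rfl; exact h1 hbc)) hty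
      · linarith [h.far d hd hty h2 b hb hbt, h3.2 hty]
    · intro d hd hd2
      rw [habv]
      have hdb : d ≠ b := by rintro rfl; exact h.blue d hd hbc hd2
      simp only [not_lt_zero, false_iff]
      intro hiff
      rcases h.gap d hd hd2 with h1 | h1
      · linarith [hiff.1 h1, h1 b hb hbt]
      · linarith [hiff.2 (h1 b hb hbt) b hb hbt, h1 b hb hbt]
  refine ⟨⟨by simp, by simp, ?_⟩, hcur, fun d hd _ _ => hst d hd, by omega, ?_⟩
  · intro t ht
    obtain rfl : t = 0 := by omega
    rw [hg, hbb, hbq]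
    exact hcur
  · intro b' m ht' hm
    exact covered_of_edge h hcur (by omega) ht' (Or.inl rfl) hm

end

end Bowtie

namespace Bowtie

open RealRAM

/-! ### The program: sweeping one chain -/

-- The split, the size of its gap, and the state `(b, q, g, τ)` of a sweep, with the next event `vc`.
notation "vi" => (13 : ℕ)
notation "vm" => (14 : ℕ)
notation "vb" => (15 : ℕ)
notation "vp" => (16 : ℕ)
notation "vg" => (17 : ℕ)
notation "vτ" => (18 : ℕ)
notation "vdone" => (19 : ℕ)
notation "vc" => (20 : ℕ)

-- The blue points from left to right, and the types of the points.
notation "aBlue" => (4 : ℕ)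
notation "aTy" => (5 : ℕ)

-- The tables of the chain `χ`, and its number of stamps.
notation "aSt(" χ ")" => (χ + (10 : ℕ))
notation "aEv(" χ ")" => (χ + (20 : ℕ))
notation "aBg(" χ ")" => (χ + (30 : ℕ))
notation "aBb(" χ ")" => (χ + (40 : ℕ))
notation "aBq(" χ ")" => (χ + (50 : ℕ))
notation "vT(" χ ")" => (χ + (21 : ℕ))

/-- The current edge becomes the record for the current stamp. -/
def recordProg (χ : ℕ) : Prog :=
  .seq (.putNat aBg(χ) (.var vτ) (.var vg))
  (.seq (.putNat aBb(χ) (.var vτ) (.var vb))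
  (.putNat aBq(χ) (.var vτ) (.var vp)))

/-- The sweep passes a red point in the gap. -/
def gapProg (χ : ℕ) : Prog :=
  .seq (.putNat aSt(χ) (.var vc) (.var vτ))
  (.seq (.putNat aEv(χ) (.var vτ) (.var vc))
  (.seq (.setNat vτ (.add (.var vτ) (.const 1)))
  (recordProg χ)))

/-- The sweep passes a red point outside the gap. The orientation `rev` tells whether the near points
are to the left of the far ones, so that the sweep sees the points from right to left. -/
def redProg (χ : ℕ) (rev : Bool) : Prog :=
  .seq (.ite (.and (.natEq (.get aTy (.var vc)) (.get aTy (.var vb)))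
      (bif rev then .natLt (.var vb) (.var vc) else .natLt (.var vc) (.var vb)))
    (.setNat vg (.sub (.var vg) (.const 1)))
    (.setNat vg (.add (.var vg) (.const 1))))
  (.ite (.natLt (.get aBg(χ) (.var vτ)) (.var vg)) (recordProg χ) .skip)

/-- One step of a sweep. -/
def sweepProg (χ nxArr : ℕ) (rev : Bool) : Prog :=
  .seq (.setNat vc (.get nxArr (cellAt (.var vb) (.var vp))))
  (.ite (.natEq (.var vc) (.var vN)) (.setNat vdone (.const 1))
  (.ite (.natEq (.get aCol (.var vc)) (.const 1))
    (.ite (.natEq (.get aTy (.var vc)) (.get aTy (.var vb)))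
      (.seq (.setNat vp (.var vb)) (.setNat vb (.var vc)))
      (.setNat vdone (.const 1)))
    (.seq (.setNat vp (.var vc))
      (.ite (.natEq (.get aTy (.var vc)) (.const 2)) (gapProg χ) (redProg χ rev)))))

/-- The start of a sweep at the point `b`. -/
def sweepInit (χ : ℕ) : Prog :=
  .seq (.setNat vp (.var vN))
  (.seq (.setNat vg (.const 0))
  (.seq (.setNat vτ (.const 0))
  (.seq (.setNat vdone (.const 0))
  (recordProg χ))))

/-- The sweep of the chain `χ` that starts at `b` and follows the lists in the array `nxArr`. -/
def chainProg (χ nxArr : ℕ) (rev : Bool) : Prog :=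
  .seq (.setNat vu (.const 0))
  (.seq (Prog.upto vu (.var vN) (.putNat aSt(χ) (.var vu) (.var vN)))
  (.seq (sweepInit χ)
  (.seq (.loop (.natEq (.var vdone) (.const 0)) (sweepProg χ nxArr rev))
  (.setNat vT(χ) (.var vτ)))))

/-- What the sweep of the chain `χ` leaves unchanged. -/
structure ChainFrame (χ : ℕ) (s s' : State) : Prop where
  arr : ∀ a, a ≠ aSt(χ) → a ≠ aEv(χ) → a ≠ aBg(χ) → a ≠ aBb(χ) → a ≠ aBq(χ) → s'.natArr a = s.natArr a
  realArr : s'.realArr = s.realArr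
  nat : ∀ v, v ≠ vu → v < 15 ∨ 20 < v → v ≠ vT(χ) → s'.nat v = s.nat v

attribute [local simp] NExpr.eval RExpr.eval BExpr.Holds State.setNat State.setReal State.putNat
  State.putReal Prog.run Function.update_apply cellAt slopeExpr

theorem ChainFrame.trans {χ : ℕ} {s s' s'' : State} (h : ChainFrame χ s s')
    (h' : ChainFrame χ s' s'') : ChainFrame χ s s'' :=
  ⟨fun a h1 h2 h3 h4 h5 => (h'.arr a h1 h2 h3 h4 h5).trans (h.arr a h1 h2 h3 h4 h5),
    h'.realArr.trans h.realArr, fun v h1 h2 h3 => (h'.nat v h1 h2 h3).trans (h.nat v h1 h2 h3)⟩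

theorem ChainFrame.base {n N : ℕ} {x y : ℕ → ℝ} {col : ℕ → ℕ} {χ : ℕ} {s s' : State}
    (hf : ChainFrame χ s s') (h : Base n N x y col s) : Base n N x y col s' := by
  refine h.frame (hf.nat _ ?_ ?_ ?_) (hf.nat _ ?_ ?_ ?_) ?_ ?_ (hf.arr _ ?_ ?_ ?_ ?_ ?_)
    (hf.arr _ ?_ ?_ ?_ ?_ ?_) <;> first | omega | simp [hf.realArr]

theorem ChainFrame.of_frame {χ : ℕ} {p : Prog} {s s' : State} (h : Frame p s s')
    (hv : ∀ v ∈ p.natVars, v = vu ∨ (15 ≤ v ∧ v ≤ 20) ∨ v = vT(χ))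
    (ha : ∀ a ∈ p.natArrs, a = aSt(χ) ∨ a = aEv(χ) ∨ a = aBg(χ) ∨ a = aBb(χ) ∨ a = aBq(χ))
    (hr : p.realArrs = []) : ChainFrame χ s s' := by
  refine ⟨fun a h1 h2 h3 h4 h5 => h.arr a fun h6 => ?_, funext fun a => h.realArr a (by simp [hr]),
    fun v h1 h2 h3 => h.nat v fun h4 => ?_⟩
  · have := ha a h6; tauto
  · have := hv v h4; omega

/-- The memory holds the complete tables of the chain `χ`, with `T` stamps. -/
def ChainRes (N : ℕ) (X Y : ℕ → ℝ) (col ty : ℕ → ℕ) (e χ T : ℕ) (s : State) : Prop :=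
  s.nat vT(χ) = T ∧ ChainTable N X Y col ty e (s.natArr aSt(χ)) (s.natArr aEv(χ))
    (s.natArr aBg(χ)) (s.natArr aBb(χ)) (s.natArr aBq(χ)) T ∧
  ∀ b m, LineTan N X Y col ty e b m →
    Covered N X Y col ty e (s.natArr aSt(χ)) (s.natArr aBg(χ)) T b m

/-- The invariant of a sweep that was started in the memory `s₀`, with fuel `f`. -/
def SweepInv (N : ℕ) (X Y : ℕ → ℝ) (col ty : ℕ → ℕ) (e χ : ℕ) (nx : ℕ → ℕ → ℕ) (s₀ : State)
    (f : ℕ) (s : State) : Prop :=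
  ChainFrame χ s₀ s ∧ ChainState N X Y col ty e nx (s.natArr aSt(χ)) (s.natArr aEv(χ))
    (s.natArr aBg(χ)) (s.natArr aBb(χ)) (s.natArr aBq(χ)) (s.nat vτ) (s.nat vb) (s.nat vp)
    (s.nat vg) ∧
  (s.nat vdone ≠ 0 → nx (s.nat vb) (s.nat vp) = N ∨ (col (nx (s.nat vb) (s.nat vp)) = 1 ∧
    ty (nx (s.nat vb) (s.nat vp)) ≠ ty (s.nat vb))) ∧
  f = (∑ d ∈ Finset.range N, chainWeight N X Y (s.nat vb) (s.nat vp) d) +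
    if s.nat vdone = 0 then 1 else 0

section

variable {n N : ℕ} {x y X Y : ℕ → ℝ} {col ty : ℕ → ℕ} {e χ nxArr : ℕ} {rev : Bool} {s₀ : State}

theorem sweep_step (hχ : nxArr < 10) (hB : Base n N x y col s₀) (hty : s₀.natArr aTy = ty)
    (h : ChainHyp N X Y col ty e (row s₀ N nxArr))
    (hdir : ∀ c < N, ∀ b < N, (X c < X b ↔ bif rev then b < c else c < b))
    (f : ℕ) (s : State) (hI : SweepInv N X Y col ty e χ (row s₀ N nxArr) s₀ f s)
    (hc : s.nat vdone = 0) : ∃ f' < f,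
      SweepInv N X Y col ty e χ (row s₀ N nxArr) s₀ f' ((sweepProg χ nxArr rev).run s) := by
  obtain ⟨hF, hS, -, rfl⟩ := hI
  have hB' := hF.base hB
  have hb := hS.cur.tan.b_lt
  have hN := hB'.N_eq
  have hcol := hB'.col_eq
  have hty' : s.natArr aTy = ty := by
    rw [hF.arr] <;> omega
  have hoff := hB'.off_eq _ hb
  obtain ⟨c, hcdef⟩ : ∃ c, c = row s₀ N nxArr (s.nat vb) (s.nat vp) := ⟨_, rfl⟩
  have hc' : s.natArr nxArr (s.nat vb * (N + 1) + s.nat vp) = c := by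
    rw [hF.arr nxArr (by omega) (by omega) (by omega) (by omega) (by omega), hcdef]; rfl
  rw [hc, if_pos rfl]
  have hstep : ChainFrame χ s ((sweepProg χ nxArr rev).run s) := by
    refine .of_frame (.of_loopFree (by cases rev <;> rfl) s) ?_ ?_ rfl
    · simp [sweepProg, gapProg, redProg, recordProg, Prog.natVars]
    · simp [sweepProg, gapProg, redProg, recordProg, Prog.natArrs]
  by_cases hcN : c = N
  · have hrun : (sweepProg χ nxArr rev).run s = (s.setNat vc c).setNat vdone 1 := by
      simp [sweepProg, hoff, hc', hN, hcN]
    rw [hrun] at hstep ⊢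
    refine ⟨_, ?_, hF.trans hstep,
      by simpa using hS, ?_, rfl⟩
    · simp
    · intro _
      left
      simp only [State.setNat, Function.update_apply]
      simp [← hcdef, hcN]
  obtain ⟨hcl, hcb, -⟩ := hS.next h hcdef hcN
  by_cases hcol1 : col c = 1
  · by_cases htyc : ty c = ty (s.nat vb)
    · obtain ⟨h1, h2⟩ := hS.blue_step h hcdef hcN hcol1 htyc
      have h3 := chainWeight_blue h hS hcdef hcN h1
      have hrun : (sweepProg χ nxArr rev).run s =
          ((s.setNat vc c).setNat vp (s.nat vb)).setNat vb c := by
        simp [sweepProg, hoff, hc', hN, hcN, hcol, hcol1, hty', htyc]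
      rw [hrun] at hstep ⊢
      refine ⟨_, ?_, hF.trans hstep,
        by simpa using h2, by simp [hc], rfl⟩
      · simp [hc]; omega
    · have hrun : (sweepProg χ nxArr rev).run s = (s.setNat vc c).setNat vdone 1 := by
        simp [sweepProg, hoff, hc', hN, hcN, hcol, hcol1, hty', htyc]
      rw [hrun] at hstep ⊢
      refine ⟨_, ?_, hF.trans hstep,
        by simpa using hS, ?_, rfl⟩
      · simp
      · intro _
        right
        simp only [State.setNat, Function.update_apply]
        simp [← hcdef, hcol1, htyc]
  have hw := chainWeight_red h hS hcdef hcN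
  by_cases hty2 : ty c = 2
  · have h2 := hS.gap_step h hcdef hcN hty2
    have hrun : (sweepProg χ nxArr rev).run s =
        (gapProg χ).run ((s.setNat vc c).setNat vp c) := by
      simp [sweepProg, hoff, hc', hN, hcN, hcol, hcol1, hty', hty2]
    rw [hrun] at hstep ⊢
    refine ⟨_, ?_, hF.trans hstep, ?_, ?_, rfl⟩
    · simp [gapProg, recordProg, hc]; omega
    · simpa [gapProg, recordProg] using h2
    · simp [gapProg, recordProg, hc]
  · obtain ⟨h1, h2⟩ := hS.red_step h hcdef hcN hcol1 hty2 rfl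
    set g' := if ty c = ty (s.nat vb) ∧ X c < X (s.nat vb) then s.nat vg - 1 else s.nat vg + 1
      with hg'
    have hrun : (sweepProg χ nxArr rev).run s =
        if s.natArr aBg(χ) (s.nat vτ) < g' then
          (recordProg χ).run (((s.setNat vc c).setNat vp c).setNat vg g')
        else (((s.setNat vc c).setNat vp c).setNat vg g') := by
      have hd := hdir c hcl _ hb
      rw [hg']
      by_cases hcase : ty c = ty (s.nat vb) ∧ X c < X (s.nat vb)
      · have hd' := hd.1 hcase.2
        rw [if_pos hcase]
        cases rev <;> simp at hd' <;>
          simp [sweepProg, hoff, hc', hN, hcN, hcol, hcol1, hty', redProg, hcase.1, hd',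
            hcase.1 ▸ hty2]
      · rw [if_neg hcase]
        rw [hd] at hcase
        by_cases htyc : ty c = ty (s.nat vb)
        · cases rev <;> simp only [htyc, cond_true, cond_false, true_and] at hcase <;>
            simp [sweepProg, hoff, hc', hN, hcN, hcol, hcol1, hty', redProg, htyc, htyc ▸ hty2,
              hcase]
        · cases rev <;>
            simp [sweepProg, hoff, hc', hN, hcN, hcol, hcol1, hty', redProg, htyc, hty2]
    rw [hrun] at hstep ⊢
    clear hrun
    split_ifs at hstep ⊢ with hlt
    · refine ⟨_, ?_, hF.trans hstep, ?_, ?_, rfl⟩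
      · simp [recordProg, hc]; omega
      · simpa [recordProg] using h1 hlt
      · simp [recordProg, hc]
    · refine ⟨_, ?_, hF.trans hstep, ?_, ?_, rfl⟩
      · simp [hc]; omega
      · simpa using h2 hlt
      · simp [hc]

theorem runs_chainProg (χ nxArr : ℕ) (rev : Bool) (hχ : nxArr < 10) : ∃ K,
    ∀ (n N : ℕ) (x y X Y : ℕ → ℝ) (col ty : ℕ → ℕ) (e : ℕ) (s₀ : State), Base n N x y col s₀ →
    s₀.natArr aTy = ty → ChainHyp N X Y col ty e (row s₀ N nxArr) →
    (∀ c < N, ∀ b < N, (X c < X b ↔ bif rev then b < c else c < b)) →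
    s₀.nat vb < N → col (s₀.nat vb) = 1 → ty (s₀.nat vb) = e →
    (∀ d < N, ty d = e → d ≠ s₀.nat vb → X (s₀.nat vb) < X d) →
    Runs (chainProg χ nxArr rev) s₀ (K * (N + 1)) fun s =>
      ChainFrame χ s₀ s ∧ ∃ T, ChainRes N X Y col ty e χ T s := by
  have hlf : (sweepProg χ nxArr rev).loopFree = true := by
    cases rev <;> rfl
  refine ⟨100 + (sweepInit χ).time + 2 * (20 + (sweepProg χ nxArr rev).time), ?_⟩
  intro n N x y X Y col ty e s₀ hB hty h hdir hb hbc hbt hmin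
  have hfr : ∀ {p : Prog} {s : State}, p.loopFree = true → (∀ v ∈ p.natVars, v = vu ∨
      (15 ≤ v ∧ v ≤ 20) ∨ v = vT(χ)) → (∀ a ∈ p.natArrs, a = aSt(χ) ∨ a = aEv(χ) ∨ a = aBg(χ) ∨
      a = aBb(χ) ∨ a = aBq(χ)) → p.realArrs = [] → ChainFrame χ s (p.run s) :=
    fun h1 h2 h3 h4 => .of_frame (.of_loopFree h1 _) h2 h3 h4
  refine (Runs.seq (P := fun s => s.nat vu = 0 ∧ ChainFrame χ s₀ s ∧ s.nat vb = s₀.nat vb)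
    (Runs.of_loopFree rfl ⟨by simp, hfr rfl (by simp [Prog.natVars]) (by simp [Prog.natArrs]) rfl,
      by simp⟩)
    fun s hs => Runs.seq (P := fun s => s.nat vu = N ∧ (ChainFrame χ s₀ s ∧ s.nat vb = s₀.nat vb ∧
      ∀ d < N, s.natArr aSt(χ) d = N)) (Runs.upto (T := 3) (K := N)
        (I := fun k s => ChainFrame χ s₀ s ∧ s.nat vb = s₀.nat vb ∧
          ∀ d < k, s.natArr aSt(χ) d = N) ?_ ?_ hs.1 ⟨hs.2.1, hs.2.2, by simp⟩)
    fun s hs => Runs.seq (P := fun s => ∃ f ≤ 2 * N + 1,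
      SweepInv N X Y col ty e χ (row s₀ N nxArr) s₀ f s) (Runs.of_loopFree rfl ?_)
    fun s hs => ?_).mono (T := 2 + ((N + 1) * (3 + 8) + ((sweepInit χ).time +
      ((2 * N + 2) * (4 + (sweepProg χ nxArr rev).time) + 2)))) ?_ fun _ h => h
  · intro k s _ hI _
    simpa using (hI.1.base hB).N_eq
  · intro k s hk hI hv
    obtain ⟨h1, h2, h3⟩ := hI
    have hN := (h1.base hB).N_eq
    refine Runs.of_loopFree rfl ⟨by simpa using hv, (h1.trans (hfr (p := .seq
      (.putNat aSt(χ) (.var vu) (.var vN)) (.setNat vu (.const (k + 1)))) rfl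
      (by simp [Prog.natVars]) (by simp [Prog.natArrs]) rfl)), by simpa using h2, fun d hd => ?_⟩
    by_cases hdk : d = k
    · simp [hdk, hv, hN]
    · simpa [hv, hdk] using h3 d (by omega)
  · obtain ⟨-, h1, h2, h3⟩ := hs
    have hN := (h1.base hB).N_eq
    have hF := h1.trans (hfr (p := sweepInit χ) (s := s) rfl
      (by simp [Prog.natVars, sweepInit, recordProg]) (by simp [Prog.natArrs, sweepInit, recordProg])
      rfl)
    have hst := ChainState.start (st := ((sweepInit χ).run s).natArr aSt(χ))
      (ev := ((sweepInit χ).run s).natArr aEv(χ)) (bg := ((sweepInit χ).run s).natArr aBg(χ))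
      (bb := ((sweepInit χ).run s).natArr aBb(χ)) (bq := ((sweepInit χ).run s).natArr aBq(χ))
      h hb hbc hbt hmin (by simpa [sweepInit, recordProg] using h3)
      (by simp [sweepInit, recordProg]) (by simp [sweepInit, recordProg, h2])
      (by simp [sweepInit, recordProg, hN])
    refine ⟨_, ?_, hF, ?_, ?_, rfl⟩
    · have := chainWeight_le (N := N) (X := X) (Y := Y) (b := ((sweepInit χ).run s).nat vb)
        (q := ((sweepInit χ).run s).nat vp)
      split_ifs <;> omega
    · have e1 : ((sweepInit χ).run s).nat vτ = 0 := by simp [sweepInit, recordProg]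
      have e2 : ((sweepInit χ).run s).nat vb = s₀.nat vb := by simp [sweepInit, recordProg, h2]
      have e3 : ((sweepInit χ).run s).nat vp = N := by simp [sweepInit, recordProg, hN]
      have e4 : ((sweepInit χ).run s).nat vg = 0 := by simp [sweepInit, recordProg]
      rw [e1, e2, e3, e4]
      exact hst
    · simp [sweepInit, recordProg]
  · obtain ⟨f, hf, hI⟩ := hs
    refine Runs.seq ((Runs.loop (I := SweepInv N X Y col ty e χ (row s₀ N nxArr) s₀)
      (K := (sweepProg χ nxArr rev).time) (Q := fun s => s.nat vdone ≠ 0 ∧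
        ∃ f, SweepInv N X Y col ty e χ (row s₀ N nxArr) s₀ f s) ?_ ?_ hI).mono ?_ fun _ h => h)
      fun s hs => Runs.of_loopFree rfl ?_
    · intro f s hI hc
      obtain ⟨f', h1, h2⟩ := sweep_step (rev := rev) hχ hB hty h hdir f s hI (by simpa using hc)
      exact ⟨f', h1, Runs.of_loopFree hlf h2⟩
    · intro f s hI hc
      exact ⟨by simpa using hc, f, hI⟩
    · exact Nat.mul_le_mul (by omega) (by simp [BExpr.cost, NExpr.cost])
    · obtain ⟨h1, f, hF, hS, h2, -⟩ := hs
      have hF' := hF.trans (hfr (p := .setNat vT(χ) (.var vτ)) (s := s) rfl (by simp [Prog.natVars])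
        (by simp [Prog.natArrs]) rfl)
      refine ⟨hF', s.nat vτ, by simp, by simpa using hS.table, ?_⟩
      intro b m ht
      simpa using hS.finish h rfl (h2 h1) b m ht
  · have : (2 * N + 2) * (4 + (sweepProg χ nxArr rev).time) =
      2 * (N + 1) * (4 + (sweepProg χ nxArr rev).time) := by ring
    nlinarith [Nat.zero_le (N * (sweepInit χ).time), Nat.zero_le (N * (sweepProg χ nxArr rev).time)]

end

end Bowtie

namespace Bowtie

open RealRAM

/-! ### The program: combining two chains -/

-- The times on the two chains, and the number of gap points on whose side they agree.
notation "vs" => (25 : ℕ)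
notation "vt" => (26 : ℕ)
notation "vns" => (27 : ℕ)
-- The value of the best pair of edges so far, and the edges.
notation "vbest" => (28 : ℕ)
notation "vb1" => (29 : ℕ)
notation "vq1" => (30 : ℕ)
notation "vb2" => (31 : ℕ)
notation "vq2" => (32 : ℕ)
-- The value of the current pair, and the gap point that is passed next.
notation "vsc" => (33 : ℕ)
notation "vr" => (34 : ℕ)

/-- The gap points on whose side two tangents agree, given the stamps of the gap points on two chains
and the times of the tangents. Two chains with near points on the same side (`same`) start with
opposite sides of the gap, and two chains with near points on different sides start with equal
sides. -/
def agree (N : ℕ) (ty : ℕ → ℕ) (same : Bool) (st₁ st₂ : ℕ → ℕ) (t₁ t₂ : ℕ) : Finset ℕ :=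
  {d ∈ Finset.range N | ty d = 2 ∧ ((st₁ d < t₁ ↔ st₂ d < t₂) ↔ same = false)}

/-- The time on the second chain advances by one. -/
def comboNext (χ₁ χ₂ : ℕ) (same : Bool) : Prog :=
  .seq (.setNat vr (.get aEv(χ₂) (.var vt)))
  (.ite (bif same then .natLt (.get aSt(χ₁) (.var vr)) (.var vs)
      else .not (.natLt (.get aSt(χ₁) (.var vr)) (.var vs)))
    (.setNat vns (.sub (.var vns) (.const 1)))
    (.setNat vns (.add (.var vns) (.const 1))))

/-- The current pair of records becomes the best pair. -/
def comboUpdate (χ₁ χ₂ : ℕ) : Prog :=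
  .seq (.setNat vbest (.var vsc))
  (.seq (.setNat vb1 (.get aBb(χ₁) (.var vs)))
  (.seq (.setNat vq1 (.get aBq(χ₁) (.var vs)))
  (.seq (.setNat vb2 (.get aBb(χ₂) (.var vt)))
  (.setNat vq2 (.get aBq(χ₂) (.var vt))))))

/-- Evaluation of the pair of records for the times `vs` and `vt`. Ties count as improvements, so that the first
pair of all replaces the initial value `0`. -/
def comboBody (χ₁ χ₂ : ℕ) (same : Bool) : Prog :=
  .seq (.setNat vsc (.add (.add (.get aBg(χ₁) (.var vs)) (.get aBg(χ₂) (.var vt))) (.var vns)))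
  (.seq (.ite (.natLt (.var vsc) (.var vbest)) .skip (comboUpdate χ₁ χ₂)) (comboNext χ₁ χ₂ same))

/-- Evaluation of all pairs of records for a fixed time on the first chain. The initial value of `vns` is given
by `agree_zero`. -/
def comboRow (χ₁ χ₂ : ℕ) (same : Bool) : Prog :=
  .seq (.seq (.setNat vns (bif same then .var vs else .sub (.var vm) (.var vs)))
    (.setNat vt (.const 0)))
  (Prog.upto vt (.add (.var vT(χ₂)) (.const 1)) (comboBody χ₁ χ₂ same))

/-- Evaluation of all pairs of records of two chains. -/
def comboProg (χ₁ χ₂ : ℕ) (same : Bool) : Prog :=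
  .seq (.setNat vs (.const 0))
    (Prog.upto vs (.add (.var vT(χ₁)) (.const 1)) (comboRow χ₁ χ₂ same))

attribute [local simp] NExpr.eval RExpr.eval BExpr.Holds State.setNat State.setReal State.putNat
  State.putReal Prog.run Function.update_apply cellAt slopeExpr

/-- The best pair of records found so far satisfies `S`. -/
def Held (S : ℕ → ℕ → ℕ → ℕ → ℕ → Prop) (s : State) : Prop :=
  S (s.nat vb1) (s.nat vq1) (s.nat vb2) (s.nat vq2) (s.nat vbest)

section

variable {N : ℕ} {X Y : ℕ → ℝ} {col ty : ℕ → ℕ} {e : ℕ}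
  {st ev bg bb bq st' : ℕ → ℕ} {T : ℕ}

theorem ChainTable.card_lt (h : ChainTable N X Y col ty e st ev bg bb bq T) {t : ℕ} (ht : t ≤ T) :
    ((Finset.range N).filter fun d => ty d = 2 ∧ st d < t).card = t := by
  have h1 : ((Finset.range N).filter fun d => ty d = 2 ∧ st d < t) = (Finset.range t).image ev := by
    ext d
    simp only [Finset.mem_filter, Finset.mem_range, Finset.mem_image]
    constructor
    · rintro ⟨h1, h2, h3⟩
      exact ⟨st d, h3, h.ev_st d h1 h2 (by omega)⟩
    · rintro ⟨t', h1, rfl⟩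
      obtain ⟨h2, h3, h4⟩ := h.st_ev t' (by omega)
      exact ⟨h2, h3, by omega⟩
  rw [h1, Finset.card_image_of_injOn, Finset.card_range]
  intro t1 h1 t2 h2 heq
  simp only [Finset.coe_range, Set.mem_Iio] at h1 h2
  rw [← (h.st_ev t1 (by omega)).2.2, ← (h.st_ev t2 (by omega)).2.2, heq]

theorem agree_zero (h : ChainTable N X Y col ty e st ev bg bb bq T) (same : Bool) {t : ℕ}
    (ht : t ≤ T) : (agree N ty same st st' t 0).card =
      bif same then t else ((Finset.range N).filter fun d => ty d = 2).card - t := by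
  have h1 := h.card_lt ht
  cases same
  · simp only [agree, not_lt_zero, iff_false, iff_true, cond_false]
    have h2 := Finset.card_filter_add_card_filter_not (s := (Finset.range N).filter fun d => ty d = 2)
      (fun d => st d < t)
    rw [Finset.filter_filter, Finset.filter_filter, h1] at h2
    omega
  · simpa [agree] using h1

theorem agree_succ (h : ChainTable N X Y col ty e st' ev bg bb bq T) (same : Bool) {t t' : ℕ}
    (ht : t' < T) : (agree N ty same st st' t (t' + 1)).card =
      if (st (ev t') < t ↔ same = true)
        then (agree N ty same st st' t t').card - 1 else (agree N ty same st st' t t').card + 1 := by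
  obtain ⟨h1, h2, h3⟩ := h.st_ev t' ht
  have h4 : ∀ d < N, ty d = 2 → d ≠ ev t' → (st' d < t' + 1 ↔ st' d < t') := by
    intro d hd hd2 hne
    have : st' d ≠ t' := by
      intro heq
      exact hne (by rw [← heq, h.ev_st d hd hd2 (by omega)])
    omega
  have h5 : ∀ d, d ≠ ev t' → (d ∈ agree N ty same st st' t (t' + 1) ↔
      d ∈ agree N ty same st st' t t') := by
    intro d hd
    simp only [agree, Finset.mem_filter, Finset.mem_range]
    constructor
    · rintro ⟨h6, h7, h8⟩
      exact ⟨h6, h7, by rwa [h4 d h6 h7 hd] at h8⟩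
    · rintro ⟨h6, h7, h8⟩
      exact ⟨h6, h7, by rwa [h4 d h6 h7 hd]⟩
  have h6 : ev t' ∈ agree N ty same st st' t (t' + 1) ↔
      ¬ (st (ev t') < t ↔ same = true) := by
    cases same <;> simp [agree, h1, h2, h3]
  have h7 : ev t' ∈ agree N ty same st st' t t' ↔
      (st (ev t') < t ↔ same = true) := by
    cases same <;> simp [agree, h1, h2, h3]
  split_ifs with hc
  · rw [← Finset.card_erase_of_mem (h7.2 hc)]
    congr 1
    ext d
    by_cases hd : d = ev t'
    · subst hd; simp [h6, hc]
    · simp [h5 d hd, hd]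
  · rw [← Finset.card_insert_of_notMem (mt h7.1 hc)]
    congr 1
    ext d
    by_cases hd : d = ev t'
    · subst hd; simp [h6, hc]
    · simp [h5 d hd, hd]

end

/-- What the combination of two chains leaves unchanged. -/
def ComboFrame (s s' : State) : Prop := s'.natArr = s.natArr ∧ ∀ v < 25, s'.nat v = s.nat v

theorem ComboFrame.of_frame {p : Prog} {s s' : State} (h : Frame p s s')
    (hv : ∀ v ∈ p.natVars, 25 ≤ v) (ha : p.natArrs = []) : ComboFrame s s' :=
  ⟨funext fun a => h.arr a (by simp [ha]), fun v hv' => h.nat v fun h1 => by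
    have := hv v h1; omega⟩

theorem ComboFrame.trans {s s' s'' : State} (h : ComboFrame s s') (h' : ComboFrame s' s'') :
    ComboFrame s s'' := ⟨h'.1.trans h.1, fun v hv => (h'.2 v hv).trans (h.2 v hv)⟩

section

variable {N : ℕ} {X₁ Y₁ X₂ Y₂ : ℕ → ℝ} {col ty : ℕ → ℕ} {e₁ e₂ χ₁ χ₂ T₁ T₂ : ℕ} {same : Bool}
  {s₀ : State} {S : ℕ → ℕ → ℕ → ℕ → ℕ → Prop}

/-- The value of a pair of records. -/
def comboScore (N : ℕ) (ty : ℕ → ℕ) (same : Bool) (χ₁ χ₂ : ℕ) (s : State) (t₁ t₂ : ℕ) : ℕ :=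
  s.natArr aBg(χ₁) t₁ + s.natArr aBg(χ₂) t₂ +
    (agree N ty same (s.natArr aSt(χ₁)) (s.natArr aSt(χ₂)) t₁ t₂).card

/-- The invariant of the combination of two chains, when the pairs in `D` have been evaluated. -/
structure ComboInv (N : ℕ) (ty : ℕ → ℕ) (same : Bool) (χ₁ χ₂ : ℕ)
    (S : ℕ → ℕ → ℕ → ℕ → ℕ → Prop) (s₀ : State) (D : Set (ℕ × ℕ)) (s : State) : Prop where
  frame : ComboFrame s₀ s
  le : s₀.nat vbest ≤ s.nat vbest
  held : Held S s ∨ (s.nat vbest = 0 ∧ D = ∅)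
  score : ∀ p ∈ D, comboScore N ty same χ₁ χ₂ s₀ p.1 p.2 ≤ s.nat vbest

theorem ComboInv.congr {D : Set (ℕ × ℕ)} {s s' : State} (h : ComboInv N ty same χ₁ χ₂ S s₀ D s)
    (hf : ComboFrame s s') (hv : ∀ v, 28 ≤ v → v ≤ 32 → s'.nat v = s.nat v) :
    ComboInv N ty same χ₁ χ₂ S s₀ D s' := by
  refine ⟨h.frame.trans hf, ?_, ?_, ?_⟩
  · rw [hv _ (by omega) (by omega)]; exact h.le
  · unfold Held
    rw [hv vb1 (by omega) (by omega), hv vb2 (by omega) (by omega), hv vq1 (by omega) (by omega),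
      hv vq2 (by omega) (by omega), hv vbest (by omega) (by omega)]
    exact h.held
  · rw [hv _ (by omega) (by omega)]; exact h.score

theorem combo_step
    (h₂ : ChainTable N X₂ Y₂ col ty e₂ (s₀.natArr aSt(χ₂)) (s₀.natArr aEv(χ₂)) (s₀.natArr aBg(χ₂))
      (s₀.natArr aBb(χ₂)) (s₀.natArr aBq(χ₂)) T₂) {t₁ t₂ : ℕ}
    (hS : S (s₀.natArr aBb(χ₁) t₁) (s₀.natArr aBq(χ₁) t₁) (s₀.natArr aBb(χ₂) t₂)
      (s₀.natArr aBq(χ₂) t₂) (comboScore N ty same χ₁ χ₂ s₀ t₁ t₂))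
    {D : Set (ℕ × ℕ)} {s : State} (h : ComboInv N ty same χ₁ χ₂ S s₀ D s) (hs : s.nat vs = t₁)
    (ht : s.nat vt = t₂) (hns : s.nat vns =
      (agree N ty same (s₀.natArr aSt(χ₁)) (s₀.natArr aSt(χ₂)) t₁ t₂).card) :
    ComboInv N ty same χ₁ χ₂ S s₀ (insert (t₁, t₂) D) ((comboBody χ₁ χ₂ same).run s) ∧
    ((comboBody χ₁ χ₂ same).run s).nat vs = t₁ ∧ ((comboBody χ₁ χ₂ same).run s).nat vt = t₂ ∧
    (t₂ < T₂ → ((comboBody χ₁ χ₂ same).run s).nat vns =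
      (agree N ty same (s₀.natArr aSt(χ₁)) (s₀.natArr aSt(χ₂)) t₁ (t₂ + 1)).card) := by
  obtain ⟨hf, hle, hheld, hsc⟩ := h
  have hfr : ComboFrame s ((comboBody χ₁ χ₂ same).run s) := by
    refine .of_frame (.of_loopFree (by cases same <;> rfl) s) ?_ rfl
    simp [comboBody, comboUpdate, comboNext, Prog.natVars]
  set sc := comboScore N ty same χ₁ χ₂ s₀ t₁ t₂ with hscdef
  have hsc1 : s₀.natArr aBg(χ₁) t₁ + s₀.natArr aBg(χ₂) t₂ + s.nat vns = sc := by
    rw [hns]; rfl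
  have harr := hf.1
  obtain ⟨s', hs'⟩ : ∃ s' : State, s' = (Prog.seq (.setNat vsc (.add (.add (.get aBg(χ₁) (.var vs))
    (.get aBg(χ₂) (.var vt))) (.var vns)))
    (.ite (.natLt (.var vsc) (.var vbest)) .skip (comboUpdate χ₁ χ₂))).run s := ⟨_, rfl⟩
  have hrun : (comboBody χ₁ χ₂ same).run s = (comboNext χ₁ χ₂ same).run s' := by
    rw [hs']; rfl
  have e1 : s'.natArr = s₀.natArr := by
    rw [← harr, hs']
    simp [comboUpdate]
    split_ifs <;> rfl
  have e2 : s'.nat vs = t₁ ∧ s'.nat vt = t₂ ∧ s'.nat vns = s.nat vns := by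
    rw [hs', ← hs, ← ht]
    simp [comboUpdate]
    split_ifs <;> simp
  have e3 : s.nat vbest ≤ s'.nat vbest ∧ sc ≤ s'.nat vbest ∧ Held S s' := by
    rw [hs']
    by_cases hlt : sc < s.nat vbest
    · have : (Prog.seq (.setNat vsc (.add (.add (.get aBg(χ₁) (.var vs))
          (.get aBg(χ₂) (.var vt))) (.var vns)))
          (.ite (.natLt (.var vsc) (.var vbest)) .skip (comboUpdate χ₁ χ₂))).run s =
          s.setNat vsc sc := by
        simp [harr, hs, ht, hsc1, hlt]
      rw [this]
      refine ⟨by simp, by simpa using hlt.le, ?_⟩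
      simpa [Held] using hheld.resolve_right (by omega)
    · have : (Prog.seq (.setNat vsc (.add (.add (.get aBg(χ₁) (.var vs))
          (.get aBg(χ₂) (.var vt))) (.var vns)))
          (.ite (.natLt (.var vsc) (.var vbest)) .skip (comboUpdate χ₁ χ₂))).run s =
          (comboUpdate χ₁ χ₂).run (s.setNat vsc sc) := by
        simp [harr, hs, ht, hsc1, hlt]
      rw [this]
      refine ⟨by simpa [comboUpdate] using hlt, by simp [comboUpdate], ?_⟩
      simpa [Held, comboUpdate, harr, hs, ht] using hS
  have e4 : ∀ v, 28 ≤ v → v ≤ 32 → ((comboNext χ₁ χ₂ same).run s').nat v = s'.nat v := by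
    intro v h1 h2
    refine (Frame.of_loopFree (p := comboNext χ₁ χ₂ same) (by cases same <;> rfl) s').nat v ?_
    simp [comboNext, Prog.natVars]
    omega
  rw [hrun] at hfr ⊢
  refine ⟨⟨hf.trans hfr, ?_, Or.inl ?_, ?_⟩, ?_, ?_, ?_⟩
  · rw [e4 _ (by omega) (by omega)]; exact hle.trans e3.1
  · unfold Held
    rw [e4 vb1 (by omega) (by omega), e4 vb2 (by omega) (by omega), e4 vq1 (by omega) (by omega),
      e4 vq2 (by omega) (by omega), e4 vbest (by omega) (by omega)]
    exact e3.2.2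
  · rw [e4 _ (by omega) (by omega)]
    rintro p (rfl | hp)
    · exact e3.2.1
    · exact (hsc p hp).trans e3.1
  · rw [← e2.1]
    exact (Frame.of_loopFree (p := comboNext χ₁ χ₂ same) (by cases same <;> rfl) s').nat vs
      (by simp [comboNext, Prog.natVars])
  · rw [← e2.2.1]
    exact (Frame.of_loopFree (p := comboNext χ₁ χ₂ same) (by cases same <;> rfl) s').nat vt
      (by simp [comboNext, Prog.natVars])
  · intro hlt
    rw [agree_succ h₂ same hlt, ← hns]
    cases same <;> simp [comboNext, e1, e2] <;> split_ifs <;> rfl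

theorem runs_comboProg (χ₁ χ₂ : ℕ) (hχ₁ : χ₁ < 4) (hχ₂ : χ₂ < 4) (same : Bool) : ∃ K,
    ∀ (N : ℕ) (X₁ Y₁ X₂ Y₂ : ℕ → ℝ) (col ty : ℕ → ℕ) (e₁ e₂ T₁ T₂ m : ℕ)
      (S : ℕ → ℕ → ℕ → ℕ → ℕ → Prop) (s₀ : State), s₀.nat vT(χ₁) = T₁ → s₀.nat vT(χ₂) = T₂ →
    s₀.nat vm = m → ((Finset.range N).filter fun d => ty d = 2).card = m →
    ChainTable N X₁ Y₁ col ty e₁ (s₀.natArr aSt(χ₁)) (s₀.natArr aEv(χ₁)) (s₀.natArr aBg(χ₁))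
      (s₀.natArr aBb(χ₁)) (s₀.natArr aBq(χ₁)) T₁ →
    ChainTable N X₂ Y₂ col ty e₂ (s₀.natArr aSt(χ₂)) (s₀.natArr aEv(χ₂)) (s₀.natArr aBg(χ₂))
      (s₀.natArr aBb(χ₂)) (s₀.natArr aBq(χ₂)) T₂ →
    (∀ t₁ ≤ T₁, ∀ t₂ ≤ T₂, S (s₀.natArr aBb(χ₁) t₁) (s₀.natArr aBq(χ₁) t₁) (s₀.natArr aBb(χ₂) t₂)
      (s₀.natArr aBq(χ₂) t₂) (comboScore N ty same χ₁ χ₂ s₀ t₁ t₂)) →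
    (Held S s₀ ∨ s₀.nat vbest = 0) →
    Runs (comboProg χ₁ χ₂ same) s₀ (K * (m + 1) ^ 2) fun s =>
      ComboFrame s₀ s ∧ Held S s ∧ s₀.nat vbest ≤ s.nat vbest ∧
      ∀ t₁ ≤ T₁, ∀ t₂ ≤ T₂, comboScore N ty same χ₁ χ₂ s₀ t₁ t₂ ≤ s.nat vbest := by
  have hlf : (comboBody χ₁ χ₂ same).loopFree = true := by cases same <;> rfl
  refine ⟨100 + 20 * (comboBody χ₁ χ₂ same).time, ?_⟩
  intro N X₁ Y₁ X₂ Y₂ col ty e₁ e₂ T₁ T₂ m S s₀ hT₁ hT₂ hvm hm h₁ h₂ hS hheld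
  have hm₁ := h₁.le_card
  have hm₂ := h₂.le_card
  rw [hm] at hm₁ hm₂
  set b := (comboBody χ₁ χ₂ same).time with hb
  refine (Runs.seq (P := fun s => s.nat vs = 0 ∧ ComboInv N ty same χ₁ χ₂ S s₀ {p | p.1 < 0 ∧ p.2 ≤ T₂} s)
    (Runs.of_loopFree rfl ⟨by simp, ?_⟩) fun s hs => (Runs.upto (K := T₁ + 1)
      (T := 6 + (T₂ + 2) * (b + 10)) (I := fun k s => ComboInv N ty same χ₁ χ₂ S s₀
        {p | p.1 < k ∧ p.2 ≤ T₂} s) ?_ ?_ hs.1 hs.2)).mono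
        (T := 2 + (T₁ + 2) * (6 + (T₂ + 2) * (b + 10) + 10)) ?_ ?_
  · refine ⟨.of_frame (.of_loopFree rfl s₀) (by simp [Prog.natVars]) rfl, by simp, ?_, by simp⟩
    simpa [Held] using hheld
  · intro k s _ hI _
    simp [hI.frame.2 vT(χ₁) (by omega), hT₁]
  · intro k s hk hI hsv
    refine Runs.seq (P := fun s => s.nat vt = 0 ∧
      (s.nat vs = k ∧ ComboInv N ty same χ₁ χ₂ S s₀ ({p | p.1 < k ∧ p.2 ≤ T₂} ∪ {p | p.1 = k ∧ p.2 < 0}) s ∧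
        (0 ≤ T₂ → s.nat vns =
          (agree N ty same (s₀.natArr aSt(χ₁)) (s₀.natArr aSt(χ₂)) k 0).card)))
      (T := 6) ((Runs.of_loopFree (by cases same <;> rfl) ⟨by simp, by simpa using hsv, ?_, ?_⟩).mono ?_
        fun _ h => h)
      fun s hs => ((Runs.upto (K := T₂ + 1) (T := b)
        (I := fun k' s => s.nat vs = k ∧ ComboInv N ty same χ₁ χ₂ S s₀
          ({p | p.1 < k ∧ p.2 ≤ T₂} ∪ {p | p.1 = k ∧ p.2 < k'}) s ∧ (k' ≤ T₂ → s.nat vns =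
          (agree N ty same (s₀.natArr aSt(χ₁)) (s₀.natArr aSt(χ₂)) k k').card)) ?_ ?_ hs.1 hs.2)).mono
          le_rfl ?_
    · cases same <;> simp [Prog.time, NExpr.cost]
    · have : {p : ℕ × ℕ | p.1 < k ∧ p.2 ≤ T₂} ∪ {p | p.1 = k ∧ p.2 < 0} =
        {p | p.1 < k ∧ p.2 ≤ T₂} := by simp
      rw [this]
      refine hI.congr (.of_frame (.of_loopFree (by cases same <;> rfl) s) (by simp [Prog.natVars]) rfl) ?_
      intro v h1 h2
      refine (Frame.of_loopFree (by cases same <;> rfl) s).nat v ?_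
      simp [Prog.natVars]
      omega
    · intro _
      rw [agree_zero h₁ same (by omega), hm]
      cases same <;> simp [hsv, hI.frame.2 vm (by omega), hvm]
    · intro k' s _ hI _
      simp [hI.2.1.frame.2 vT(χ₂) (by omega), hT₂]
    · intro k' s hk' hI ht
      obtain ⟨h1, h2, h3, h4⟩ := combo_step h₂ (hS k (by omega) k' (by omega))
        hI.2.1 hI.1 ht (hI.2.2 (by omega))
      refine Runs.of_loopFree hlf ⟨h3, by simpa using h2, ?_, ?_⟩
      · have hset : insert (k, k') ({p : ℕ × ℕ | p.1 < k ∧ p.2 ≤ T₂} ∪ {p | p.1 = k ∧ p.2 < k'}) =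
            {p | p.1 < k ∧ p.2 ≤ T₂} ∪ {p | p.1 = k ∧ p.2 < k' + 1} := by
          ext ⟨a, c⟩
          simp only [Set.mem_insert_iff, Set.mem_union, Set.mem_ofPred_eq, Prod.mk.injEq]
          omega
        rw [← hset]
        refine h1.congr ⟨rfl, fun v hv => ?_⟩ fun v h5 h6 => ?_
        · simp; omega
        · simp; omega
      · intro h5
        simpa using h4 (by omega)
    · rintro s ⟨h1, h2, h3, -⟩
      refine ⟨h2, ?_⟩
      have hset : {p : ℕ × ℕ | p.1 < k ∧ p.2 ≤ T₂} ∪ {p | p.1 = k ∧ p.2 < T₂ + 1} =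
          {p | p.1 < k + 1 ∧ p.2 ≤ T₂} := by
        ext ⟨a, c⟩
        simp only [Set.mem_union, Set.mem_ofPred_eq]
        omega
      rw [hset] at h3
      refine h3.congr ⟨rfl, fun v hv => ?_⟩ fun v h5 h6 => ?_
      · simp; omega
      · simp; omega
  · have h3 : (T₁ + 2) * (6 + (T₂ + 2) * (b + 10) + 10) ≤
        (2 * (m + 1)) * (18 * (m + 1) + 2 * (m + 1) * (b + 10)) := by
      refine Nat.mul_le_mul (by omega) ?_
      have : (T₂ + 2) * (b + 10) ≤ 2 * (m + 1) * (b + 10) := Nat.mul_le_mul_right _ (by omega)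
      omega
    clear_value b
    nlinarith [Nat.zero_le (m * m * b), Nat.zero_le (m * b)]
  · rintro s ⟨-, hI⟩
    refine ⟨hI.frame, hI.held.resolve_right ?_, hI.le, fun t₁ h1 t₂ h2 =>
      hI.score (t₁, t₂) ⟨by simpa using Nat.lt_succ_of_le h1, h2⟩⟩
    rintro ⟨-, h1⟩
    have : ((0, 0) : ℕ × ℕ) ∈ (∅ : Set (ℕ × ℕ)) := by
      rw [← h1]; simp
    exact this

end

end Bowtie

namespace Bowtie

/-! ### Four chains by reflection

A split of the blue points into two wedges has four chains: the two lines have opposite sides of the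
wedges above them, and each of them touches one of the wedges. Reflections reduce all of them to
`ChainHyp`. -/

/-- The orientation of a chain with near points of type `e`. -/
def sg (e : ℕ) : ℝ := if e = 1 then 1 else -1

/-- The `x`-coordinates, reflected such that the near points of type `e` lie to the right. -/
def chX (e : ℕ) (x : ℕ → ℝ) (d : ℕ) : ℝ := sg e * x d

/-- The `y`-coordinates, reflected such that the near points lie above the line; `κ` is `1` for the
line with the points of type `1` above it, and `-1` for the line with these points below it. -/
def chY (κ : ℝ) (e : ℕ) (y : ℕ → ℝ) (d : ℕ) : ℝ := κ * sg e * y d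

theorem sg_eq (e : ℕ) : sg e = 1 ∨ sg e = -1 := by unfold sg; split_ifs <;> simp

theorem sg_ne (e : ℕ) : sg e ≠ 0 := by rcases sg_eq e with h | h <;> simp [h]

theorem slopeAt_ch (κ : ℝ) (e : ℕ) (x y : ℕ → ℝ) (b d : ℕ) :
    slopeAt (chX e x) (chY κ e y) b d = κ * slopeAt x y b d := by
  unfold slopeAt chX chY
  rw [← mul_sub, ← mul_sub, mul_comm κ, mul_assoc, mul_div_mul_left _ _ (sg_ne e), mul_div_assoc]

theorem ht_ch {κ : ℝ} (hκ : κ = 1 ∨ κ = -1) (e : ℕ) (x y : ℕ → ℝ) (b d : ℕ) (m : ℝ) :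
    ht (chX e x) (chY κ e y) b (κ * m) d = κ * sg e * ht x y b m d := by
  unfold ht chX chY
  rcases hκ with rfl | rfl <;> ring

theorem GenPos.ch {N : ℕ} {x y : ℕ → ℝ} (h : GenPos N x y) {κ : ℝ} (hκ : κ = 1 ∨ κ = -1) (e : ℕ) :
    GenPos N (chX e x) (chY κ e y) := by
  refine ⟨fun i hi j hj hij heq => h.inj i hi j hj hij (mul_left_cancel₀ (sg_ne e) heq),
    fun i hi j hj k hk h1 h2 h3 heq => h.slope i hi j hj k hk h1 h2 h3 ?_⟩
  rw [slopeAt_ch, slopeAt_ch] at heq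
  exact mul_left_cancel₀ (by rcases hκ with rfl | rfl <;> norm_num) heq

/-- A distribution of the points, numbered from left to right, over the two wedges and the gap between them:
points of type `0` belong to the west wedge, points of type `1` to the east wedge, and points of type `2` to
the gap. If the west wedge is empty, then the gap may lie on both sides of the east wedge. A red point
outside the gap has a blue point of its own wedge between it and the gap, as `hullW` and `hullE` say. -/
structure Split (N : ℕ) (col ty : ℕ → ℕ) : Prop where
  blue : ∀ d < N, col d = 1 → ty d ≠ 2
  lt : ∀ d < N, ∀ b < N, ty d = 0 → ty b = 1 → d < b
  le_two : ∀ d < N, ty d ≤ 2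
  gapE : ∀ d < N, ty d = 2 → (∀ b < N, ty b = 1 → d < b) ∨ (∀ b < N, ty b = 1 → b < d)
  gapW : ∀ d < N, ty d = 2 → ∀ w < N, ty w = 0 → w < d ∧ ∀ b < N, ty b = 1 → d < b
  hullW : ∀ d < N, ty d = 0 → ∃ a < N, ∃ b < N, col a = 1 ∧ col b = 1 ∧ ty a = 0 ∧ ty b = 1 ∧ d ≤ a
  hullE : ∀ d < N, ty d = 1 → ∃ a < N, ∃ b < N, col a = 1 ∧ col b = 1 ∧
    ty a = 1 ∧ ((a ≤ d ∧ ty b = 1 ∧ d ≤ b) ∨ (a ≤ d ∧ ty b = 0))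

section

variable {N : ℕ} {x y : ℕ → ℝ} {col ty : ℕ → ℕ} {κ : ℝ} {e : ℕ}

theorem Split.chainHyp (h : Split N col ty) (gp : GenPos N x y)
    (hm : ∀ i < N, ∀ j < N, (x i < x j ↔ i < j)) (hκ : κ = 1 ∨ κ = -1) (he : e = 0 ∨ e = 1)
    {nx : ℕ → ℕ → ℕ}
    (hnx : ∀ c < N, Linked N (fun d => κ * slopeAt x y c d) {d | d < N ∧ d ≠ c} (nx c)) :
    ChainHyp N (chX e x) (chY κ e y) col ty e nx := by
  have hX0 : ∀ a < N, ∀ b < N, (chX 0 x a < chX 0 x b ↔ b < a) := by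
    intro a ha b hb
    rw [← hm b hb a ha]
    simp [chX, sg]
  have hX1 : ∀ a < N, ∀ b < N, (chX 1 x a < chX 1 x b ↔ a < b) := by
    intro a ha b hb
    rw [← hm a ha b hb]
    simp [chX, sg]
  refine ⟨gp.ch hκ e, fun b hb => ?_, h.blue, ?_, ?_⟩
  · have : slopeAt (chX e x) (chY κ e y) b = fun d => κ * slopeAt x y b d :=
      funext fun d => slopeAt_ch κ e x y b d
    rw [this]
    exact hnx b hb
  · intro d hd h1 h2 b hb h3
    have := h.le_two d hd
    rcases he with rfl | rfl
    · rw [hX0 d hd b hb]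
      exact h.lt b hb d hd h3 (by omega)
    · rw [hX1 d hd b hb]
      exact h.lt d hd b hb (by omega) h3
  · intro d hd h2
    rcases he with rfl | rfl
    · left
      intro b hb hb0
      rw [hX0 d hd b hb]
      exact (h.gapW d hd h2 b hb hb0).1
    · refine (h.gapE d hd h2).imp (fun h3 b hb hb1 => ?_) (fun h3 b hb hb1 => ?_)
      · rw [hX1 d hd b hb]; exact h3 b hb hb1
      · rw [hX1 b hb d hd]; exact h3 b hb hb1

/-- A tangent of the split: a line of slope `m` through a blue point `b` of type `e`. -/
def Tangent (N : ℕ) (x y : ℕ → ℝ) (col ty : ℕ → ℕ) (κ : ℝ) (e b : ℕ) (m : ℝ) : Prop :=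
  LineTan N (chX e x) (chY κ e y) col ty e b (κ * m)

/-- The slopes on the open edge after `q` of the pencil through `b`. -/
def OnEdge (N : ℕ) (x y : ℕ → ℝ) (κ : ℝ) (nx : ℕ → ℕ → ℕ) (b q : ℕ) (m : ℝ) : Prop :=
  (q = N ∨ κ * slopeAt x y b q < κ * m) ∧ (nx b q = N ∨ κ * m < κ * slopeAt x y b (nx b q))

theorem Tangent.blue_side (hκ : κ = 1 ∨ κ = -1) (he : e = 0 ∨ e = 1) {b : ℕ} {m : ℝ}
    (h : Tangent N x y col ty κ e b m) {d : ℕ} (hd : d < N) (hcol : col d = 1) :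
    (ty d = 0 → κ * ht x y b m d ≤ 0) ∧ (ty d = 1 → 0 ≤ κ * ht x y b m d) := by
  have h1 := h.near d hd hcol
  have h2 := h.far d hd hcol
  rw [ht_ch hκ] at h1 h2
  rcases he with rfl | rfl
  · simp only [sg, zero_ne_one, if_false] at h1 h2
    exact ⟨fun h => by linarith [h1 h], fun h => by linarith [h2 (by omega)]⟩
  · simp only [sg, if_true] at h1 h2
    exact ⟨fun h => by linarith [h2 (by omega)], fun h => by linarith [h1 h]⟩

theorem Tangent.ne_zero (gp : GenPos N x y) {b : ℕ} {m : ℝ}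
    (h : Tangent N x y col ty κ e b m) {d : ℕ} (hd : d < N) (hcol : col d ≠ 1) :
    ht x y b m d ≠ 0 := by
  have hdb : d ≠ b := by rintro rfl; exact hcol h.b_col
  rw [Ne, ht_eq_zero_iff (gp.inj b h.b_lt d hd hdb.symm)]
  intro hm
  refine h.ne d hd hdb ?_
  rw [slopeAt_ch, hm]

theorem mem_lineGood (gp : GenPos N x y) (hty : ∀ d < N, ty d ≤ 2) (hκ : κ = 1 ∨ κ = -1)
    (he : e = 0 ∨ e = 1) {b : ℕ} {m : ℝ}
    (h : Tangent N x y col ty κ e b m) {d : ℕ} :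
    d ∈ lineGood N (chX e x) (chY κ e y) col ty e b (κ * m) ↔
      d < N ∧ col d ≠ 1 ∧
        ((ty d = 0 ∧ 0 < κ * ht x y b m d) ∨ (ty d = 1 ∧ κ * ht x y b m d < 0)) := by
  classical
  unfold lineGood
  rw [Finset.mem_filter, Finset.mem_range]
  refine and_congr_right fun hd => and_congr_right fun hcol => ?_
  have hne := h.ne_zero gp hd hcol
  have hne' : κ * ht x y b m d ≠ 0 := mul_ne_zero (by rcases hκ with rfl | rfl <;> norm_num) hne
  have h2 := hty d hd
  rw [ht_ch hκ, mul_right_comm]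
  set t := κ * ht x y b m d
  have h3 : t < 0 ∨ 0 < t := lt_or_gt_of_ne hne'
  rcases he with rfl | rfl
  · simp only [sg, zero_ne_one, if_false, mul_neg, mul_one, neg_pos]
    rcases h3 with h3 | h3 <;> simp only [h3, h3.not_gt] <;> simp <;> omega
  · simp only [sg, if_true, mul_one]
    rcases h3 with h3 | h3 <;> simp only [h3, h3.not_gt] <;> simp <;> omega

/-- The red points that two lines do not separate strictly, in terms of the heights of the points
above the two lines. -/
noncomputable def unsep (N : ℕ) (col : ℕ → ℕ) (h₁ h₂ : ℕ → ℝ) : Finset ℕ :=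
  open Classical in {d ∈ Finset.range N | col d ≠ 1 ∧ 0 ≤ h₁ d * h₂ d}

theorem ht_sub_affine (b₁ b₂ : ℕ) (m₁ m₂ : ℝ) (d d' : ℕ) :
    (ht x y b₁ m₁ d - ht x y b₂ m₂ d) - (ht x y b₁ m₁ d' - ht x y b₂ m₂ d') =
      (m₂ - m₁) * (x d - x d') := by
  unfold ht; ring

/-- No red point outside the gap is excluded by both lines. The difference of the heights above them changes
its sign only once from left to right, but would have the wrong sign at such a point, and the right sign
at blue points on both sides, or at two blue points of different wedges on one side. -/
theorem Split.exclusive (h : Split N col ty) (hm : ∀ i < N, ∀ j < N, (x i < x j ↔ i < j))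
    {e₁ e₂ : ℕ} (he₁ : e₁ = 0 ∨ e₁ = 1) (he₂ : e₂ = 0 ∨ e₂ = 1) {b₁ b₂ : ℕ} {m₁ m₂ : ℝ}
    (h₁ : Tangent N x y col ty 1 e₁ b₁ m₁) (h₂ : Tangent N x y col ty (-1) e₂ b₂ m₂) {d : ℕ}
    (hd : d < N) (hcol : col d ≠ 1) :
    (ty d = 0 → 0 < ht x y b₁ m₁ d → ¬ ht x y b₂ m₂ d < 0) ∧
    (ty d = 1 → ht x y b₁ m₁ d < 0 → ¬ 0 < ht x y b₂ m₂ d) := by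
  have hs₁ := fun {d} => h₁.blue_side (Or.inl rfl) he₁ (d := d)
  have hs₂ := fun {d} => h₂.blue_side (Or.inr rfl) he₂ (d := d)
  have haff := ht_sub_affine (x := x) (y := y) b₁ b₂ m₁ m₂
  have hlt : ∀ a < N, a ≠ d → a ≤ d → x a < x d := fun a ha hne hle =>
    (hm a ha d hd).2 (by omega)
  have hgt : ∀ a < N, a ≠ d → d ≤ a → x d < x a := fun a ha hne hle =>
    (hm d hd a ha).2 (by omega)
  have hcne : ∀ a, col a = 1 → a ≠ d := by rintro a ha rfl; exact hcol ha
  constructor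
  · intro hty hp hq
    obtain ⟨a, ha, b, hb, hca, hcb, hta, htb, hda⟩ := h.hullW d hd hty
    have e1 := haff a d
    have k1 := hgt a ha (hcne a hca) hda
    have k3 := (hs₁ ha hca).1 hta
    have k4 := (hs₂ ha hca).1 hta
    have k5 := (hs₁ hb hcb).2 htb
    have k6 := (hs₂ hb hcb).2 htb
    have k7 : m₂ - m₁ < 0 := by nlinarith
    have k8 : x a < x b := (hm a ha b hb).2 (h.lt a ha b hb hta htb)
    have k9 : (m₂ - m₁) * (x b - x a) < 0 := mul_neg_of_neg_of_pos k7 (by linarith)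
    linarith [haff b a]
  · intro hty hp hq
    obtain ⟨a, ha, b, hb, hca, hcb, hta, hor⟩ := h.hullE d hd hty
    have e1 := haff a d
    have e2 := haff b d
    have k3 := (hs₁ ha hca).2 hta
    have k4 := (hs₂ ha hca).2 hta
    rcases hor with ⟨h1, h2, h3⟩ | ⟨h1, h2⟩
    · have k1 := hlt a ha (hcne a hca) h1
      have k2 := hgt b hb (hcne b hcb) h3
      have k5 := (hs₁ hb hcb).2 h2
      have k6 := (hs₂ hb hcb).2 h2
      have k7 : m₂ - m₁ < 0 := by nlinarith
      nlinarith
    · have k1 := hlt a ha (hcne a hca) h1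
      have k2 := hlt b hb (hcne b hcb) (h.lt b hb d hd h2 hty).le
      have k5 := (hs₁ hb hcb).1 h2
      have k6 := (hs₂ hb hcb).1 h2
      have k8 : x b < x a := (hm b hb a ha).2 (h.lt b hb a ha h2 hta)
      have k7 : m₂ - m₁ < 0 := by nlinarith
      nlinarith

/-- The number of red points that two tangents of a split do not separate is determined by the
numbers of points that they exclude and by the stamps of the gap points. -/
theorem Split.card_unsep (h : Split N col ty) (gp : GenPos N x y)
    (hm : ∀ i < N, ∀ j < N, (x i < x j ↔ i < j))
    {e₁ e₂ : ℕ} (he₁ : e₁ = 0 ∨ e₁ = 1) (he₂ : e₂ = 0 ∨ e₂ = 1) {b₁ b₂ : ℕ} {m₁ m₂ : ℝ}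
    (h₁ : Tangent N x y col ty 1 e₁ b₁ m₁) (h₂ : Tangent N x y col ty (-1) e₂ b₂ m₂)
    {st₁ st₂ : ℕ → ℕ} {t₁ t₂ : ℕ}
    (hf₁ : ∀ d < N, ty d = 2 → (st₁ d < t₁ ↔
      (LeftOf N (chX e₁ x) ty e₁ d ↔ 0 < ht (chX e₁ x) (chY 1 e₁ y) b₁ (1 * m₁) d)))
    (hf₂ : ∀ d < N, ty d = 2 → (st₂ d < t₂ ↔
      (LeftOf N (chX e₂ x) ty e₂ d ↔ 0 < ht (chX e₂ x) (chY (-1) e₂ y) b₂ (-1 * m₂) d))) :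
    (unsep N col (ht x y b₁ m₁) (ht x y b₂ m₂)).card =
      (lineGood N (chX e₁ x) (chY 1 e₁ y) col ty e₁ b₁ (1 * m₁)).card +
      (lineGood N (chX e₂ x) (chY (-1) e₂ y) col ty e₂ b₂ (-1 * m₂)).card +
      (agree N ty (decide (e₁ = e₂)) st₁ st₂ t₁ t₂).card := by
  classical
  have hn₁ := fun {d} => h₁.ne_zero gp (d := d)
  have hn₂ := fun {d} => h₂.ne_zero gp (d := d)
  have hdisj : Disjoint (lineGood N (chX e₁ x) (chY 1 e₁ y) col ty e₁ b₁ (1 * m₁))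
      (lineGood N (chX e₂ x) (chY (-1) e₂ y) col ty e₂ b₂ (-1 * m₂)) := by
    rw [Finset.disjoint_left]
    intro d hd1 hd2
    rw [mem_lineGood gp h.le_two (Or.inl rfl) he₁ h₁] at hd1
    rw [mem_lineGood gp h.le_two (Or.inr rfl) he₂ h₂] at hd2
    obtain ⟨hd, hcol, h3⟩ := hd1
    obtain ⟨-, -, h4⟩ := hd2
    obtain ⟨h5, h6⟩ := h.exclusive hm he₁ he₂ h₁ h₂ hd hcol
    rcases h3 with ⟨h7, h8⟩ | ⟨h7, h8⟩
    · exact h5 h7 (by linarith) (by rcases h4 with h4 | h4 <;> linarith [h4.2])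
    · exact h6 h7 (by linarith) (by rcases h4 with h4 | h4 <;> linarith [h4.2])
  rw [← Finset.card_union_of_disjoint hdisj, ← Finset.card_union_of_disjoint]
  · congr 1
    ext d
    rw [Finset.mem_union, Finset.mem_union, mem_lineGood gp h.le_two (Or.inl rfl) he₁ h₁,
      mem_lineGood gp h.le_two (Or.inr rfl) he₂ h₂]
    simp only [unsep, agree, Finset.mem_filter, Finset.mem_range]
    by_cases hd : d < N
    swap
    · simp [hd]
    have hty := h.le_two d hd
    have hpm := mul_nonneg_iff (a := ht x y b₁ m₁ d) (b := ht x y b₂ m₂ d)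
    by_cases hcol : col d = 1
    · simp [hcol, h.blue d hd hcol]
    have k1 := lt_or_gt_of_ne (hn₁ hd hcol)
    have k2 := lt_or_gt_of_ne (hn₂ hd hcol)
    obtain ⟨h5, h6⟩ := h.exclusive hm he₁ he₂ h₁ h₂ hd hcol
    simp only [hd, hcol, true_and, not_false_eq_true, ne_eq, one_mul, neg_mul, Left.neg_pos_iff,
      Left.neg_neg_iff]
    by_cases hty2 : ty d = 2
    · simp only [hty2, OfNat.ofNat_ne_zero, OfNat.ofNat_ne_one, false_and, or_self, false_or,
        true_and]
      rw [hf₁ d hd hty2, hf₂ d hd hty2, ht_ch (Or.inl rfl), ht_ch (Or.inr rfl), hpm]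
      have hb₁ := h₁.b_lt
      have hb₂ := h₂.b_lt
      have hbt₁ := h₁.b_ty
      have hbt₂ := h₂.b_ty
      have hL : e₁ ≠ e₂ → LeftOf N (chX e₁ x) ty e₁ d ∧ LeftOf N (chX e₂ x) ty e₂ d := by
        intro hne
        have hgen : ∀ w < N, ty w = 0 → LeftOf N (chX 0 x) ty 0 d ∧ LeftOf N (chX 1 x) ty 1 d := by
          intro w hw hw0
          constructor
          · intro b hb hb0
            have := (hm b hb d hd).2 (h.gapW d hd hty2 b hb hb0).1
            simp [chX, sg, this]
          · intro b hb hb1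
            have := (hm d hd b hb).2 ((h.gapW d hd hty2 w hw hw0).2 b hb hb1)
            simp [chX, sg, this]
        rcases he₁ with rfl | rfl <;> rcases he₂ with rfl | rfl
        · exact absurd rfl hne
        · exact hgen b₁ hb₁ hbt₁
        · exact (hgen b₂ hb₂ hbt₂).symm
        · exact absurd rfl hne
      by_cases heq : e₁ = e₂
      · subst heq
        simp only [decide_true, Bool.true_eq_false, iff_false]
        rcases he₁ with rfl | rfl <;> simp only [sg, if_true, zero_ne_one, if_false] <;>
          rcases k1 with k1 | k1 <;> rcases k2 with k2 | k2 <;>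
          simp [k1, k2, k1.le, k2.le, k1.not_ge, k2.not_ge, k1.not_gt, k2.not_gt]
      · obtain ⟨l1, l2⟩ := hL heq
        simp only [l1, l2, heq, decide_false, iff_true, true_iff]
        rcases he₁ with rfl | rfl <;> rcases he₂ with rfl | rfl <;>
          simp only [sg, if_true, zero_ne_one, if_false] <;>
          first
          | exact absurd rfl heq
          | rcases k1 with k1 | k1 <;> rcases k2 with k2 | k2 <;>
            simp [k1, k2, k1.le, k2.le, k1.not_ge, k2.not_ge, k1.not_gt, k2.not_gt]
    · simp only [hty2, false_and, or_false]
      rw [hpm]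
      have : ty d = 0 ∨ ty d = 1 := by omega
      rcases this with hty' | hty' <;> rcases k1 with k1 | k1 <;> rcases k2 with k2 | k2 <;>
        simp [hty', k1, k2, k1.le, k2.le, k1.not_ge, k2.not_ge, k1.not_gt, k2.not_gt]
      · exact h5 hty' k1 k2
      · exact h6 hty' k1 k2
  · rw [Finset.disjoint_left]
    intro d hd1 hd2
    rw [Finset.mem_union, mem_lineGood gp h.le_two (Or.inl rfl) he₁ h₁,
      mem_lineGood gp h.le_two (Or.inr rfl) he₂ h₂] at hd1
    simp only [agree, Finset.mem_filter] at hd2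
    omega

/-- All lines on an edge with the tangent property are tangents, and exclude the same points. -/
theorem tangent_of_edge {nx : ℕ → ℕ → ℕ}
    (hc : ChainHyp N (chX e x) (chY κ e y) col ty e nx) {st : ℕ → ℕ} {t b q g : ℕ}
    (hr : ChainRec N (chX e x) (chY κ e y) col ty e st t b q g) {m : ℝ}
    (hm : OnEdge N x y κ nx b q m) :
    Tangent N x y col ty κ e b m ∧
    g = (lineGood N (chX e x) (chY κ e y) col ty e b (κ * m)).card ∧
    ∀ d < N, ty d = 2 → (st d < t ↔
      (LeftOf N (chX e x) ty e d ↔ 0 < ht (chX e x) (chY κ e y) b (κ * m) d)) := by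
  obtain ⟨hb, hbc, hbt, hq, hside⟩ := hr.tan
  have key := fun {d} => abv_iff_of_edge hc hb hq (m := κ * m) (d := d)
    (by rw [slopeAt_ch]; exact hm.1) (by rw [slopeAt_ch]; exact hm.2)
  refine ⟨⟨hb, hbc, hbt, fun d hd hdb => ?_, fun d hd hdc hdt => ?_, fun d hd hdc hdt => ?_⟩, ?_, ?_⟩
  · intro heq
    exact (key hd hdb).2 ((ht_eq_zero_iff (hc.gp.inj b hb d hd hdb.symm)).2 heq)
  · by_cases hdb : d = b
    · rw [hdb, ht_self]
    · exact ((key hd hdb).1.1 ((hside d hd hdb hdc).2 hdt)).le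
  · by_cases hdb : d = b
    · rw [hdb, ht_self]
    · exact not_lt.1 fun h => hdt ((hside d hd hdb hdc).1 ((key hd hdb).1.2 h))
  · rw [hr.good]
    congr 1
    classical
    refine Finset.filter_congr fun d hd => ?_
    by_cases hdb : d = b
    · subst hdb; simp [hbc]
    · rw [(key (Finset.mem_range.1 hd) hdb).1]
  · intro d hd hd2
    have hdb : d ≠ b := by rintro rfl; exact hc.blue d hd hbc hd2
    rw [hr.flip d hd hd2, (key hd hdb).1]

end

end Bowtie

namespace Bowtie

open Filter Topology

/-! ### Optimal double wedges are bounded by tangents -/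

section

variable {N : ℕ} {x y : ℕ → ℝ} {col ty : ℕ → ℕ} {κ : ℝ} {e : ℕ}

theorem tangent_of_sides (gp : GenPos N x y) (hty : ∀ d < N, ty d ≤ 2)
    (hb : ∀ d < N, col d = 1 → ty d ≠ 2) (hκ : κ = 1 ∨ κ = -1) {b : ℕ} {m : ℝ} (hbN : b < N)
    (hcol : col b = 1) (hne : ∀ d < N, d ≠ b → ht x y b m d ≠ 0)
    (h₀ : ∀ d < N, col d = 1 → ty d = 0 → κ * ht x y b m d ≤ 0)
    (h₁ : ∀ d < N, col d = 1 → ty d = 1 → 0 ≤ κ * ht x y b m d) :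
    Tangent N x y col ty κ (ty b) b m := by
  have he : ty b = 0 ∨ ty b = 1 := by
    have := hty b hbN
    have := hb b hbN hcol
    omega
  refine ⟨hbN, hcol, rfl, fun d hd hdb heq => hne d hd hdb ?_, fun d hd hc ht => ?_,
    fun d hd hc ht => ?_⟩
  · rw [slopeAt_ch] at heq
    have := mul_left_cancel₀ (by rcases hκ with rfl | rfl <;> norm_num) heq
    exact (ht_eq_zero_iff (gp.inj b hbN d hd hdb.symm)).2 this
  · rw [ht_ch hκ, mul_right_comm]
    rcases he with he | he <;> rw [he] at ht ⊢
    · have := h₀ d hd hc ht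
      simp only [sg, zero_ne_one, if_false]
      linarith
    · have := h₁ d hd hc ht
      simp only [sg, if_true]
      linarith
  · have h3 := hty d hd
    have h4 := hb d hd hc
    rw [ht_ch hκ, mul_right_comm]
    rcases he with he | he <;> rw [he] at ht ⊢
    · have := h₁ d hd hc (by omega)
      simp only [sg, zero_ne_one, if_false]
      linarith
    · have := h₀ d hd hc (by omega)
      simp only [sg, if_true]
      linarith

/-- A line through a blue point can be rotated slightly such that it avoids all other points, respects
the sides of the blue points, and separates no more red points from a second line, whose heights are
given by `r`. -/
theorem exists_rotate (gp : GenPos N x y) (hty : ∀ d < N, ty d ≤ 2)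
    (hb : ∀ d < N, col d = 1 → ty d ≠ 2) (hκ : κ = 1 ∨ κ = -1) (r : ℕ → ℝ) {b : ℕ} {m : ℝ}
    (hbN : b < N) (hcol : col b = 1)
    (h₀ : ∀ d < N, col d = 1 → ty d = 0 → κ * ht x y b m d ≤ 0)
    (h₁ : ∀ d < N, col d = 1 → ty d = 1 → 0 ≤ κ * ht x y b m d) :
    ∃ m', Tangent N x y col ty κ (ty b) b m' ∧
      ∀ d < N, col d ≠ 1 → ht x y b m' d * r d < 0 → ht x y b m d * r d < 0 := by
  by_cases hex : ∃ c < N, c ≠ b ∧ ht x y b m c = 0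
  swap
  · push Not at hex
    exact ⟨m, tangent_of_sides gp hty hb hκ hbN hcol hex h₀ h₁, fun _ _ _ h => h⟩
  obtain ⟨c, hc, hcb, hc0⟩ := hex
  have hxc := gp.inj b hbN c hc hcb.symm
  have hother : ∀ d < N, d ≠ b → d ≠ c → ht x y b m d ≠ 0 := by
    intro d hd hdb hdc h0
    rw [ht_eq_zero_iff (gp.inj b hbN d hd hdb.symm)] at h0
    rw [ht_eq_zero_iff hxc] at hc0
    exact gp.slope b hbN c hc d hd hcb.symm hdb.symm hdc.symm (hc0 ▸ h0)
  -- the side of the line on which `c` should lie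
  obtain ⟨w, hw, hwb, hwr⟩ : ∃ w : ℝ, w ≠ 0 ∧ (col c = 1 → (ty c = 0 → κ * w < 0) ∧
      (ty c = 1 → 0 < κ * w)) ∧ (col c ≠ 1 → 0 ≤ w * r c) := by
    by_cases hcc : col c = 1
    · by_cases ht1 : ty c = 1
      · refine ⟨κ, ?_, fun _ => ⟨fun h => by omega, fun _ => ?_⟩, fun h => absurd hcc h⟩ <;>
          rcases hκ with rfl | rfl <;> norm_num
      · refine ⟨-κ, ?_, fun _ => ⟨fun _ => ?_, fun h => absurd h ht1⟩, fun h => absurd hcc h⟩ <;>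
          rcases hκ with rfl | rfl <;> norm_num
    · rcases le_total 0 (r c) with h | h
      · exact ⟨1, one_ne_zero, fun h => absurd h hcc, fun _ => by linarith⟩
      · exact ⟨-1, by norm_num, fun h => absurd h hcc, fun _ => by linarith⟩
  have hev : ∀ᶠ ε in 𝓝[>] (0 : ℝ), ∀ d ∈ Finset.range N, ht x y b m d ≠ 0 →
      0 < ht x y b m d * ht x y b (m - w * (x c - x b) * ε) d := by
    rw [eventually_all_finset]
    intro d _
    by_cases h0 : ht x y b m d = 0
    · simp [h0]
    have hcont : Continuous fun ε : ℝ => ht x y b m d * ht x y b (m - w * (x c - x b) * ε) d := by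
      unfold ht; fun_prop
    have h1 : 0 < ht x y b m d * ht x y b (m - w * (x c - x b) * 0) d := by
      rw [mul_zero, sub_zero]
      exact mul_self_pos.2 h0
    filter_upwards [(hcont.tendsto 0).mono_left nhdsWithin_le_nhds (lt_mem_nhds h1)] with ε h _
    exact h
  obtain ⟨ε, hε, hpos⟩ := (hev.and self_mem_nhdsWithin).exists
  replace hpos : 0 < ε := hpos
  set m' := m - w * (x c - x b) * ε with hm'
  have hcw : ht x y b m' c = w * (ε * (x c - x b) ^ 2) := by
    have : ht x y b m' c = ht x y b m c + w * (ε * (x c - x b) ^ 2) := by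
      rw [hm']; unfold ht; ring
    rw [this, hc0, zero_add]
  have hpos' : 0 < ε * (x c - x b) ^ 2 := mul_pos hpos (by have := sub_ne_zero.2 hxc.symm; positivity)
  refine ⟨m', tangent_of_sides gp hty hb hκ hbN hcol ?_ ?_ ?_, ?_⟩
  · intro d hd hdb
    by_cases hdc : d = c
    · rw [hdc, hcw]; exact mul_ne_zero hw hpos'.ne'
    · exact right_ne_zero_of_mul (hε d (Finset.mem_range.2 hd) (hother d hd hdb hdc)).ne'
  · intro d hd hdc ht0
    by_cases hdc' : d = c
    · subst hdc'
      rw [hcw, ← mul_assoc]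
      exact (mul_neg_of_neg_of_pos ((hwb hdc).1 ht0) hpos').le
    by_cases hdb : d = b
    · rw [hdb, ht_self, mul_zero]
    have h1 := hε d (Finset.mem_range.2 hd) (hother d hd hdb hdc')
    have h2 := h₀ d hd hdc ht0
    rcases hκ with rfl | rfl <;> nlinarith
  · intro d hd hdc ht0
    by_cases hdc' : d = c
    · subst hdc'
      rw [hcw, ← mul_assoc]
      exact (mul_pos ((hwb hdc).2 ht0) hpos').le
    by_cases hdb : d = b
    · rw [hdb, ht_self, mul_zero]
    have h1 := hε d (Finset.mem_range.2 hd) (hother d hd hdb hdc')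
    have h2 := h₁ d hd hdc ht0
    rcases hκ with rfl | rfl <;> nlinarith
  · intro d hd hdc hlt
    have hdb : d ≠ b := by rintro rfl; exact hdc hcol
    by_cases hdc' : d = c
    · subst hdc'
      rw [hcw] at hlt
      nlinarith [mul_nonneg (hwr hdc) hpos'.le]
    have h1 := hε d (Finset.mem_range.2 hd) (hother d hd hdb hdc')
    rcases mul_pos_iff.1 h1 with ⟨h2, h3⟩ | ⟨h2, h3⟩
    · exact mul_neg_of_pos_of_neg h2 (by nlinarith)
    · exact mul_neg_of_neg_of_pos h2 (by nlinarith)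

/-- The height of the point `d` above the line with slope `m` and intercept `a`. -/
def hgt (x y : ℕ → ℝ) (m a : ℝ) (d : ℕ) : ℝ := y d - (m * x d + a)

theorem ht_eq_hgt (b : ℕ) (m : ℝ) : ht x y b m = hgt x y m (y b - m * x b) := by
  funext d; unfold ht hgt; ring

/-- A line with the blue points on the prescribed sides can be moved towards a second line with the
opposite sides until it touches a blue point, and then rotated slightly. No red point moves into the double
wedge, as the swept region lies in it. -/
theorem exists_tangent (gp : GenPos N x y) (hty : ∀ d < N, ty d ≤ 2)
    (hb : ∀ d < N, col d = 1 → ty d ≠ 2) (hex : ∃ b < N, col b = 1) (hκ : κ = 1 ∨ κ = -1)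
    {m a m' a' : ℝ}
    (h₀ : ∀ d < N, col d = 1 → ty d = 0 → κ * hgt x y m a d ≤ 0 ∧ 0 ≤ κ * hgt x y m' a' d)
    (h₁ : ∀ d < N, col d = 1 → ty d = 1 → 0 ≤ κ * hgt x y m a d ∧ κ * hgt x y m' a' d ≤ 0) :
    ∃ b μ, Tangent N x y col ty κ (ty b) b μ ∧ (ty b = 0 ∨ ty b = 1) ∧
      ∀ d < N, col d ≠ 1 → ht x y b μ d * hgt x y m' a' d < 0 →
        hgt x y m a d * hgt x y m' a' d < 0 := by
  set p := hgt x y m a with hp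
  set q := hgt x y m' a' with hq
  obtain ⟨b₀, hb₀, hbc₀⟩ := hex
  obtain ⟨b, hbmem, hmin⟩ := Finset.exists_min_image ((Finset.range N).filter fun d => col d = 1)
    (fun d => p d / (p d - q d)) ⟨b₀, by simp [hb₀, hbc₀]⟩
  obtain ⟨hbN, hbc⟩ : b < N ∧ col b = 1 := by simpa using hbmem
  have hcase : ∀ d < N, col d = 1 → (ty d = 0 ∨ ty d = 1) := by
    intro d hd hc
    have := hty d hd
    have := hb d hd hc
    omega
  have hside : ∀ d < N, col d = 1 → (0 ≤ p d ∧ q d ≤ 0) ∨ (p d ≤ 0 ∧ 0 ≤ q d) := by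
    intro d hd hc
    rcases hcase d hd hc with h | h
    · have := h₀ d hd hc h
      rcases hκ with rfl | rfl
      · right; constructor <;> linarith
      · left; constructor <;> linarith
    · have := h₁ d hd hc h
      rcases hκ with rfl | rfl
      · left; constructor <;> linarith
      · right; constructor <;> linarith
  set t := p b / (p b - q b) with ht
  have hquot : ∀ d < N, col d = 1 → 0 ≤ p d / (p d - q d) ∧ p d / (p d - q d) ≤ 1 ∧
      p d / (p d - q d) * (p d - q d) = p d := by
    intro d hd hc
    by_cases h0 : p d - q d = 0
    · have : p d = 0 := by rcases hside d hd hc with h | h <;> linarith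
      simp [this]
    refine ⟨?_, ?_, div_mul_cancel₀ _ h0⟩
    · rcases hside d hd hc with h | h
      · exact div_nonneg h.1 (by linarith)
      · exact div_nonneg_of_nonpos h.1 (by linarith)
    · rcases hside d hd hc with h | h
      · exact div_le_one_of_le₀ (by linarith) (by linarith)
      · rw [← neg_div_neg_eq]
        exact div_le_one_of_le₀ (by linarith) (by linarith)
  obtain ⟨ht0, ht1, htb⟩ := hquot b hbN hbc
  rw [← ht] at ht0 ht1 htb
  -- the line that divides the strip between the two lines in the ratio `t`
  have hmix : ∀ d, Bowtie.ht x y b ((1 - t) * m + t * m') d = p d - t * (p d - q d) := by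
    intro d
    have : Bowtie.ht x y b ((1 - t) * m + t * m') d =
        (p d - t * (p d - q d)) - (p b - t * (p b - q b)) := by
      rw [hp, hq]; unfold Bowtie.ht hgt; ring
    rw [this, htb, sub_self, sub_zero]
  have hkeep : ∀ d < N, col d = 1 → (ty d = 0 → κ * Bowtie.ht x y b ((1 - t) * m + t * m') d ≤ 0) ∧
      (ty d = 1 → 0 ≤ κ * Bowtie.ht x y b ((1 - t) * m + t * m') d) := by
    intro d hd hc
    obtain ⟨k0, k1, k2⟩ := hquot d hd hc
    have k3 : t ≤ p d / (p d - q d) := hmin d (by simp [hd, hc])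
    have k4 : p d - t * (p d - q d) = (p d / (p d - q d) - t) * (p d - q d) := by
      rw [sub_mul, k2]
    rw [hmix, k4]
    have k5 := sub_nonneg.2 k3
    constructor
    · intro h
      have := h₀ d hd hc h
      rcases hκ with rfl | rfl
      · have := mul_nonneg k5 (show 0 ≤ -(p d - q d) by linarith)
        linarith
      · have := mul_nonneg k5 (show 0 ≤ p d - q d by linarith)
        linarith
    · intro h
      have := h₁ d hd hc h
      rcases hκ with rfl | rfl
      · have := mul_nonneg k5 (show 0 ≤ p d - q d by linarith)
        linarith
      · have := mul_nonneg k5 (show 0 ≤ -(p d - q d) by linarith)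
        linarith
  obtain ⟨μ, hμ, hsep⟩ := exists_rotate gp hty hb hκ q hbN hbc (fun d hd hc => (hkeep d hd hc).1)
    (fun d hd hc => (hkeep d hd hc).2)
  refine ⟨b, μ, hμ, hcase b hbN hbc, fun d hd hc hlt => ?_⟩
  have h3 := hsep d hd hc hlt
  rw [hmix] at h3
  have h4 : (1 - t) * (p d * q d) < 0 := by nlinarith [mul_nonneg ht0 (mul_self_nonneg (q d))]
  exact (pos_iff_neg_of_mul_neg h4).1 (lt_of_le_of_ne (by linarith) (by
    rintro h5; rw [← h5] at h4; simp at h4))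

/-- Every pair of lines that respects the sides given by a split can be replaced by a pair of
tangents. -/
theorem exists_tangents (gp : GenPos N x y) (hty : ∀ d < N, ty d ≤ 2)
    (hb : ∀ d < N, col d = 1 → ty d ≠ 2) (hex : ∃ b < N, col b = 1) {m a m' a' : ℝ}
    (h₀ : ∀ d < N, col d = 1 → ty d = 0 → hgt x y m a d ≤ 0 ∧ 0 ≤ hgt x y m' a' d)
    (h₁ : ∀ d < N, col d = 1 → ty d = 1 → 0 ≤ hgt x y m a d ∧ hgt x y m' a' d ≤ 0) :
    ∃ e₁ b₁ m₁ e₂ b₂ m₂, (e₁ = 0 ∨ e₁ = 1) ∧ (e₂ = 0 ∨ e₂ = 1) ∧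
      Tangent N x y col ty 1 e₁ b₁ m₁ ∧ Tangent N x y col ty (-1) e₂ b₂ m₂ ∧
      (unsep N col (hgt x y m a) (hgt x y m' a')).card ≤
        (unsep N col (ht x y b₁ m₁) (ht x y b₂ m₂)).card := by
  obtain ⟨b₁, m₁, hT₁, he₁, hs₁⟩ := exists_tangent gp hty hb hex (κ := 1) (Or.inl rfl)
    (m := m) (a := a) (m' := m') (a' := a') (by simpa using h₀) (by simpa using h₁)
  have hside := fun {d} => hT₁.blue_side (Or.inl rfl) he₁ (d := d)
  rw [ht_eq_hgt] at hside hs₁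
  obtain ⟨b₂, m₂, hT₂, he₂, hs₂⟩ := exists_tangent gp hty hb hex (κ := -1) (Or.inr rfl)
    (m := m') (a := a') (m' := m₁) (a' := y b₁ - m₁ * x b₁)
    (fun d hd hc ht => ⟨by linarith [(h₀ d hd hc ht).2], by linarith [(hside hd hc).1 ht]⟩)
    (fun d hd hc ht => ⟨by linarith [(h₁ d hd hc ht).2], by linarith [(hside hd hc).2 ht]⟩)
  refine ⟨_, b₁, m₁, _, b₂, m₂, he₁, he₂, hT₁, hT₂, Finset.card_le_card ?_⟩
  intro d hd
  simp only [unsep, Finset.mem_filter, Finset.mem_range] at hd ⊢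
  refine ⟨hd.1, hd.2.1, not_lt.1 fun hlt => hd.2.2.not_gt ?_⟩
  rw [ht_eq_hgt b₁, mul_comm] at hlt
  have := hs₂ d hd.1 hd.2.1 hlt
  rw [mul_comm] at this
  exact hs₁ d hd.1 hd.2.1 this

end

/-! ### The splits of the blue points -/

/-- `bp` lists the blue points among `0, …, N - 1` in increasing order, and there are `n` of them. -/
structure BlueList (n N : ℕ) (col bp : ℕ → ℕ) : Prop where
  lt : ∀ k < n, bp k < N
  mono : ∀ k < n, ∀ l < n, k < l → bp k < bp l
  surj : ∀ d < N, col d = 1 → ∃ k < n, bp k = d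
  col : ∀ k < n, col (bp k) = 1

/-- The types of the points for the split before the blue point with number `i`. For `i = 0`, all
blue points lie in the east wedge, and the gap consists of the points to the left and to the right of
all of them. -/
def splitTy (n : ℕ) (bp : ℕ → ℕ) (i d : ℕ) : ℕ :=
  if (if i = 0 then d < bp 0 ∨ bp (n - 1) < d else bp (i - 1) < d ∧ d < bp i) then 2
  else if i ≠ 0 ∧ d ≤ bp (i - 1) then 0 else 1

section

variable {n N : ℕ} {x y : ℕ → ℝ} {col bp : ℕ → ℕ}

theorem BlueList.le (h : BlueList n N col bp) {k l : ℕ} (hk : k ≤ l) (hl : l < n) : bp k ≤ bp l := by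
  rcases hk.eq_or_lt with rfl | hlt
  · exact le_rfl
  · exact (h.mono k (by omega) l hl hlt).le

theorem splitTy_zero (d : ℕ) :
    splitTy n bp 0 d = if d < bp 0 ∨ bp (n - 1) < d then 2 else 1 := by
  simp [splitTy]

theorem splitTy_pos {i : ℕ} (hi : i ≠ 0) (d : ℕ) : splitTy n bp i d =
    if bp (i - 1) < d ∧ d < bp i then 2 else if d ≤ bp (i - 1) then 0 else 1 := by
  simp [splitTy, hi]

theorem BlueList.split (h : BlueList n N col bp) {i : ℕ} (hi : i < n) :
    Split N col (splitTy n bp i) := by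
  by_cases hi0 : i = 0
  · subst hi0
    have hty := fun d => splitTy_zero (n := n) (bp := bp) d
    have h2 : ∀ d, splitTy n bp 0 d = 2 ↔ d < bp 0 ∨ bp (n - 1) < d := by
      intro d; rw [hty]; split_ifs <;> simp [*]
    have h1 : ∀ d, splitTy n bp 0 d = 1 ↔ bp 0 ≤ d ∧ d ≤ bp (n - 1) := by
      intro d; rw [hty]; split_ifs <;> simp <;> omega
    have h0 : ∀ d, splitTy n bp 0 d ≠ 0 := by
      intro d; rw [hty]; split_ifs <;> simp
    have hle : bp 0 ≤ bp (n - 1) := h.le (by omega) (by omega)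
    refine ⟨?_, ?_, ?_, ?_, ?_, ?_, ?_⟩
    · intro d hd hc
      obtain ⟨k, hk, rfl⟩ := h.surj d hd hc
      rw [Ne, h2]
      have := h.le (Nat.zero_le k) hk
      have := h.le (show k ≤ n - 1 by omega) (by omega)
      omega
    · intro d _ b _ h3; exact absurd h3 (h0 d)
    · intro d _; rw [hty]; split_ifs <;> simp
    · intro d _ h3
      rw [h2] at h3
      simp only [h1]
      rcases h3 with h3 | h3
      · left; intros; omega
      · right; intros; omega
    · intro d _ _ w _ h3; exact absurd h3 (h0 w)
    · intro d _ h3; exact absurd h3 (h0 d)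
    · intro d _ h3
      rw [h1] at h3
      refine ⟨bp 0, h.lt 0 hi, bp (n - 1), h.lt _ (by omega), h.col 0 hi, h.col _ (by omega), ?_, ?_⟩
      · rw [h1]; omega
      · left; rw [h1]; omega
  · have hty := fun d => splitTy_pos (n := n) (bp := bp) hi0 d
    have hlt : bp (i - 1) < bp i := h.mono _ (by omega) _ hi (by omega)
    have h2 : ∀ d, splitTy n bp i d = 2 ↔ bp (i - 1) < d ∧ d < bp i := by
      intro d; rw [hty]; split_ifs <;> simp [*]
    have h1 : ∀ d, splitTy n bp i d = 1 ↔ bp i ≤ d := by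
      intro d; rw [hty]; split_ifs <;> simp <;> omega
    have h0 : ∀ d, splitTy n bp i d = 0 ↔ d ≤ bp (i - 1) := by
      intro d; rw [hty]; split_ifs <;> simp <;> omega
    refine ⟨?_, ?_, ?_, ?_, ?_, ?_, ?_⟩
    · intro d hd hc
      obtain ⟨k, hk, rfl⟩ := h.surj d hd hc
      rw [Ne, h2]
      rcases Nat.lt_or_ge k i with h3 | h3
      · have := h.le (show k ≤ i - 1 by omega) (by omega)
        omega
      · have := h.le h3 hk
        omega
    · intro d _ b _; rw [h0, h1]; omega
    · intro d _; rw [hty]; split_ifs <;> simp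
    · intro d _ h3
      rw [h2] at h3
      simp only [h1]
      left; intros; omega
    · intro d _ h3 w _ h4
      rw [h2] at h3
      rw [h0] at h4
      simp only [h1]
      exact ⟨by omega, fun b _ hb => by omega⟩
    · intro d _ h3
      rw [h0] at h3
      refine ⟨bp (i - 1), h.lt _ (by omega), bp i, h.lt _ hi, h.col _ (by omega), h.col _ hi, ?_, ?_, h3⟩
      · rw [h0]
      · rw [h1]
    · intro d _ h3
      rw [h1] at h3
      refine ⟨bp i, h.lt _ hi, bp (i - 1), h.lt _ (by omega), h.col _ hi, h.col _ (by omega), ?_,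
        Or.inr ⟨h3, ?_⟩⟩
      · rw [h1]
      · rw [h0]

theorem unsep_comm (h₁ h₂ : ℕ → ℝ) : unsep N col h₁ h₂ = unsep N col h₂ h₁ := by
  unfold unsep
  simp only [mul_comm]

/-- The lines of every feasible double wedge can be replaced by tangents of some split. -/
theorem BlueList.exists_tangents (h : BlueList n N col bp) (hn : 0 < n) (gp : GenPos N x y)
    (hm : ∀ i < N, ∀ j < N, (x i < x j ↔ i < j)) {m a m' a' : ℝ} (hlt : m < m')
    (hf : ∀ d < N, col d = 1 → hgt x y m a d * hgt x y m' a' d ≤ 0) :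
    ∃ i < n, ∃ e₁ b₁ m₁ e₂ b₂ m₂, (e₁ = 0 ∨ e₁ = 1) ∧ (e₂ = 0 ∨ e₂ = 1) ∧
      Tangent N x y col (splitTy n bp i) 1 e₁ b₁ m₁ ∧
      Tangent N x y col (splitTy n bp i) (-1) e₂ b₂ m₂ ∧
      (unsep N col (hgt x y m a) (hgt x y m' a')).card ≤
        (unsep N col (ht x y b₁ m₁) (ht x y b₂ m₂)).card := by
  have hex : ∃ b < N, col b = 1 := ⟨bp 0, h.lt 0 hn, h.col 0 hn⟩
  -- the difference of the heights increases from left to right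
  have hdiff : ∀ d < N, ∀ d' < N, d < d' →
      hgt x y m a d - hgt x y m' a' d < hgt x y m a d' - hgt x y m' a' d' := by
    intro d hd d' hd' hlt'
    have h1 := (hm d hd d' hd').2 hlt'
    have h2 := mul_pos (sub_pos.2 hlt) (sub_pos.2 h1)
    unfold hgt
    nlinarith
  have hE : ∀ d < N, col d = 1 → 0 ≤ hgt x y m a d - hgt x y m' a' d →
      0 ≤ hgt x y m a d ∧ hgt x y m' a' d ≤ 0 := by
    intro d hd hc h1
    have h2 := hf d hd hc
    constructor <;> nlinarith
  have hW : ∀ d < N, col d = 1 → hgt x y m a d - hgt x y m' a' d ≤ 0 →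
      hgt x y m a d ≤ 0 ∧ 0 ≤ hgt x y m' a' d := by
    intro d hd hc h1
    have h2 := hf d hd hc
    constructor <;> nlinarith
  by_cases hall : ∃ k, k < n ∧ 0 ≤ hgt x y m a (bp k) - hgt x y m' a' (bp k)
  · classical
    -- the leftmost blue point of the east wedge has the number `i`
    obtain ⟨hi, hi1⟩ := Nat.find_spec hall
    have hi2 := fun {k} => Nat.find_min hall (m := k)
    set i := Nat.find hall
    have hs := h.split hi
    refine ⟨i, hi, Bowtie.exists_tangents gp hs.le_two hs.blue hex ?_ ?_⟩
    · intro d hd hc ht0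
      refine hW d hd hc ?_
      obtain ⟨k, hk, rfl⟩ := h.surj d hd hc
      by_contra hcon
      have hik : i ≤ k := not_lt.1 fun hlt => hi2 hlt ⟨hk, (not_le.1 hcon).le⟩
      have := h.le hik hk
      by_cases hi0 : i = 0
      · rw [hi0, splitTy_zero] at ht0
        split_ifs at ht0
      · have := h.mono (i - 1) (by omega) i hi (by omega)
        rw [splitTy_pos hi0] at ht0
        split_ifs at ht0
        omega
    · intro d hd hc ht1
      refine hE d hd hc ?_
      obtain ⟨k, hk, rfl⟩ := h.surj d hd hc
      have hik : i ≤ k := by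
        by_contra hcon
        have := h.le (show k ≤ i - 1 by omega) (by omega)
        rw [splitTy_pos (by omega)] at ht1
        split_ifs at ht1
        omega
      rcases hik.eq_or_lt with heq | hlt'
      · rw [← heq]; exact hi1
      · have := hdiff _ (h.lt i hi) _ (h.lt k hk) (h.mono _ hi _ hk hlt')
        linarith
  · push Not at hall
    have hs := h.split hn
    -- all blue points lie in the west wedge, which the exchange of the lines turns into the east wedge
    rw [unsep_comm]
    refine ⟨0, hn, Bowtie.exists_tangents gp hs.le_two hs.blue hex ?_ ?_⟩
    · intro d hd hc ht0
      rw [splitTy_zero] at ht0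
      split_ifs at ht0
    · intro d hd hc _
      obtain ⟨k, hk, rfl⟩ := h.surj d hd hc
      exact (hW _ hd hc (hall k hk).le).symm

end

end Bowtie

namespace Bowtie

open RealRAM

/-! ### The program: one split

The chains `0` and `1` belong to the line with the east wedge above it, which touches the east wedge and
the west wedge, respectively. The chains `2` and `3` belong to the other line in the same way. -/

/-- Computation of the type of the point `vu`; `vm` counts the points in the gap. -/
def typeBody : Prog :=
  .ite (.or (.and (.natEq (.var vi) (.const 0)) (.or (.natLt (.var vu) (.get aBlue (.const 0)))
        (.natLt (.get aBlue (.sub (.var vn) (.const 1))) (.var vu))))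
      (.and (.not (.natEq (.var vi) (.const 0)))
        (.and (.natLt (.get aBlue (.sub (.var vi) (.const 1))) (.var vu))
          (.natLt (.var vu) (.get aBlue (.var vi))))))
    (.seq (.putNat aTy (.var vu) (.const 2)) (.setNat vm (.add (.var vm) (.const 1))))
    (.ite (.and (.not (.natEq (.var vi) (.const 0)))
        (.not (.natLt (.get aBlue (.sub (.var vi) (.const 1))) (.var vu))))
      (.putNat aTy (.var vu) (.const 0)) (.putNat aTy (.var vu) (.const 1)))

/-- The types of the points for the split before the blue point with number `vi`. -/
def typeProg : Prog :=
  .seq (.seq (.setNat vm (.const 0)) (.setNat vu (.const 0))) (Prog.upto vu (.var vN) typeBody)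

/-- The sweep of a chain, from the blue point of the split on the side of the gap. -/
def branchProg (χ nxArr : ℕ) (rev : Bool) : Prog :=
  .seq (.setNat vb (.get aBlue (bif rev then .sub (.var vi) (.const 1) else .var vi)))
    (chainProg χ nxArr rev)

/-- Evaluation of the pairs of tangents that both touch the east wedge. -/
def eastProg : Prog :=
  .seq typeProg (.seq (branchProg 0 aNx false) (.seq (branchProg 2 aPv false)
    (comboProg 0 2 true)))

/-- Evaluation of the other pairs of tangents. -/
def westProg : Prog :=
  .seq (branchProg 1 aNx true) (.seq (branchProg 3 aPv true) (.seq (comboProg 1 3 true)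
    (.seq (comboProg 0 3 false) (comboProg 1 2 false))))

/-- Evaluation of all splits. For the split `0`, the west wedge is empty. -/
def splitsProg : Prog :=
  .seq (.setNat vi (.const 0)) (.seq eastProg (.seq (.setNat vi (.const 1))
    (Prog.upto vi (.var vn) (.seq eastProg westProg))))

attribute [local simp] NExpr.eval RExpr.eval BExpr.Holds State.setNat State.setReal State.putNat
  State.putReal Prog.run Function.update_apply cellAt slopeExpr

/-- The memory during the evaluation of the splits; `A` and `A'` are the arrays of the lists, and `bp`
that of the blue points. -/
structure Env (n N : ℕ) (x y : ℕ → ℝ) (col A A' bp : ℕ → ℕ) (s : State) : Prop where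
  base : Base n N x y col s
  nx_eq : s.natArr aNx = A
  pv_eq : s.natArr aPv = A'
  bp_eq : s.natArr aBlue = bp

/-- The memory during the evaluation of the split `i`. -/
structure SplitEnv (n N : ℕ) (x y : ℕ → ℝ) (col A A' bp : ℕ → ℕ) (i : ℕ) (s : State) : Prop where
  env : Env n N x y col A A' bp s
  i_eq : s.nat vi = i
  ty_eq : ∀ d < N, s.natArr aTy d = splitTy n bp i d
  m_eq : s.nat vm = ((Finset.range N).filter fun d => splitTy n bp i d = 2).card

section

variable {n N : ℕ} {x y : ℕ → ℝ} {col A A' bp : ℕ → ℕ} {i : ℕ} {s s' : State} {p : Prog}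

theorem Env.frame (h : Env n N x y col A A' bp s) (hf : Frame p s s')
    (hv : ∀ v ∈ [vn, vN], v ∉ p.natVars) (ha : ∀ a ∈ [aCol, aOff, aNx, aPv, aBlue], a ∉ p.natArrs)
    (hr : p.realArrs = []) : Env n N x y col A A' bp s' := by
  have hr' : ∀ a, a ∉ p.realArrs := by simp [hr]
  exact ⟨h.base.frame (hf.nat _ (hv _ (by simp))) (hf.nat _ (hv _ (by simp))) (hf.realArr _ (hr' _))
    (hf.realArr _ (hr' _)) (hf.arr _ (ha _ (by simp))) (hf.arr _ (ha _ (by simp))),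
    (hf.arr _ (ha _ (by simp))).trans h.nx_eq, (hf.arr _ (ha _ (by simp))).trans h.pv_eq,
    (hf.arr _ (ha _ (by simp))).trans h.bp_eq⟩

theorem SplitEnv.frame (h : SplitEnv n N x y col A A' bp i s) (hf : Frame p s s')
    (hv : ∀ v ∈ [vn, vN, vi, vm], v ∉ p.natVars)
    (ha : ∀ a ∈ [aCol, aOff, aNx, aPv, aBlue, aTy], a ∉ p.natArrs)
    (hr : p.realArrs = []) : SplitEnv n N x y col A A' bp i s' := by
  refine ⟨h.env.frame hf (fun v hv' => hv v ?_) (fun a ha' => ha a ?_) hr,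
    (hf.nat _ (hv _ (by simp))).trans h.i_eq, fun d hd => ?_, (hf.nat _ (hv _ (by simp))).trans h.m_eq⟩
  · simp only [List.mem_cons, List.not_mem_nil, or_false] at hv' ⊢; tauto
  · simp only [List.mem_cons, List.not_mem_nil, or_false] at ha' ⊢; tauto
  · rw [hf.arr aTy (ha _ (by simp))]; exact h.ty_eq d hd

theorem ChainRes.frame {X Y : ℕ → ℝ} {ty : ℕ → ℕ} {e χ T : ℕ} (h : ChainRes N X Y col ty e χ T s)
    (hf : Frame p s s') (hv : vT(χ) ∉ p.natVars)
    (ha : ∀ a ∈ [aSt(χ), aEv(χ), aBg(χ), aBb(χ), aBq(χ)], a ∉ p.natArrs) :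
    ChainRes N X Y col ty e χ T s' := by
  unfold ChainRes
  rw [hf.nat _ hv, hf.arr _ (ha aSt(χ) (by simp)), hf.arr _ (ha aEv(χ) (by simp)),
    hf.arr _ (ha aBg(χ) (by simp)), hf.arr _ (ha aBb(χ) (by simp)), hf.arr _ (ha aBq(χ) (by simp))]
  exact h

theorem runs_typeProg : ∃ K, ∀ (n N : ℕ) (x y : ℕ → ℝ) (col A A' bp : ℕ → ℕ) (i : ℕ) (s : State),
    Env n N x y col A A' bp s → s.nat vi = i →
    Runs typeProg s (K * (N + 1)) (SplitEnv n N x y col A A' bp i) := by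
  refine ⟨4 + (typeBody.time + 8), fun n N x y col A A' bp i s hE hi => ?_⟩
  refine (Runs.seq (P := fun s => s.nat vu = 0 ∧ (Env n N x y col A A' bp s ∧ s.nat vi = i ∧
      (∀ d < 0, s.natArr aTy d = splitTy n bp i d) ∧
      s.nat vm = ((Finset.range 0).filter fun d => splitTy n bp i d = 2).card))
    (Runs.of_loopFree rfl ⟨by simp, hE.frame (.of_loopFree rfl s) (by decide) (by decide) rfl,
      by simpa using hi, by simp, by simp⟩)
    fun s hs => Runs.upto (T := typeBody.time) (K := N) (I := fun k s => Env n N x y col A A' bp s ∧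
      s.nat vi = i ∧ (∀ d < k, s.natArr aTy d = splitTy n bp i d) ∧
      s.nat vm = ((Finset.range k).filter fun d => splitTy n bp i d = 2).card) ?_ ?_ hs.1 hs.2).mono ?_ ?_
  · intro k s _ hI _
    exact hI.1.base.N_eq
  · rintro k s hk ⟨h1, h2, h3, h4⟩ hv
    have hbp := h1.bp_eq
    have hn := h1.base.n_eq
    have hrun : typeBody.run s =
        if splitTy n bp i k = 2 then (s.putNat aTy k 2).setNat vm (s.nat vm + 1)
          else s.putNat aTy k (splitTy n bp i k) := by
      unfold splitTy typeBody
      by_cases hi0 : i = 0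
      · subst hi0
        simp only [Prog.run, NExpr.eval, BExpr.Holds, hv, h2, hbp, hn]
        split_ifs <;> first | rfl | omega | tauto
      · simp only [Prog.run, NExpr.eval, BExpr.Holds, hv, h2, hbp, hn]
        split_ifs <;> first | rfl | omega | tauto
    refine Runs.of_loopFree rfl ⟨?_, (h1.frame (.of_loopFree (p := typeBody) rfl s) (by decide)
      (by decide) rfl).frame (.of_loopFree (p := .setNat vu (.const (k + 1))) rfl _)
      (by simp [Prog.natVars]) (by simp [Prog.natArrs]) rfl, ?_⟩
    · rw [← hv]
      exact (Frame.of_loopFree (p := typeBody) rfl s).nat vu (by decide)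
    · rw [hrun]
      refine ⟨?_, fun d hd => ?_, ?_⟩
      · split_ifs <;> simpa using h2
      · by_cases hdk : d = k
        · subst hdk
          split_ifs with hc <;> simp [hc]
        · have := h3 d (by omega)
          split_ifs <;> simpa [hdk] using this
      · rw [Finset.range_add_one, Finset.filter_insert]
        split_ifs <;> simp [h4]
  · have : (N + 1) * (typeBody.time + ((NExpr.var vN).cost + 7)) = (typeBody.time + 8) * (N + 1) := by
      simp [NExpr.cost, mul_comm]
    rw [this]
    simp only [Prog.time, NExpr.cost]
    nlinarith [Nat.zero_le N]
  · rintro s ⟨-, h1, h2, h3, h4⟩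
    exact ⟨h1, h2, h3, h4⟩

theorem Tangent.congr {ty ty' : ℕ → ℕ} {κ : ℝ} {e b : ℕ} {m : ℝ} (h : Tangent N x y col ty κ e b m)
    (heq : ∀ d < N, ty' d = ty d) : Tangent N x y col ty' κ e b m := by
  obtain ⟨h1, h2, h3, h4, h5, h6⟩ := h
  exact ⟨h1, h2, (heq b h1).trans h3, h4, fun d hd hc ht => h5 d hd hc ((heq d hd).symm.trans ht),
    fun d hd hc ht => h6 d hd hc (by rwa [← heq d hd])⟩

theorem Split.congr {ty ty' : ℕ → ℕ} (h : Split N col ty) (heq : ∀ d < N, ty' d = ty d) :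
    Split N col ty' := by
  obtain ⟨h1, h2, h3, h4, h5, h6, h7⟩ := h
  refine ⟨?_, ?_, ?_, ?_, ?_, ?_, ?_⟩
  · intro d hd hc; rw [heq d hd]; exact h1 d hd hc
  · intro d hd b hb; rw [heq d hd, heq b hb]; exact h2 d hd b hb
  · intro d hd; rw [heq d hd]; exact h3 d hd
  · intro d hd hd2
    rw [heq d hd] at hd2
    refine (h4 d hd hd2).imp (fun h b hb hb1 => h b hb ?_) (fun h b hb hb1 => h b hb ?_) <;>
      rwa [← heq b hb]
  · intro d hd hd2 w hw hw0
    rw [heq d hd] at hd2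
    rw [heq w hw] at hw0
    exact ⟨(h5 d hd hd2 w hw hw0).1, fun b hb hb1 => (h5 d hd hd2 w hw hw0).2 b hb (by rwa [← heq b hb])⟩
  · intro d hd hd0
    rw [heq d hd] at hd0
    obtain ⟨a, ha, b, hb, h8, h9, h10, h11, h12⟩ := h6 d hd hd0
    exact ⟨a, ha, b, hb, h8, h9, (heq a ha).trans h10, (heq b hb).trans h11, h12⟩
  · intro d hd hd0
    rw [heq d hd] at hd0
    obtain ⟨a, ha, b, hb, h8, h9, h10, h11⟩ := h7 d hd hd0
    refine ⟨a, ha, b, hb, h8, h9, (heq a ha).trans h10, ?_⟩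
    rw [heq b hb]
    exact h11

/-- The list structure that an array encodes. -/
def rowOf (N : ℕ) (A : ℕ → ℕ) (c d : ℕ) : ℕ := A (c * (N + 1) + d)

/-- All that is known of the points and of the lists. -/
structure Points (n N : ℕ) (x y : ℕ → ℝ) (col A A' bp : ℕ → ℕ) : Prop where
  gp : GenPos N x y
  mono : ∀ i < N, ∀ j < N, (x i < x j ↔ i < j)
  lists : ListsUpTo N N x y (rowOf N A) (rowOf N A')
  blue : BlueList n N col bp

theorem Points.linked (h : Points n N x y col A A' bp) :
    (∀ c < N, Linked N (fun d => 1 * slopeAt x y c d) {d | d < N ∧ d ≠ c} (rowOf N A c)) ∧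
    ∀ c < N, Linked N (fun d => -1 * slopeAt x y c d) {d | d < N ∧ d ≠ c} (rowOf N A' c) := by
  simp only [one_mul, neg_mul]
  exact ⟨fun c hc => (h.lists c hc).1, fun c hc => (h.lists c hc).2⟩

theorem runs_branchProg (χ nxArr : ℕ) (rev : Bool) (hχ : nxArr < 10) : ∃ K,
    ∀ (n N : ℕ) (x y : ℕ → ℝ) (col A A' bp : ℕ → ℕ) (κ : ℝ) (i e : ℕ) (s : State),
    Points n N x y col A A' bp → SplitEnv n N x y col A A' bp i s → i < n → (κ = 1 ∨ κ = -1) →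
    (∀ c < N, Linked N (fun d => κ * slopeAt x y c d) {d | d < N ∧ d ≠ c}
      (rowOf N (s.natArr nxArr) c)) →
    e = (bif rev then 0 else 1) → (e = 0 → i ≠ 0) →
    Runs (branchProg χ nxArr rev) s (K * (N + 1)) fun s' =>
      ∃ T, ChainRes N (chX e x) (chY κ e y) col (s.natArr aTy) e χ T s' := by
  obtain ⟨K, hK⟩ := runs_chainProg χ nxArr rev hχ
  refine ⟨10 + K, fun n N x y col A A' bp κ i e s hP hE hi hκ hlink he hei => ?_⟩
  have hs := (hP.blue.split hi).congr hE.ty_eq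
  have he' : e = 0 ∨ e = 1 := by cases rev <;> simp at he <;> omega
  obtain ⟨ty, hty⟩ : ∃ ty, ty = s.natArr aTy := ⟨_, rfl⟩
  have hc := hs.chainHyp hP.gp hP.mono hκ he' hlink
  have hrun : (Prog.setNat vb (.get aBlue (bif rev then .sub (.var vi) (.const 1) else .var vi))).run s =
      s.setNat vb (bp (i - (1 - e))) := by
    cases rev <;> simp at he <;> simp [hE.env.bp_eq, hE.i_eq, he]
  refine (Runs.seq (P := fun s' => s' = s.setNat vb (bp (i - (1 - e)))) (Runs.of_loopFree rfl hrun)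
    fun s' hs' => (hK n N x y (chX e x) (chY κ e y) col (s.natArr aTy) e s' ?_ ?_ ?_ ?_ ?_ ?_ ?_ ?_).mono
      le_rfl fun s'' h => h.2).mono ?_ fun _ h => h
  · subst hs'
    exact hE.env.base.frame (by simp) (by simp) (by simp) (by simp) (by simp) (by simp)
  · subst hs'; simp
  · subst hs'; exact hc
  · intro c hcN b hb
    cases rev <;> simp at he <;> subst he
    · simpa [chX, sg] using hP.mono c hcN b hb
    · simpa [chX, sg] using hP.mono b hb c hcN
  · subst hs'
    simpa using hP.blue.lt _ (by omega)
  · subst hs'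
    simpa using hP.blue.col _ (by omega)
  · subst hs'
    simp only [State.setNat, Function.update_self]
    rw [hE.ty_eq _ (hP.blue.lt _ (by omega))]
    by_cases hi0 : i = 0
    · have he1 : e = 1 := by omega
      subst hi0 he1
      have := hP.blue.le (Nat.zero_le (n - 1)) (by omega)
      rw [splitTy_zero]
      simp [this]
    · have := hP.blue.mono (i - 1) (by omega) i hi (by omega)
      rw [splitTy_pos hi0]
      rcases he' with rfl | rfl
      · simp
      · simp [this]
  · intro d hd
    subst hs'
    simp only [State.setNat, Function.update_self]
    rw [hE.ty_eq d hd]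
    intro hde hne
    have hb := hP.blue.lt (i - (1 - e)) (by omega)
    rcases he' with rfl | rfl
    · have hi0 := hei rfl
      rw [splitTy_pos hi0] at hde
      have := (hP.mono d hd _ hb).2 (by
        simp only [Nat.sub_zero] at hne ⊢
        split_ifs at hde
        all_goals omega)
      simpa [chX, sg] using this
    · have := (hP.mono _ hb d hd).2 (by
        simp only [Nat.sub_self, Nat.sub_zero] at hne ⊢
        by_cases hi0 : i = 0
        · subst hi0
          rw [splitTy_zero] at hde
          split_ifs at hde
          all_goals omega
        · rw [splitTy_pos hi0] at hde
          split_ifs at hde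
          all_goals omega)
      simpa [chX, sg] using this
  · have : (Prog.setNat vb (.get aBlue (bif rev then .sub (.var vi) (.const 1) else .var vi))).time ≤ 10 := by
      cases rev <;> decide
    nlinarith

end

end Bowtie

namespace Bowtie

open RealRAM

/-! ### The program: all splits -/

/-- The pair of edges `(b₁, q₁)` and `(b₂, q₂)` has the value `v`: all pairs of lines on the two edges
have the blue points in their double wedge, and leave exactly `v` red points outside. -/
structure Sound (N : ℕ) (x y : ℕ → ℝ) (col A A' : ℕ → ℕ) (b₁ q₁ b₂ q₂ v : ℕ) : Prop where
  fst : b₁ < N ∧ (q₁ = N ∨ (q₁ < N ∧ q₁ ≠ b₁))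
  snd : b₂ < N ∧ (q₂ = N ∨ (q₂ < N ∧ q₂ ≠ b₂))
  lines : ∀ m₁ m₂, OnEdge N x y 1 (rowOf N A) b₁ q₁ m₁ → OnEdge N x y (-1) (rowOf N A') b₂ q₂ m₂ →
    (∀ d < N, col d = 1 → ht x y b₁ m₁ d * ht x y b₂ m₂ d ≤ 0) ∧
    (unsep N col (ht x y b₁ m₁) (ht x y b₂ m₂)).card = v

/-- All pairs of tangents of the split `i` with contact points of the types `e₁` and `e₂` leave at most
`v` red points outside. -/
def Bounded (n N : ℕ) (x y : ℕ → ℝ) (col bp : ℕ → ℕ) (i e₁ e₂ v : ℕ) : Prop :=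
  ∀ b₁ m₁ b₂ m₂, Tangent N x y col (splitTy n bp i) 1 e₁ b₁ m₁ →
    Tangent N x y col (splitTy n bp i) (-1) e₂ b₂ m₂ →
    (unsep N col (ht x y b₁ m₁) (ht x y b₂ m₂)).card ≤ v

section

variable {n N : ℕ} {x y : ℕ → ℝ} {col A A' bp : ℕ → ℕ} {i : ℕ} {s s' : State} {p : Prog}

/-- The combination of two chains of a split keeps a sound pair of edges, and its value bounds all pairs of
tangents from these chains. -/
theorem runs_combo (χ₁ χ₂ : ℕ) (hχ₁ : χ₁ < 4) (hχ₂ : χ₂ < 4) (same : Bool) : ∃ K,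
    ∀ (n N : ℕ) (x y : ℕ → ℝ) (col A A' bp ty : ℕ → ℕ) (i e₁ e₂ T₁ T₂ m : ℕ) (s : State),
    Points n N x y col A A' bp → SplitEnv n N x y col A A' bp i s → i < n →
    ((Finset.range N).filter fun d => splitTy n bp i d = 2).card = m →
    (e₁ = 0 ∨ e₁ = 1) → (e₂ = 0 ∨ e₂ = 1) → same = decide (e₁ = e₂) →
    (∀ d < N, ty d = splitTy n bp i d) →
    ChainRes N (chX e₁ x) (chY 1 e₁ y) col ty e₁ χ₁ T₁ s →
    ChainRes N (chX e₂ x) (chY (-1) e₂ y) col ty e₂ χ₂ T₂ s →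
    (Held (Sound N x y col A A') s ∨ s.nat vbest = 0) →
    Runs (comboProg χ₁ χ₂ same) s (K * (m + 1) ^ 2) fun s' =>
      Held (Sound N x y col A A') s' ∧ s.nat vbest ≤ s'.nat vbest ∧
      Bounded n N x y col bp i e₁ e₂ (s'.nat vbest) := by
  obtain ⟨K, hK⟩ := runs_comboProg χ₁ χ₂ hχ₁ hχ₂ same
  refine ⟨K, fun n N x y col A A' bp ty i e₁ e₂ T₁ T₂ m s hP hE hi hm he₁ he₂ hsame hty h₁ h₂ hh => ?_⟩
  have hs := (hP.blue.split hi).congr hty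
  have hc₁ := hs.chainHyp hP.gp hP.mono (Or.inl rfl) he₁ hP.linked.1
  have hc₂ := hs.chainHyp hP.gp hP.mono (Or.inr rfl) he₂ hP.linked.2
  obtain ⟨hT₁, ht₁, hcov₁⟩ := h₁
  obtain ⟨hT₂, ht₂, hcov₂⟩ := h₂
  have hm' : ((Finset.range N).filter fun d => ty d = 2).card = m := by
    rw [← hm]
    congr 1
    refine Finset.filter_congr fun d hd => ?_
    rw [hty d (Finset.mem_range.1 hd)]
  refine (hK N _ _ _ _ col ty e₁ e₂ T₁ T₂ m (Sound N x y col A A') s hT₁ hT₂ (hE.m_eq.trans hm) hm'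
    ht₁ ht₂ ?_ hh).mono le_rfl ?_
  · intro t₁ hle₁ t₂ hle₂
    have hr₁ := ht₁.recs t₁ hle₁
    have hr₂ := ht₂.recs t₂ hle₂
    refine ⟨⟨hr₁.tan.b_lt, hr₁.tan.q_mem⟩, ⟨hr₂.tan.b_lt, hr₂.tan.q_mem⟩, fun m₁ m₂ hm₁ hm₂ => ?_⟩
    obtain ⟨k1, k2, k3⟩ := tangent_of_edge hc₁ hr₁ hm₁
    obtain ⟨l1, l2, l3⟩ := tangent_of_edge hc₂ hr₂ hm₂
    constructor
    · intro d hd hcol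
      have a1 := k1.blue_side (Or.inl rfl) he₁ hd hcol
      have a2 := l1.blue_side (Or.inr rfl) he₂ hd hcol
      have a3 := hs.blue d hd hcol
      have a4 := hs.le_two d hd
      have : ty d = 0 ∨ ty d = 1 := by omega
      rcases this with h | h
      · exact mul_nonpos_of_nonpos_of_nonneg (by linarith [a1.1 h]) (by linarith [a2.1 h])
      · exact mul_nonpos_of_nonneg_of_nonpos (by linarith [a1.2 h]) (by linarith [a2.2 h])
    · rw [hs.card_unsep hP.gp hP.mono he₁ he₂ k1 l1 k3 l3, ← k2, ← l2, ← hsame]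
      rfl
  · rintro s' ⟨-, h1, h2, h3⟩
    refine ⟨h1, h2, fun b₁ m₁ b₂ m₂ hT₁ hT₂ => ?_⟩
    replace hT₁ := hT₁.congr hty
    replace hT₂ := hT₂.congr hty
    obtain ⟨t₁, hle₁, hg₁, hf₁⟩ := hcov₁ _ _ hT₁
    obtain ⟨t₂, hle₂, hg₂, hf₂⟩ := hcov₂ _ _ hT₂
    rw [hs.card_unsep hP.gp hP.mono he₁ he₂ hT₁ hT₂ hf₁ hf₂, ← hsame]
    refine le_trans ?_ (h3 t₁ hle₁ t₂ hle₂)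
    unfold comboScore
    omega

/-- The invariant of the evaluation of the splits below `k`. -/
structure SplitsInv (n N : ℕ) (x y : ℕ → ℝ) (col A A' bp : ℕ → ℕ) (k : ℕ) (s : State) : Prop where
  env : Env n N x y col A A' bp s
  held : Held (Sound N x y col A A') s
  bound : ∀ i < k, ∀ e₁ e₂, (e₁ = 0 ∨ e₁ = 1) → (e₂ = 0 ∨ e₂ = 1) →
    Bounded n N x y col bp i e₁ e₂ (s.nat vbest)

theorem Bounded.mono {e₁ e₂ v v' : ℕ} (h : Bounded n N x y col bp i e₁ e₂ v) (hv : v ≤ v') :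
    Bounded n N x y col bp i e₁ e₂ v' := fun b₁ m₁ b₂ m₂ h₁ h₂ => (h b₁ m₁ b₂ m₂ h₁ h₂).trans hv

theorem Held.frame {S : ℕ → ℕ → ℕ → ℕ → ℕ → Prop} (h : Held S s) (hf : Frame p s s')
    (hv : ∀ v ∈ [vb1, vq1, vb2, vq2, vbest], v ∉ p.natVars) : Held S s' := by
  unfold Held
  rw [hf.nat _ (hv vb1 (by simp)), hf.nat _ (hv vq1 (by simp)), hf.nat _ (hv vb2 (by simp)),
    hf.nat _ (hv vq2 (by simp)), hf.nat _ (hv vbest (by simp))]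
  exact h

/-- The state after the evaluation of the pairs of tangents that both touch the east wedge. -/
structure EastDone (n N : ℕ) (x y : ℕ → ℝ) (col A A' bp : ℕ → ℕ) (i v : ℕ) (s : State) : Prop where
  env : SplitEnv n N x y col A A' bp i s
  held : Held (Sound N x y col A A') s
  le : v ≤ s.nat vbest
  bound : Bounded n N x y col bp i 1 1 (s.nat vbest)
  res₀ : ∃ T, ChainRes N (chX 1 x) (chY 1 1 y) col (s.natArr aTy) 1 0 T s
  res₂ : ∃ T, ChainRes N (chX 1 x) (chY (-1) 1 y) col (s.natArr aTy) 1 2 T s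

theorem runs_eastProg : ∃ K, ∀ (n N : ℕ) (x y : ℕ → ℝ) (col A A' bp : ℕ → ℕ) (i m v : ℕ) (s : State),
    Points n N x y col A A' bp → Env n N x y col A A' bp s → s.nat vi = i → i < n →
    ((Finset.range N).filter fun d => splitTy n bp i d = 2).card = m →
    (Held (Sound N x y col A A') s ∨ s.nat vbest = 0) → s.nat vbest = v →
    Runs eastProg s (K * (N + 1) + K * (m + 1) ^ 2) (EastDone n N x y col A A' bp i v) := by
  obtain ⟨K₁, hK₁⟩ := runs_typeProg
  obtain ⟨K₂, hK₂⟩ := runs_branchProg 0 aNx false (by omega)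
  obtain ⟨K₃, hK₃⟩ := runs_branchProg 2 aPv false (by omega)
  obtain ⟨K₄, hK₄⟩ := runs_combo 0 2 (by omega) (by omega) true
  refine ⟨K₁ + K₂ + K₃ + K₄, fun n N x y col A A' bp i m v s hP hE hsi hi hm hh hv => ?_⟩
  refine (Runs.seq (hK₁ n N x y col A A' bp i s hE hsi).frame fun s₁ hs₁ =>
    Runs.seq (hK₂ n N x y col A A' bp 1 i 1 s₁ hP hs₁.1 hi (Or.inl rfl) ?_ rfl (by simp)).frame fun s₂ hs₂ =>
    Runs.seq (hK₃ n N x y col A A' bp (-1) i 1 s₂ hP ?_ hi (Or.inr rfl) ?_ rfl (by simp)).frame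
    fun s₃ hs₃ => ((?_ : Runs _ _ (K₄ * (m + 1) ^ 2) _))).mono ?_ fun _ h => h
  · rw [hs₁.1.env.nx_eq]; exact hP.linked.1
  · exact hs₁.1.frame hs₂.2 (by decide) (by decide) rfl
  · rw [(hs₁.1.frame hs₂.2 (by decide) (by decide) rfl).env.pv_eq]; exact hP.linked.2
  · have hE₂ := hs₁.1.frame hs₂.2 (by decide) (by decide) rfl
    have hE₃ := hE₂.frame hs₃.2 (by decide) (by decide) rfl
    obtain ⟨⟨T₂, hr₂⟩, hf₂⟩ := hs₂
    obtain ⟨⟨T₃, hr₃⟩, hf₃⟩ := hs₃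
    have hr₂' := hr₂.frame hf₃ (by decide) (by decide)
    have hty₂ := hf₂.arr aTy (by decide)
    have hty₃ := hf₃.arr aTy (by decide)
    rw [← hty₂, ← hty₃] at hr₂'
    rw [← hty₃] at hr₃
    have hbest : s₃.nat vbest = v := by
      rw [hf₃.nat vbest (by decide), hf₂.nat vbest (by decide), hs₁.2.nat vbest (by decide), hv]
    have hh' : Held (Sound N x y col A A') s₃ ∨ s₃.nat vbest = 0 := by
      rw [hbest, ← hv]
      exact hh.imp_left fun h => ((h.frame hs₁.2 (by decide)).frame hf₂ (by decide)).frame hf₃ (by decide)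
    refine (hK₄ n N x y col A A' bp (s₃.natArr aTy) i 1 1 T₂ T₃ m s₃ hP hE₃ hi hm (Or.inr rfl)
      (Or.inr rfl) rfl hE₃.ty_eq hr₂' hr₃ hh').frame.mono le_rfl ?_
    rintro s₄ ⟨⟨h1, h2, h3⟩, hf₄⟩
    have hty₄ := hf₄.arr aTy (by decide)
    refine ⟨hE₃.frame hf₄ (by decide) (by decide) rfl, h1, hbest ▸ h2, h3, ⟨T₂, ?_⟩, ⟨T₃, ?_⟩⟩
    · rw [hty₄]; exact hr₂'.frame hf₄ (by decide) (by decide)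
    · rw [hty₄]; exact hr₃.frame hf₄ (by decide) (by decide)
  · nlinarith [Nat.zero_le (K₄ * (N + 1)), Nat.zero_le ((K₁ + K₂ + K₃) * (m + 1) ^ 2)]

theorem runs_westProg : ∃ K, ∀ (n N : ℕ) (x y : ℕ → ℝ) (col A A' bp : ℕ → ℕ) (i m v : ℕ) (s : State),
    Points n N x y col A A' bp → EastDone n N x y col A A' bp i v s → i < n → i ≠ 0 →
    ((Finset.range N).filter fun d => splitTy n bp i d = 2).card = m →
    Runs westProg s (K * (N + 1) + K * (m + 1) ^ 2) fun s' =>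
      Held (Sound N x y col A A') s' ∧ v ≤ s'.nat vbest ∧ ∀ e₁ e₂, (e₁ = 0 ∨ e₁ = 1) →
        (e₂ = 0 ∨ e₂ = 1) → Bounded n N x y col bp i e₁ e₂ (s'.nat vbest) := by
  obtain ⟨K₁, hK₁⟩ := runs_branchProg 1 aNx true (by omega)
  obtain ⟨K₂, hK₂⟩ := runs_branchProg 3 aPv true (by omega)
  obtain ⟨K₃, hK₃⟩ := runs_combo 1 3 (by omega) (by omega) true
  obtain ⟨K₄, hK₄⟩ := runs_combo 0 3 (by omega) (by omega) false
  obtain ⟨K₅, hK₅⟩ := runs_combo 1 2 (by omega) (by omega) false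
  refine ⟨K₁ + K₂ + K₃ + K₄ + K₅, fun n N x y col A A' bp i m v s hP hD hi hi0 hm => ?_⟩
  have hE := hD.env
  refine (Runs.seq (hK₁ n N x y col A A' bp 1 i 0 s hP hE hi (Or.inl rfl) ?_ rfl fun _ => hi0).frame
    fun s₁ hs₁ => Runs.seq (hK₂ n N x y col A A' bp (-1) i 0 s₁ hP ?_ hi (Or.inr rfl) ?_ rfl
      fun _ => hi0).frame fun s₂ hs₂ => (?_ : Runs _ _ (K₃ * (m + 1) ^ 2 + (K₄ * (m + 1) ^ 2 +
      K₅ * (m + 1) ^ 2)) _)).mono ?_ fun _ h => h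
  · rw [hE.env.nx_eq]; exact hP.linked.1
  · exact hE.frame hs₁.2 (by decide) (by decide) rfl
  · rw [(hE.frame hs₁.2 (by decide) (by decide) rfl).env.pv_eq]; exact hP.linked.2
  · have hE₁ := hE.frame hs₁.2 (by decide) (by decide) rfl
    have hE₂ := hE₁.frame hs₂.2 (by decide) (by decide) rfl
    obtain ⟨⟨T₁, hr₁⟩, hf₁⟩ := hs₁
    obtain ⟨⟨T₃, hr₃⟩, hf₂⟩ := hs₂
    obtain ⟨T₀, hr₀⟩ := hD.res₀
    obtain ⟨T₂, hr₂⟩ := hD.res₂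
    have hty₁ := hf₁.arr aTy (by decide)
    have hty₂ := hf₂.arr aTy (by decide)
    rw [← hty₁, ← hty₂] at hr₁ hr₀ hr₂
    rw [← hty₂] at hr₃
    replace hr₀ := (hr₀.frame hf₁ (by decide) (by decide)).frame hf₂ (by decide) (by decide)
    replace hr₂ := (hr₂.frame hf₁ (by decide) (by decide)).frame hf₂ (by decide) (by decide)
    replace hr₁ := hr₁.frame hf₂ (by decide) (by decide)
    have hh : Held (Sound N x y col A A') s₂ :=
      (hD.held.frame hf₁ (by decide)).frame hf₂ (by decide)
    have hbest : s₂.nat vbest = s.nat vbest := by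
      rw [hf₂.nat vbest (by decide), hf₁.nat vbest (by decide)]
    set ty := s₂.natArr aTy with hty
    have htyeq := hE₂.ty_eq
    refine Runs.seq (hK₃ n N x y col A A' bp ty i 0 0 T₁ T₃ m s₂ hP hE₂ hi hm (Or.inl rfl)
      (Or.inl rfl) rfl htyeq hr₁ hr₃ (Or.inl hh)).frame fun s₃ hs₃ => ?_
    obtain ⟨⟨h1, h2, h3⟩, hf₃⟩ := hs₃
    refine Runs.seq (hK₄ n N x y col A A' bp ty i 1 0 T₀ T₃ m s₃ hP
      (hE₂.frame hf₃ (by decide) (by decide) rfl) hi hm (Or.inr rfl) (Or.inl rfl) rfl htyeq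
      (hr₀.frame hf₃ (by decide) (by decide)) (hr₃.frame hf₃ (by decide) (by decide))
      (Or.inl h1)).frame fun s₄ hs₄ => ?_
    obtain ⟨⟨k1, k2, k3⟩, hf₄⟩ := hs₄
    refine (hK₅ n N x y col A A' bp ty i 0 1 T₁ T₂ m s₄ hP
      ((hE₂.frame hf₃ (by decide) (by decide) rfl).frame hf₄ (by decide) (by decide) rfl) hi hm
      (Or.inl rfl) (Or.inr rfl) rfl htyeq
      ((hr₁.frame hf₃ (by decide) (by decide)).frame hf₄ (by decide) (by decide))
      ((hr₂.frame hf₃ (by decide) (by decide)).frame hf₄ (by decide) (by decide))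
      (Or.inl k1)).mono le_rfl ?_
    rintro s₅ ⟨l1, l2, l3⟩
    have hle := hD.le
    refine ⟨l1, by omega, fun e₁ e₂ he₁ he₂ => ?_⟩
    rcases he₁ with rfl | rfl <;> rcases he₂ with rfl | rfl
    · exact h3.mono (by omega)
    · exact l3
    · exact k3.mono (by omega)
    · exact hD.bound.mono (by omega)
  · nlinarith [Nat.zero_le ((K₃ + K₄ + K₅) * (N + 1)), Nat.zero_le ((K₁ + K₂) * (m + 1) ^ 2)]

theorem BlueList.gap_card (h : BlueList n N col bp) (hi : i < n) (hi0 : i ≠ 0) :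
    ((Finset.range N).filter fun d => splitTy n bp i d = 2).card + 1 ≤ bp i - bp (i - 1) := by
  have h1 : ((Finset.range N).filter fun d => splitTy n bp i d = 2) ⊆
      Finset.Ioo (bp (i - 1)) (bp i) := by
    intro d hd
    have hd2 := (Finset.mem_filter.1 hd).2
    rw [splitTy_pos hi0] at hd2
    rw [Finset.mem_Ioo]
    split_ifs at hd2 <;> first | assumption | omega
  have h2 := Finset.card_le_card h1
  rw [Nat.card_Ioo] at h2
  have := h.mono (i - 1) (by omega) i hi (by omega)
  omega

/-- The evaluation of a split with `m` points in its gap takes `O(N + (m + 1) ^ 2)` steps. This adds up to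
`O(N ^ 2)`, as the sizes of the gaps add up to at most `N`, apart from that of the split `0`. -/
theorem runs_splitsProg : ∃ K, ∀ (n N : ℕ) (x y : ℕ → ℝ) (col A A' bp : ℕ → ℕ) (s : State),
    Points n N x y col A A' bp → Env n N x y col A A' bp s → 0 < n → n ≤ N → s.nat vbest = 0 →
    Runs splitsProg s (K * (N + 1) ^ 2) (SplitsInv n N x y col A A' bp n) := by
  obtain ⟨K₁, hK₁⟩ := runs_eastProg
  obtain ⟨K₂, hK₂⟩ := runs_westProg
  refine ⟨20 + 3 * K₁ + 2 * K₂, fun n N x y col A A' bp s hP hE hn hnN hbest => ?_⟩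
  set m : ℕ → ℕ := fun i => ((Finset.range N).filter fun d => splitTy n bp i d = 2).card with hm
  refine (Runs.seq (P := fun s => s.nat vi = 0 ∧ Env n N x y col A A' bp s ∧ s.nat vbest = 0)
    (Runs.of_loopFree rfl ⟨by simp [Prog.run, State.setNat, NExpr.eval], hE.frame (.of_loopFree rfl s)
      (by decide) (by decide) rfl, ?_⟩) fun s₁ hs₁ =>
    Runs.seq (hK₁ n N x y col A A' bp 0 (m 0) 0 s₁ hP hs₁.2.1 hs₁.1 hn rfl (Or.inr hs₁.2.2) hs₁.2.2)
    fun s₂ hs₂ => Runs.seq (P := fun s => s.nat vi = 1 ∧ SplitsInv n N x y col A A' bp 1 s)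
    (Runs.of_loopFree rfl ⟨by simp [Prog.run, State.setNat, NExpr.eval],
      hs₂.env.env.frame (.of_loopFree rfl s₂) (by decide) (by decide) rfl,
      hs₂.held.frame (.of_loopFree rfl s₂) (by decide), ?_⟩)
    fun s₃ hs₃ => (Runs.upto_sum (I := SplitsInv n N x y col A A' bp) (K := n)
      (T := fun k => (K₁ * (N + 1) + K₁ * (m k + 1) ^ 2) + (K₂ * (N + 1) + K₂ * (m k + 1) ^ 2)) ?_ ?_ hn
      hs₃.1 hs₃.2)).mono ?_ fun _ h => h.2
  · rw [← hbest]
    simp [Prog.run, State.setNat]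
  · intro i hi e₁ e₂ he₁ he₂ b₁ m₁ b₂ m₂ hT₁ hT₂
    obtain rfl : i = 0 := by omega
    have hne : ∀ d, splitTy n bp 0 d ≠ 0 := by
      intro d; rw [splitTy_zero]; split_ifs <;> simp
    have h1 : e₁ = 1 := he₁.resolve_left fun h => hne b₁ (hT₁.b_ty.trans h)
    have h2 : e₂ = 1 := he₂.resolve_left fun h => hne b₂ (hT₂.b_ty.trans h)
    subst h1 h2
    simpa [Prog.run, State.setNat] using hs₂.bound b₁ m₁ b₂ m₂ hT₁ hT₂
  · intro k s _ hI _
    exact hI.env.base.n_eq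
  · intro k s hk0 hk hI hv
    refine (Runs.seq (hK₁ n N x y col A A' bp k (m k) _ s hP hI.env hv hk rfl (Or.inl hI.held) rfl)
      fun s₁ hs₁ => (hK₂ n N x y col A A' bp k (m k) _ s₁ hP hs₁ hk (by omega) rfl)).frame.mono
      le_rfl ?_
    rintro s' ⟨⟨h1, h2, h3⟩, hf⟩
    have hf' := Frame.of_loopFree (p := .setNat vi (.const (k + 1))) rfl s'
    refine ⟨(hf.nat vi (by decide)).trans hv, (hI.env.frame hf (by decide) (by decide) rfl).frame hf'
      (by simp [Prog.natVars]) (by simp [Prog.natArrs]) rfl, h1.frame hf' (by simp [Prog.natVars]), ?_⟩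
    intro i hi e₁ e₂ he₁ he₂
    have hb : (s'.setNat vi (k + 1)).nat vbest = s'.nat vbest := by simp [State.setNat]
    rw [hb]
    rcases Nat.lt_succ_iff_lt_or_eq.1 hi with hi | rfl
    · exact (hI.bound i hi e₁ e₂ he₁ he₂).mono h2
    · exact h3 e₁ e₂ he₁ he₂
  · have hm0 : m 0 ≤ N := (Finset.card_filter_le _ _).trans (by simp)
    -- the gaps of different splits are disjoint
    have hsum : ∀ k, k < n → ∑ i ∈ Finset.Ico 1 (k + 1), (m i + 1) ≤ bp k := by
      intro k
      induction k with
      | zero => simp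
      | succ k ih =>
        intro hk
        rw [Finset.sum_Ico_succ_top (by omega)]
        have h1 := ih (by omega)
        have h2 := hP.blue.gap_card (i := k + 1) hk (by omega)
        have h3 := hP.blue.mono k (by omega) (k + 1) hk (by omega)
        simp only [Nat.add_sub_cancel] at h2
        have h4 : m (k + 1) + 1 ≤ bp (k + 1) - bp k := h2
        omega
    have hsum' : ∑ i ∈ Finset.Ico 1 n, (m i + 1) ≤ N := by
      have h1 := hsum (n - 1) (by omega)
      rw [Nat.sub_add_cancel hn] at h1
      exact h1.trans (hP.blue.lt _ (by omega)).le
    have hle : ∑ k ∈ Finset.Ico 1 n, ((K₁ * (N + 1) + K₁ * (m k + 1) ^ 2) +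
        (K₂ * (N + 1) + K₂ * (m k + 1) ^ 2) + ((NExpr.var vn).cost + 7)) ≤
        ∑ k ∈ Finset.Ico 1 n, ((K₁ + K₂ + 8) * (N + 1) + (K₁ + K₂) * (N + 1) * (m k + 1)) := by
      refine Finset.sum_le_sum fun k _ => ?_
      have h1 : m k ≤ N := (Finset.card_filter_le _ _).trans (by simp)
      have h2 : (m k + 1) ^ 2 ≤ (N + 1) * (m k + 1) := by
        rw [sq]; exact Nat.mul_le_mul_right _ (by omega)
      have h3 := Nat.mul_le_mul_left (K₁ + K₂) h2
      have h4 : (NExpr.var vn).cost + 7 = 8 := rfl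
      rw [h4]
      nlinarith
    have hle2 : ∑ k ∈ Finset.Ico 1 n, ((K₁ + K₂ + 8) * (N + 1) + (K₁ + K₂) * (N + 1) * (m k + 1)) ≤
        N * ((K₁ + K₂ + 8) * (N + 1)) + (K₁ + K₂) * (N + 1) * N := by
      rw [Finset.sum_add_distrib, Finset.sum_const, smul_eq_mul, Nat.card_Ico, ← Finset.mul_sum]
      exact Nat.add_le_add (Nat.mul_le_mul_right _ (by omega)) (Nat.mul_le_mul_left _ hsum')
    have hm0' : (m 0 + 1) ^ 2 ≤ (N + 1) ^ 2 := Nat.pow_le_pow_left (by omega) 2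
    have h5 := Nat.mul_le_mul_left K₁ hm0'
    have h6 := hle.trans hle2
    simp only [Prog.time, NExpr.cost] at h6 ⊢
    have h7 : K₁ * (N + 1) ≤ K₁ * (N + 1) ^ 2 := Nat.mul_le_mul_left _ (by nlinarith)
    nlinarith

end

end Bowtie

namespace Bowtie

open RealRAM

/-! ### The program: sorting the points

Every point is moved to the cell given by the number of points to its left, which takes quadratic time.
The real arrays `0` to `3` hold the input. -/

notation "rU" => (4 : ℕ)
notation "rV" => (5 : ℕ)

/-- The blue points, followed by the red points, are copied to the arrays `rU` and `rV`. -/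
def copyBody : Prog :=
  .ite (.natLt (.var vu) (.var vn))
    (.seq (.putReal rU (.var vu) (.get 0 (.var vu))) (.putReal rV (.var vu) (.get 1 (.var vu))))
    (.seq (.putReal rU (.var vu) (.get 2 (.sub (.var vu) (.var vn))))
      (.putReal rV (.var vu) (.get 3 (.sub (.var vu) (.var vn)))))

/-- A step of the computation of the rank of the point `vu`. -/
def rankBody : Prog :=
  .ite (.realLt (.get rU (.var vv)) (.get rU (.var vu))) (.setNat vW (.add (.var vW) (.const 1))) .skip

/-- The point `vu` is moved to the cell given by its rank. -/
def moveBody : Prog :=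
  .seq (.putReal rX (.var vW) (.get rU (.var vu)))
  (.seq (.putReal rY (.var vW) (.get rV (.var vu)))
  (.ite (.natLt (.var vu) (.var vn)) (.putNat aCol (.var vW) (.const 1))
    (.putNat aCol (.var vW) (.const 0))))

/-- The rank of the point `vu` is computed, and the point is moved. -/
def sortBody : Prog :=
  .seq (.seq (.setNat vW (.const 0)) (.setNat vv (.const 0)))
  (.seq (Prog.upto vv (.var vN) rankBody) moveBody)

/-- The start of a row of the two-dimensional arrays. -/
def offBody : Prog :=
  .seq (.putNat aOff (.var vu) (.var vcnt)) (.setNat vcnt (.add (.var vcnt) (.add (.var vN) (.const 1))))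

/-- The point `vu` is appended to the list of blue points, if it is blue. -/
def blueBody : Prog :=
  .ite (.natEq (.get aCol (.var vu)) (.const 1))
    (.seq (.putNat aBlue (.var vcnt) (.var vu)) (.setNat vcnt (.add (.var vcnt) (.const 1)))) .skip

/-- The points are sorted, and the tables of the row starts and of the blue points are computed. -/
def sortProg : Prog :=
  .seq (.seq (.setNat vN (.add (.var vn) (.var vn))) (.setNat vu (.const 0)))
  (.seq (Prog.upto vu (.var vN) copyBody)
  (.seq (.setNat vu (.const 0))
  (.seq (Prog.upto vu (.var vN) sortBody)
  (.seq (.seq (.setNat vu (.const 0)) (.setNat vcnt (.const 0)))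
  (.seq (Prog.upto vu (.var vN) offBody)
  (.seq (.seq (.setNat vu (.const 0)) (.setNat vcnt (.const 0)))
  (Prog.upto vu (.var vN) blueBody)))))))

attribute [local simp] NExpr.eval RExpr.eval BExpr.Holds State.setNat State.setReal State.putNat
  State.putReal Prog.run Function.update_apply

/-- The number of points with a smaller `x`-coordinate. -/
noncomputable def rank (N : ℕ) (X : ℕ → ℝ) (j : ℕ) : ℕ :=
  open Classical in ((Finset.range N).filter fun v => X v < X j).card

/-- The arrays `x`, `y`, `col` hold the points `X`, `Y` in the order of their `x`-coordinates. The first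
`n` points are blue. -/
structure Sorted (n N : ℕ) (X Y x y : ℕ → ℝ) (col : ℕ → ℕ) (k : ℕ) : Prop where
  x_eq : ∀ j < k, x (rank N X j) = X j
  y_eq : ∀ j < k, y (rank N X j) = Y j
  col_eq : ∀ j < k, col (rank N X j) = if j < n then 1 else 0

section

variable {n N : ℕ} {X Y : ℕ → ℝ}

theorem rank_lt_iff {i j : ℕ} (hi : i < N) : rank N X i < rank N X j ↔ X i < X j := by
  classical
  constructor
  · intro h
    by_contra hcon
    refine h.not_ge (Finset.card_le_card fun v hv => ?_)
    simp only [Finset.mem_filter, Finset.mem_range] at hv ⊢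
    exact ⟨hv.1, hv.2.trans_le (not_lt.1 hcon)⟩
  · intro h
    refine Finset.card_lt_card ((Finset.ssubset_iff_of_subset fun v hv => ?_).2 ⟨i, ?_, ?_⟩)
    · simp only [Finset.mem_filter, Finset.mem_range] at hv ⊢
      exact ⟨hv.1, hv.2.trans h⟩
    · simp [hi, h]
    · simp

theorem rank_lt {j : ℕ} (hj : j < N) : rank N X j < N := by
  classical
  have : rank N X j < (Finset.range N).card :=
    Finset.card_lt_card ((Finset.ssubset_iff_of_subset (Finset.filter_subset _ _)).2
      ⟨j, by simpa using hj, by simp⟩)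
  simpa using this

theorem rank_inj (hX : ∀ i < N, ∀ j < N, i ≠ j → X i ≠ X j) {i j : ℕ} (hi : i < N) (hj : j < N)
    (h : rank N X i = rank N X j) : i = j := by
  by_contra hne
  rcases lt_or_gt_of_ne (hX i hi j hj hne) with h1 | h1
  · exact ((rank_lt_iff hi).2 h1).ne h
  · exact ((rank_lt_iff hj).2 h1).ne' h

theorem rank_surj (hX : ∀ i < N, ∀ j < N, i ≠ j → X i ≠ X j) {d : ℕ} (hd : d < N) :
    ∃ j < N, rank N X j = d := by
  have h := Finset.surj_on_of_inj_on_of_card_le (s := Finset.range N) (t := Finset.range N)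
    (fun j _ => rank N X j) (fun j hj => by simpa using rank_lt (by simpa using hj))
    (fun i j hi hj h => rank_inj hX (by simpa using hi) (by simpa using hj) h) le_rfl d (by simpa using hd)
  obtain ⟨j, hj, rfl⟩ := h
  exact ⟨j, by simpa using hj, rfl⟩

theorem Sorted.mono {x y : ℕ → ℝ} {col : ℕ → ℕ} (h : Sorted n N X Y x y col N)
    (hX : ∀ i < N, ∀ j < N, i ≠ j → X i ≠ X j) : ∀ i < N, ∀ j < N, (x i < x j ↔ i < j) := by
  intro i hi j hj
  obtain ⟨i', hi', rfl⟩ := rank_surj hX hi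
  obtain ⟨j', hj', rfl⟩ := rank_surj hX hj
  rw [h.x_eq i' hi', h.x_eq j' hj', rank_lt_iff hi']

theorem Sorted.card_blue {x y : ℕ → ℝ} {col : ℕ → ℕ} (h : Sorted n N X Y x y col N) (hn : n ≤ N)
    (hX : ∀ i < N, ∀ j < N, i ≠ j → X i ≠ X j) :
    ((Finset.range N).filter fun d => col d = 1).card = n := by
  have h1 : ((Finset.range N).filter fun d => col d = 1) = (Finset.range n).image (rank N X) := by
    ext d
    simp only [Finset.mem_filter, Finset.mem_range, Finset.mem_image]
    constructor
    · rintro ⟨hd, hc⟩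
      obtain ⟨j, hj, rfl⟩ := rank_surj hX hd
      rw [h.col_eq j hj] at hc
      split_ifs at hc with hjn
      exact ⟨j, hjn, rfl⟩
    · rintro ⟨j, hj, rfl⟩
      refine ⟨rank_lt (by omega), ?_⟩
      rw [h.col_eq j (by omega), if_pos hj]
  rw [h1, Finset.card_image_of_injOn, Finset.card_range]
  intro i hi j hj h
  simp only [Finset.coe_range, Set.mem_Iio] at hi hj
  exact rank_inj hX (by omega) (by omega) h

theorem BlueList.append {c k : ℕ} {col bp bp' : ℕ → ℕ} (h : BlueList c k col bp) (hk : col k = 1)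
    (h1 : ∀ j < c, bp' j = bp j) (h2 : bp' c = k) : BlueList (c + 1) (k + 1) col bp' := by
  have key : ∀ j, j < c + 1 → (j < c ∧ bp' j = bp j) ∨ (j = c ∧ bp' j = k) := by
    intro j hj
    rcases Nat.lt_succ_iff_lt_or_eq.1 hj with hj | rfl
    · exact Or.inl ⟨hj, h1 j hj⟩
    · exact Or.inr ⟨rfl, h2⟩
  refine ⟨fun j hj => ?_, fun j hj l hl hlt => ?_, fun d hd hc => ?_, fun j hj => ?_⟩
  · rcases key j hj with ⟨h3, h4⟩ | ⟨h3, h4⟩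
    · have := h.lt j h3; omega
    · omega
  · rcases key l hl with ⟨h3, h4⟩ | ⟨h3, h4⟩
    · rw [h4, h1 j (by omega)]
      exact h.mono j (by omega) l h3 hlt
    · rw [h4, h1 j (by omega)]
      exact h.lt j (by omega)
  · rcases Nat.lt_succ_iff_lt_or_eq.1 hd with hd | rfl
    · obtain ⟨j, hj, hjd⟩ := h.surj d hd hc
      exact ⟨j, by omega, (h1 j hj).trans hjd⟩
    · exact ⟨c, by omega, h2⟩
  · rcases key j hj with ⟨h3, h4⟩ | ⟨h3, h4⟩
    · rw [h4]; exact h.col j h3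
    · rw [h4]; exact hk

theorem BlueList.skip {c k : ℕ} {col bp : ℕ → ℕ} (h : BlueList c k col bp) (hk : col k ≠ 1) :
    BlueList c (k + 1) col bp := by
  refine ⟨fun j hj => (h.lt j hj).trans (by omega), h.mono, fun d hd hc => ?_, h.col⟩
  rcases Nat.lt_succ_iff_lt_or_eq.1 hd with hd | rfl
  · exact h.surj d hd hc
  · exact absurd hc hk

/-- The number of points is known, and the arrays `rU` and `rV` hold the first `k` points. -/
structure Copied (n N : ℕ) (X Y : ℕ → ℝ) (k : ℕ) (s : State) : Prop where
  n_eq : s.nat vn = n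
  N_eq : s.nat vN = N
  x_eq : ∀ j < k, s.realArr rU j = X j
  y_eq : ∀ j < k, s.realArr rV j = Y j

theorem Copied.frame {k : ℕ} {s s' : State} {p : Prog} (h : Copied n N X Y k s) (hf : Frame p s s')
    (hv : ∀ v ∈ [vn, vN], v ∉ p.natVars) (hr : ∀ a ∈ [rU, rV], a ∉ p.realArrs) :
    Copied n N X Y k s' := by
  refine ⟨(hf.nat _ (hv _ (by simp))).trans h.n_eq, (hf.nat _ (hv _ (by simp))).trans h.N_eq, ?_, ?_⟩
  · rw [hf.realArr rU (hr _ (by simp))]; exact h.x_eq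
  · rw [hf.realArr rV (hr _ (by simp))]; exact h.y_eq

theorem runs_copy {s₀ : State} (hX : ∀ j < N, X j = if j < n then s₀.realArr 0 j else s₀.realArr 2 (j - n))
    (hY : ∀ j < N, Y j = if j < n then s₀.realArr 1 j else s₀.realArr 3 (j - n)) (s : State)
    (h : Copied n N X Y 0 s) (hr : ∀ a < 4, s.realArr a = s₀.realArr a) (hu : s.nat vu = 0) :
    Runs (Prog.upto vu (.var vN) copyBody) s ((N + 1) * (copyBody.time + 8)) (Copied n N X Y N) := by
  refine (Runs.upto (T := copyBody.time) (K := N) (I := fun k s => Copied n N X Y k s ∧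
    ∀ a < 4, s.realArr a = s₀.realArr a) ?_ ?_ hu ⟨h, hr⟩).mono le_rfl fun _ h => h.2.1
  · intro k s _ hI _
    exact hI.1.N_eq
  · rintro k s hk ⟨⟨h1, h2, h3, h4⟩, h5⟩ hv
    have a0 := h5 0 (by omega)
    have a1 := h5 1 (by omega)
    have a2 := h5 2 (by omega)
    have a3 := h5 3 (by omega)
    have hrun : copyBody.run s = (s.putReal rU k (X k)).putReal rV k (Y k) := by
      rw [hX k hk, hY k hk]
      by_cases hkn : k < n
      · simp [copyBody, hv, h1, hkn, a0, a1]
      · simp [copyBody, hv, h1, hkn, a2, a3]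
    refine Runs.of_loopFree rfl ?_
    rw [hrun]
    refine ⟨by simpa using hv, ⟨by simpa using h1, by simpa using h2, fun j hj => ?_, fun j hj => ?_⟩,
      fun a ha => ?_⟩
    · by_cases hjk : j = k
      · simp [hjk]
      · simpa [hjk] using h3 j (by omega)
    · by_cases hjk : j = k
      · simp [hjk]
      · simpa [hjk] using h4 j (by omega)
    · have e1 : a ≠ 4 := by omega
      have e2 : a ≠ 5 := by omega
      simpa [e1, e2] using h5 a ha

theorem runs_sortBody (hX : ∀ i < N, ∀ j < N, i ≠ j → X i ≠ X j) {k : ℕ} (hk : k < N) {s : State}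
    (hC : Copied n N X Y N s) (hs : Sorted n N X Y (s.realArr rX) (s.realArr rY) (s.natArr aCol) k)
    (hv : s.nat vu = k) :
    Runs sortBody s (4 + ((N + 1) * (rankBody.time + 8) + moveBody.time)) fun s' =>
      Sorted n N X Y (s'.realArr rX) (s'.realArr rY) (s'.natArr aCol) (k + 1) := by
  classical
  refine (Runs.seq (P := fun s' => s'.nat vv = 0 ∧ (Copied n N X Y N s' ∧ s'.nat vu = k ∧
      s'.nat vW = ((Finset.range 0).filter fun v => X v < X k).card ∧
      s'.realArr = s.realArr ∧ s'.natArr = s.natArr))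
    (Runs.of_loopFree rfl ⟨by simp, hC.frame (.of_loopFree rfl s) (by decide) (by decide),
      by simpa using hv, by simp, by simp, by simp⟩) fun s₁ hs₁ =>
    Runs.seq (Runs.upto (T := rankBody.time) (K := N) (I := fun l s' => Copied n N X Y N s' ∧
      s'.nat vu = k ∧ s'.nat vW = ((Finset.range l).filter fun v => X v < X k).card ∧
      s'.realArr = s.realArr ∧ s'.natArr = s.natArr) ?_ ?_ hs₁.1 hs₁.2)
    fun s₂ hs₂ => Runs.of_loopFree rfl ?_).mono ?_ fun _ h => h
  · intro l s' _ hI _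
    exact hI.1.N_eq
  · rintro l s' hl ⟨h1, h2, h3, h4, h5⟩ hvv
    have e1 := h1.x_eq l hl
    have e2 := h1.x_eq k hk
    have hrun : rankBody.run s' = if X l < X k then s'.setNat vW (s'.nat vW + 1) else s' := by
      simp only [rankBody, Prog.run, BExpr.Holds, RExpr.eval, NExpr.eval, hvv, h2, e1, e2]
    refine Runs.of_loopFree rfl ⟨?_, (h1.frame (.of_loopFree (p := rankBody) rfl s') (by decide)
      (by decide)).frame (.of_loopFree (p := .setNat vv (.const (l + 1))) rfl _) (by simp [Prog.natVars])
      (by simp [Prog.realArrs]), ?_⟩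
    · rw [hrun]; split_ifs <;> simpa using hvv
    · rw [hrun, Finset.range_add_one, Finset.filter_insert]
      split_ifs <;> simp [h2, h3, h4, h5]
  · obtain ⟨-, h1, h2, h3, h4, h5⟩ := hs₂
    have hW : s₂.nat vW = rank N X k := h3
    have e1 := h1.x_eq k hk
    have e2 := h1.y_eq k hk
    have hrun : moveBody.run s₂ = ((s₂.putReal rX (rank N X k) (X k)).putReal rY (rank N X k)
        (Y k)).putNat aCol (rank N X k) (if k < n then 1 else 0) := by
      by_cases hkn : k < n
      · simp [moveBody, h2, hW, e1, e2, h1.n_eq, hkn]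
      · simp [moveBody, h2, hW, e1, e2, h1.n_eq, hkn]
    rw [hrun]
    have key : ∀ j < k + 1, (j < k ∧ rank N X j ≠ rank N X k) ∨ j = k := by
      intro j hj
      by_cases hjk : j = k
      · exact Or.inr hjk
      · exact Or.inl ⟨by omega, fun h => hjk (rank_inj hX (by omega) hk h)⟩
    refine ⟨fun j hj => ?_, fun j hj => ?_, fun j hj => ?_⟩ <;>
      rcases key j hj with ⟨hjk, hne⟩ | rfl
    · simpa [hne, h4] using hs.x_eq j hjk
    · simp
    · simpa [hne, h4] using hs.y_eq j hjk
    · simp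
    · simpa [hne, h5] using hs.col_eq j hjk
    · simp
  · exact le_rfl

theorem runs_sortProg : ∃ K, ∀ (n N : ℕ) (X Y : ℕ → ℝ) (s : State), N = n + n →
    s.nat vn = n → (∀ j < N, X j = if j < n then s.realArr 0 j else s.realArr 2 (j - n)) →
    (∀ j < N, Y j = if j < n then s.realArr 1 j else s.realArr 3 (j - n)) →
    (∀ i < N, ∀ j < N, i ≠ j → X i ≠ X j) →
    Runs sortProg s (K * (N + 1) ^ 2) fun s' => ∃ x y col, Sorted n N X Y x y col N ∧
      Base n N x y col s' ∧ BlueList n N col (s'.natArr aBlue) := by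
  refine ⟨100 + copyBody.time + rankBody.time + moveBody.time + offBody.time + blueBody.time,
    fun n N X Y s₀ hNn hn hX hY hinj => ?_⟩
  refine (Runs.seq (P := fun s => s.nat vu = 0 ∧ Copied n N X Y 0 s ∧ ∀ a < 4, s.realArr a = s₀.realArr a)
    (Runs.of_loopFree rfl ⟨by simp, ⟨by simpa using hn, by simp [hn, hNn], by simp, by simp⟩, by simp⟩)
    fun s₁ hs₁ => Runs.seq (runs_copy hX hY s₁ hs₁.2.1 hs₁.2.2 hs₁.1)
    fun s₂ hs₂ => Runs.seq (P := fun s => s.nat vu = 0 ∧ (Copied n N X Y N s ∧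
        Sorted n N X Y (s.realArr rX) (s.realArr rY) (s.natArr aCol) 0))
      (Runs.of_loopFree rfl ⟨by simp, hs₂.frame (.of_loopFree rfl s₂) (by decide) (by decide),
        by simp, by simp, by simp⟩)
    fun s₃ hs₃ => Runs.seq (Runs.upto (K := N) (T := 4 + ((N + 1) * (rankBody.time + 8) + moveBody.time))
      (I := fun k s => Copied n N X Y N s ∧
        Sorted n N X Y (s.realArr rX) (s.realArr rY) (s.natArr aCol) k) ?_ ?_ hs₃.1 hs₃.2)
    fun s₄ hs₄ => Runs.seq (P := fun s => s.nat vu = 0 ∧ (Copied n N X Y N s ∧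
        Sorted n N X Y (s.realArr rX) (s.realArr rY) (s.natArr aCol) N ∧ s.nat vcnt = 0 * (N + 1) ∧
        ∀ r < 0, s.natArr aOff r = r * (N + 1)))
      (Runs.of_loopFree rfl ⟨by simp, hs₄.2.1.frame (.of_loopFree rfl s₄) (by decide) (by decide),
        by simpa using hs₄.2.2, by simp, by simp⟩)
    fun s₅ hs₅ => Runs.seq (Runs.upto (K := N) (T := offBody.time)
      (I := fun k s => Copied n N X Y N s ∧
        Sorted n N X Y (s.realArr rX) (s.realArr rY) (s.natArr aCol) N ∧ s.nat vcnt = k * (N + 1) ∧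
        ∀ r < k, s.natArr aOff r = r * (N + 1)) ?_ ?_ hs₅.1 hs₅.2)
    fun s₆ hs₆ => (?_ : Runs _ _ (4 + (N + 1) * (blueBody.time + 8)) _)).mono
      (T := 6 + ((N + 1) * (copyBody.time + 8) + (2 + ((N + 1) * (4 + ((N + 1) * (rankBody.time + 8) +
        moveBody.time) + 8) + (4 + ((N + 1) * (offBody.time + 8) +
        (4 + (N + 1) * (blueBody.time + 8)))))))) ?_ fun _ h => h
  · intro k s _ hI _
    exact hI.1.N_eq
  · rintro k s hk ⟨h1, h2⟩ hv
    refine (runs_sortBody hinj hk h1 h2 hv).frame.mono le_rfl ?_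
    rintro s' ⟨h3, hf⟩
    have hf' := Frame.of_loopFree (p := .setNat vu (.const (k + 1))) rfl s'
    exact ⟨(hf.nat vu (by decide)).trans hv, (h1.frame hf (by decide) (by decide)).frame hf'
      (by simp [Prog.natVars]) (by simp [Prog.realArrs]), by simpa using h3⟩
  · intro k s _ hI _
    exact hI.1.N_eq
  · rintro k s hk ⟨h1, h2, h3, h4⟩ hv
    have hf := Frame.of_loopFree (p := offBody) rfl s
    have hf' := Frame.of_loopFree (p := .setNat vu (.const (k + 1))) rfl (offBody.run s)
    refine Runs.of_loopFree rfl ⟨(hf.nat vu (by decide)).trans hv,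
      (h1.frame hf (by decide) (by decide)).frame hf' (by simp [Prog.natVars]) (by simp [Prog.realArrs]),
      by simpa [offBody] using h2, ?_, fun r hr => ?_⟩
    · simp [offBody, h3, h1.N_eq]; ring
    · by_cases hrk : r = k
      · simp [offBody, hrk, hv, h3]
      · simpa [offBody, hv, hrk] using h4 r (by omega)
  · obtain ⟨-, h1, h2, -, h4⟩ := hs₆
    obtain ⟨x, hx⟩ : ∃ x, x = s₆.realArr rX := ⟨_, rfl⟩
    obtain ⟨y, hy⟩ : ∃ y, y = s₆.realArr rY := ⟨_, rfl⟩
    obtain ⟨col, hcol⟩ : ∃ col, col = s₆.natArr aCol := ⟨_, rfl⟩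
    rw [← hx, ← hy, ← hcol] at h2
    have hB : Base n N x y col s₆ := ⟨h1.n_eq, h1.N_eq, hx.symm, hy.symm, hcol.symm, h4⟩
    refine (Runs.seq (P := fun s => s.nat vu = 0 ∧ (Base n N x y col s ∧
        BlueList ((Finset.range 0).filter fun d => col d = 1).card 0 col (s.natArr aBlue) ∧
        s.nat vcnt = ((Finset.range 0).filter fun d => col d = 1).card))
      (Runs.of_loopFree rfl ⟨by simp, hB.frame (by simp) (by simp) (by simp) (by simp) (by simp)
        (by simp), ⟨by simp, by simp, by simp, by simp⟩, by simp⟩)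
      fun s₇ hs₇ => Runs.upto (K := N) (T := blueBody.time) (I := fun k s => Base n N x y col s ∧
        BlueList ((Finset.range k).filter fun d => col d = 1).card k col (s.natArr aBlue) ∧
        s.nat vcnt = ((Finset.range k).filter fun d => col d = 1).card) ?_ ?_ hs₇.1 hs₇.2).mono
        le_rfl ?_
    · intro k s _ hI _
      exact hI.1.N_eq
    · rintro k s hk ⟨k1, k2, k3⟩ hv
      have hc := k1.col_eq
      by_cases hck : col k = 1
      · have hrun : blueBody.run s = (s.putNat aBlue (s.nat vcnt) k).setNat vcnt (s.nat vcnt + 1) := by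
          simp [blueBody, hv, hc, hck]
        refine Runs.of_loopFree rfl ?_
        rw [hrun, Finset.range_add_one, Finset.filter_insert, if_pos hck,
          Finset.card_insert_of_notMem (by simp)]
        refine ⟨by simpa using hv, k1.frame (by simp) (by simp) (by simp) (by simp) (by simp) (by simp),
          k2.append hck (fun j hj => ?_) ?_, by simp [k3]⟩
        · simp [k3, hj.ne]
        · simp [k3]
      · have hrun : blueBody.run s = s := by
          simp [blueBody, hv, hc, hck]
        refine Runs.of_loopFree rfl ?_
        rw [hrun, Finset.range_add_one, Finset.filter_insert, if_neg hck]
        exact ⟨hv, k1.frame (by simp) (by simp) (by simp) (by simp) (by simp) (by simp),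
          by simpa using k2.skip hck, by simpa using k3⟩
    · rintro s ⟨-, k1, k2, -⟩
      refine ⟨x, y, col, h2, k1, ?_⟩
      rwa [h2.card_blue (by omega) hinj] at k2
  · generalize copyBody.time = c1
    generalize rankBody.time = c2
    generalize moveBody.time = c3
    generalize offBody.time = c4
    generalize blueBody.time = c5
    have h1 : N + 1 ≤ (N + 1) ^ 2 := by nlinarith
    have h2 : 1 ≤ (N + 1) ^ 2 := by nlinarith
    have e : (N + 1) * (4 + ((N + 1) * (c2 + 8) + c3) + 8) =
        (N + 1) * (12 + c3) + (N + 1) ^ 2 * (c2 + 8) := by ring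
    rw [e]
    nlinarith [Nat.mul_le_mul_right c1 h1, Nat.mul_le_mul_right c3 h1, Nat.mul_le_mul_right c4 h1,
      Nat.mul_le_mul_right c5 h1]

end

end Bowtie

namespace Bowtie

open RealRAM Filter Topology

/-! ### The program: output -/

/-- A slope between those of the lines from `b` to `lo` and to `hi` is stored in the real variable `r`;
the marker `N` stands for an unbounded end. -/
def pickProg (b lo hi r : ℕ) : Prog :=
  .ite (.natEq (.var lo) (.var vN))
    (.ite (.natEq (.var hi) (.var vN)) (.setReal r (.const 0))
      (.setReal r (.sub (slopeExpr (.var b) (.var hi)) (.const 1))))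
    (.ite (.natEq (.var hi) (.var vN))
      (.setReal r (.add (slopeExpr (.var b) (.var lo)) (.const 1)))
      (.setReal r (.div (.add (slopeExpr (.var b) (.var lo)) (slopeExpr (.var b) (.var hi))) (.const 2))))

/-- The slope in the real variable `r` is increased within its edge if it equals the slope in `r'`. -/
def distinctProg (b hi r r' : ℕ) : Prog :=
  .ite (.realEq (.var r) (.var r'))
    (.ite (.natEq (.var hi) (.var vN)) (.setReal r (.add (.var r) (.const 1)))
      (.setReal r (.div (.add (.var r) (slopeExpr (.var b) (.var hi))) (.const 2))))
    .skip

/-- Output of the lines through `b` and `b'` with the slopes `r` and `r'`. -/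
def writeProg (b r b' r' : ℕ) : Prog :=
  .seq (.setReal 0 (.var r))
  (.seq (.setReal 1 (.sub (.get rY (.var b)) (.mul (.var r) (.get rX (.var b)))))
  (.seq (.setReal 2 (.var r'))
  (.setReal 3 (.sub (.get rY (.var b')) (.mul (.var r') (.get rX (.var b')))))))

/-- Output of a pair of lines on the best pair of edges, the one with the smaller slope first. The bowtie is
the region between the lines, and does not depend on their order. -/
def outProg : Prog :=
  .seq (.seq (.setNat vu (.get aNx (cellAt (.var vb1) (.var vq1))))
    (.setNat vv (.get aPv (cellAt (.var vb2) (.var vq2)))))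
  (.seq (pickProg vb1 vq1 vu 4) (.seq (pickProg vb2 vv vq2 5) (.seq (distinctProg vb1 vu 4 5)
    (.ite (.realLt (.var 4) (.var 5)) (writeProg vb1 4 vb2 5) (writeProg vb2 5 vb1 4)))))

/-- The whole algorithm. -/
def bowtieProg : Prog := .seq sortProg (.seq listsProg (.seq splitsProg outProg))

attribute [local simp] NExpr.eval RExpr.eval BExpr.Holds State.setNat State.setReal State.putNat
  State.putReal Prog.run Function.update_apply cellAt slopeExpr

/-- The slope `m` lies between those of the lines from `b` to `lo` and to `hi`. -/
def Between (N : ℕ) (x y : ℕ → ℝ) (b lo hi : ℕ) (m : ℝ) : Prop :=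
  (lo = N ∨ slopeAt x y b lo < m) ∧ (hi = N ∨ m < slopeAt x y b hi)

section

variable {n N : ℕ} {x y : ℕ → ℝ} {col A A' bp : ℕ → ℕ} {s : State}

theorem run_pickProg (hN : s.nat vN = N) (hx : s.realArr rX = x) (hy : s.realArr rY = y)
    {b lo hi r : ℕ} (h : s.nat lo = N ∨ s.nat hi = N ∨
      slopeAt x y (s.nat b) (s.nat lo) < slopeAt x y (s.nat b) (s.nat hi)) :
    ∃ m, (pickProg b lo hi r).run s = s.setReal r m ∧
      Between N x y (s.nat b) (s.nat lo) (s.nat hi) m := by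
  have e : ∀ d, (y d - y (s.nat b)) / (x d - x (s.nat b)) = slopeAt x y (s.nat b) d := fun _ => rfl
  by_cases h1 : s.nat lo = N <;> by_cases h2 : s.nat hi = N
  · exact ⟨0, by simp [pickProg, hN, h1, h2], Or.inl h1, Or.inl h2⟩
  · exact ⟨slopeAt x y (s.nat b) (s.nat hi) - 1, by simp [pickProg, hN, h1, h2, hx, hy, e], Or.inl h1,
      Or.inr (by linarith)⟩
  · exact ⟨slopeAt x y (s.nat b) (s.nat lo) + 1, by simp [pickProg, hN, h1, h2, hx, hy, e],
      Or.inr (by linarith), Or.inl h2⟩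
  · have h3 := (h.resolve_left h1).resolve_left h2
    exact ⟨(slopeAt x y (s.nat b) (s.nat lo) + slopeAt x y (s.nat b) (s.nat hi)) / 2,
      by simp [pickProg, hN, h1, h2, hx, hy, e], Or.inr (by linarith), Or.inr (by linarith)⟩

theorem run_distinctProg (hN : s.nat vN = N) (hx : s.realArr rX = x) (hy : s.realArr rY = y)
    {b lo hi r r' : ℕ} (h : Between N x y (s.nat b) (s.nat lo) (s.nat hi) (s.real r)) :
    ∃ m, (distinctProg b hi r r').run s = s.setReal r m ∧
      Between N x y (s.nat b) (s.nat lo) (s.nat hi) m ∧ m ≠ s.real r' := by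
  have e : ∀ d, (y d - y (s.nat b)) / (x d - x (s.nat b)) = slopeAt x y (s.nat b) d := fun _ => rfl
  by_cases h1 : s.real r = s.real r'
  · by_cases h2 : s.nat hi = N
    · refine ⟨s.real r + 1, by simp [distinctProg, hN, h1, h2], ⟨h.1.imp_right fun h => by linarith,
        Or.inl h2⟩, ?_⟩
      rw [h1]; linarith
    · have h3 := h.2.resolve_left h2
      refine ⟨(s.real r + slopeAt x y (s.nat b) (s.nat hi)) / 2, ?_,
        ⟨h.1.imp_right fun h => by linarith, Or.inr (by linarith)⟩, ?_⟩
      · simp [distinctProg, hN, h1, h2, hx, hy, e]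
      · rw [← h1]; intro h4; linarith
  · refine ⟨s.real r, ?_, h, h1⟩
    simp [distinctProg, h1]

theorem Linked.lt {e q : ℕ} {key : ℕ → ℝ} {S : Set ℕ} {nx : ℕ → ℕ} (h : Linked e key S nx)
    (hq : q = e ∨ q ∈ S) : q = e ∨ nx q = e ∨ key q < key (nx q) := by
  obtain ⟨h1, h2⟩ := h q hq
  by_cases h3 : nx q = e
  · exact Or.inr (Or.inl h3)
  · rcases (h2 _ (h1.resolve_left h3)).2 ⟨h3, le_rfl⟩ with h4 | h4
    · exact Or.inl h4
    · exact Or.inr (Or.inr h4)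

/-- The output describes two lines of different slopes on the best pair of edges. -/
theorem run_outProg (hP : Points n N x y col A A' bp) (hE : Env n N x y col A A' bp s)
    (hh : Held (Sound N x y col A A') s) : ∃ l₁ l₂ : Line, outputFst (outProg.run s) = l₁ ∧
      outputSnd (outProg.run s) = l₂ ∧ l₁.slope < l₂.slope ∧
      (∀ d < N, col d = 1 →
        hgt x y l₁.slope l₁.intercept d * hgt x y l₂.slope l₂.intercept d ≤ 0) ∧
      (unsep N col (hgt x y l₁.slope l₁.intercept) (hgt x y l₂.slope l₂.intercept)).card =
        s.nat vbest := by
  obtain ⟨⟨hb₁, hq₁⟩, ⟨hb₂, hq₂⟩, hlines⟩ := hh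
  obtain ⟨s₁, hs₁⟩ : ∃ s₁ : State, s₁ = (s.setNat vu (rowOf N A (s.nat vb1) (s.nat vq1))).setNat vv
    (rowOf N A' (s.nat vb2) (s.nat vq2)) := ⟨_, rfl⟩
  have hr₁ : (Prog.seq (.setNat vu (.get aNx (cellAt (.var vb1) (.var vq1))))
      (.setNat vv (.get aPv (cellAt (.var vb2) (.var vq2))))).run s = s₁ := by
    rw [hs₁]
    simp [hE.base.off_eq _ hb₁, hE.base.off_eq _ hb₂, hE.nx_eq, hE.pv_eq, rowOf]
  have hN : s₁.nat vN = N := by simp [hs₁, hE.base.N_eq]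
  have hx : s₁.realArr rX = x := by simp [hs₁, hE.base.x_eq]
  have hy : s₁.realArr rY = y := by simp [hs₁, hE.base.y_eq]
  have eb₁ : s₁.nat vb1 = s.nat vb1 := by simp [hs₁]
  have eq₁ : s₁.nat vq1 = s.nat vq1 := by simp [hs₁]
  have eb₂ : s₁.nat vb2 = s.nat vb2 := by simp [hs₁]
  have eq₂ : s₁.nat vq2 = s.nat vq2 := by simp [hs₁]
  have eu : s₁.nat vu = rowOf N A (s.nat vb1) (s.nat vq1) := by simp [hs₁]
  have ev : s₁.nat vv = rowOf N A' (s.nat vb2) (s.nat vq2) := by simp [hs₁]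
  obtain ⟨μ, hμ, hμ'⟩ := run_pickProg (b := vb1) (lo := vq1) (hi := vu) (r := 4) hN hx hy (by
    rw [eb₁, eq₁, eu]
    simpa using (hP.linked.1 _ hb₁).lt (by simpa using hq₁))
  obtain ⟨ν, hν, hν'⟩ := run_pickProg (s := s₁.setReal 4 μ) (b := vb2) (lo := vv) (hi := vq2) (r := 5)
    hN hx hy (by
    simp only [State.setReal]
    rw [eb₂, eq₂, ev]
    have := (hP.linked.2 _ hb₂).lt (q := s.nat vq2) (by simpa using hq₂)
    simp only [neg_mul, one_mul, neg_lt_neg_iff] at this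
    tauto)
  obtain ⟨ρ, hρ, hρ', hne⟩ := run_distinctProg (s := (s₁.setReal 4 μ).setReal 5 ν) (b := vb1)
    (lo := vq1) (hi := vu) (r := 4) (r' := 5) hN hx hy (by simpa using hμ')
  have hrun : outProg.run s = (Prog.ite (.realLt (.var 4) (.var 5)) (writeProg vb1 4 vb2 5)
      (writeProg vb2 5 vb1 4)).run (((s₁.setReal 4 μ).setReal 5 ν).setReal 4 ρ) := by
    rw [← hρ, ← hν, ← hμ, ← hr₁]; rfl
  have hone : OnEdge N x y 1 (rowOf N A) (s.nat vb1) (s.nat vq1) ρ := by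
    simp only [State.setReal] at hρ'
    rw [eb₁, eq₁, eu] at hρ'
    unfold OnEdge
    simpa [Between] using hρ'
  have htwo : OnEdge N x y (-1) (rowOf N A') (s.nat vb2) (s.nat vq2) ν := by
    simp only [State.setReal] at hν'
    rw [eb₂, eq₂, ev] at hν'
    unfold OnEdge
    simpa [Between] using hν'.symm
  obtain ⟨h1, h2⟩ := hlines ρ ν hone htwo
  rw [ht_eq_hgt, ht_eq_hgt] at h1 h2
  have hne' : ρ ≠ ν := by simpa using hne
  rw [hrun]
  by_cases hlt : ρ < ν
  · refine ⟨⟨ρ, y (s.nat vb1) - ρ * x (s.nat vb1)⟩, ⟨ν, y (s.nat vb2) - ν * x (s.nat vb2)⟩, ?_, ?_, hlt,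
      h1, h2⟩
    · simp [outputFst, hlt, writeProg, hx, hy, eb₁]
    · simp [outputSnd, hlt, writeProg, hx, hy, eb₂]
  · refine ⟨⟨ν, y (s.nat vb2) - ν * x (s.nat vb2)⟩, ⟨ρ, y (s.nat vb1) - ρ * x (s.nat vb1)⟩, ?_, ?_,
      lt_of_le_of_ne (not_lt.1 hlt) hne'.symm, fun d hd hc => by rw [mul_comm]; exact h1 d hd hc,
      by rw [unsep_comm]; exact h2⟩
    · simp [outputFst, hlt, writeProg, hx, hy, eb₂]
    · simp [outputSnd, hlt, writeProg, hx, hy, eb₁]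

end

/-! ### Red outliers -/

/-- The height of a point above a line. -/
def Line.height (l : Line) (p : ℝ × ℝ) : ℝ := p.2 - (l.slope * p.1 + l.intercept)

theorem mem_bowtie {l₁ l₂ : Line} {p : ℝ × ℝ} : p ∈ bowtie l₁ l₂ ↔ l₁.height p * l₂.height p ≤ 0 := by
  rw [mul_nonpos_iff]
  simp [bowtie, east, west, Line.above, Line.below, Line.height]

/-- The interior of a bowtie consists of the points that lie strictly on different sides of the two
lines. -/
theorem mem_interior_bowtie {l₁ l₂ : Line} {p : ℝ × ℝ} :
    p ∈ interior (bowtie l₁ l₂) ↔ l₁.height p * l₂.height p < 0 := by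
  constructor
  · intro h
    -- vertical translates of `p`
    have hcont : Continuous fun ε : ℝ => ((p.1, p.2 + ε) : ℝ × ℝ) := by fun_prop
    have hev : ∀ᶠ ε in 𝓝 (0 : ℝ), (l₁.height p + ε) * (l₂.height p + ε) ≤ 0 := by
      have h1 : bowtie l₁ l₂ ∈ 𝓝 (p.1, p.2 + (0 : ℝ)) := by
        rw [add_zero]; exact mem_interior_iff_mem_nhds.1 h
      filter_upwards [hcont.continuousAt.preimage_mem_nhds h1] with ε hε
      have h2 := mem_bowtie.1 hε
      unfold Line.height at h2 ⊢
      simp only at h2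
      linarith
    by_contra hcon
    rcases mul_nonneg_iff.1 (not_lt.1 hcon) with ⟨ha, hb⟩ | ⟨ha, hb⟩
    · obtain ⟨ε, h1, h2⟩ := ((hev.filter_mono nhdsWithin_le_nhds).and
        (self_mem_nhdsWithin (s := Set.Ioi (0 : ℝ)))).exists
      have h3 : 0 < ε := h2
      exact h1.not_gt (mul_pos (by linarith) (by linarith))
    · obtain ⟨ε, h1, h2⟩ := ((hev.filter_mono nhdsWithin_le_nhds).and
        (self_mem_nhdsWithin (s := Set.Iio (0 : ℝ)))).exists
      have h3 : ε < 0 := h2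
      exact h1.not_gt (mul_pos_of_neg_of_neg (by linarith) (by linarith))
  · intro h
    refine mem_interior.2 ⟨{p | l₁.height p * l₂.height p < 0}, fun q hq => mem_bowtie.2 (le_of_lt hq),
      ?_, h⟩
    refine isOpen_lt ?_ continuous_const
    unfold Line.height
    fun_prop

/-- Minimizing the number of red outliers means maximizing the number of red points that the lines do not
separate strictly. -/
theorem redOutliers_add_unsep {N : ℕ} {x y : ℕ → ℝ} {col : ℕ → ℕ} {R : Finset (ℝ × ℝ)}
    (hinj : ∀ i < N, ∀ j < N, i ≠ j → x i ≠ x j)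
    (hR : ∀ p, p ∈ R ↔ ∃ i < N, col i ≠ 1 ∧ (x i, y i) = p) (l₁ l₂ : Line) :
    redOutliers R l₁ l₂ +
      (unsep N col (hgt x y l₁.slope l₁.intercept) (hgt x y l₂.slope l₂.intercept)).card =
      ((Finset.range N).filter fun d => col d ≠ 1).card := by
  classical
  have hset : (R : Set (ℝ × ℝ)) ∩ interior (bowtie l₁ l₂) = (fun i => (x i, y i)) ''
      (((Finset.range N).filter fun d => col d ≠ 1).filter fun d =>
        ¬ 0 ≤ hgt x y l₁.slope l₁.intercept d * hgt x y l₂.slope l₂.intercept d : Finset ℕ) := by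
    ext p
    simp only [Set.mem_inter_iff, Finset.mem_coe, hR, Set.mem_image, Finset.mem_filter,
      Finset.mem_range, not_le, mem_interior_bowtie]
    constructor
    · rintro ⟨⟨i, hi, hc, rfl⟩, h⟩
      exact ⟨i, ⟨⟨hi, hc⟩, h⟩, rfl⟩
    · rintro ⟨i, ⟨⟨hi, hc⟩, h⟩, rfl⟩
      exact ⟨⟨i, hi, hc, rfl⟩, h⟩
  have h1 : redOutliers R l₁ l₂ = (((Finset.range N).filter fun d => col d ≠ 1).filter fun d =>
      ¬ 0 ≤ hgt x y l₁.slope l₁.intercept d * hgt x y l₂.slope l₂.intercept d).card := by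
    unfold redOutliers
    rw [hset, Set.InjOn.ncard_image, Set.ncard_coe_finset]
    intro i hi j hj h
    simp only [Finset.mem_coe, Finset.mem_filter, Finset.mem_range] at hi hj
    by_contra hne
    exact hinj i hi.1.1 j hj.1.1 hne (Prod.ext_iff.1 h).1
  have h2 : unsep N col (hgt x y l₁.slope l₁.intercept) (hgt x y l₂.slope l₂.intercept) =
      ((Finset.range N).filter fun d => col d ≠ 1).filter fun d =>
        0 ≤ hgt x y l₁.slope l₁.intercept d * hgt x y l₂.slope l₂.intercept d := by
    unfold unsep
    rw [Finset.filter_filter]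
  rw [h1, h2, add_comm, Finset.card_filter_add_card_filter_not]

theorem collinear_of_slopeAt {x y : ℕ → ℝ} {i j k : ℕ} (hij : x i ≠ x j) (hik : x i ≠ x k)
    (h : slopeAt x y i j = slopeAt x y i k) :
    Collinear ℝ {((x i, y i) : ℝ × ℝ), (x j, y j), (x k, y k)} := by
  have key : ∀ d, x i ≠ x d → slopeAt x y i d = slopeAt x y i j →
      ((x d, y d) : ℝ × ℝ) = (x d - x i) • ((1, slopeAt x y i j) : ℝ × ℝ) +ᵥ ((x i, y i) : ℝ × ℝ) := by
    intro d hd hs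
    rw [← hs]
    have h1 : x d - x i ≠ 0 := sub_ne_zero.2 hd.symm
    have h2 : (x d - x i) * slopeAt x y i d = y d - y i := by
      unfold slopeAt; exact mul_div_cancel₀ _ h1
    ext
    · simp
    · simp [h2]
  refine (collinear_iff_of_mem (p₀ := ((x i, y i) : ℝ × ℝ)) (by simp)).2
    ⟨(1, slopeAt x y i j), fun p hp => ?_⟩
  simp only [Set.mem_insert_iff, Set.mem_singleton_iff] at hp
  rcases hp with rfl | rfl | rfl
  · exact ⟨0, by simp⟩
  · exact ⟨_, key j hij rfl⟩
  · exact ⟨_, key k hik h.symm⟩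

end Bowtie

namespace Bowtie

open RealRAM

/-! ### The algorithm is correct and takes quadratic time -/

section

variable {n : ℕ} {B R : Finset (ℝ × ℝ)} {b r : Fin n → ℝ × ℝ}

/-- The points of the input: the blue points, followed by the red points. -/
def inputPoint (b r : Fin n → ℝ × ℝ) (j : ℕ) : ℝ × ℝ :=
  if h : j < n then b ⟨j, h⟩ else if h : j - n < n then r ⟨j - n, h⟩ else 0

theorem inputPoint_blue {j : ℕ} (h : j < n) : inputPoint b r j = b ⟨j, h⟩ := by
  simp [inputPoint, h]

theorem inputPoint_red {j : ℕ} (h : ¬ j < n) (h' : j - n < n) :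
    inputPoint b r j = r ⟨j - n, h'⟩ := by
  simp [inputPoint, h, h']

theorem injective_of_card {S : Finset (ℝ × ℝ)} (hS : S.card = n)
    (hb : Set.range b = (S : Set (ℝ × ℝ))) : Function.Injective b := by
  classical
  have h1 : Finset.univ.image b = S := by
    apply Finset.coe_injective
    simpa using hb
  have h2 : (Finset.univ.image b).card = (Finset.univ : Finset (Fin n)).card := by
    rw [h1, hS]; simp
  have h3 := Finset.card_image_iff.1 h2
  intro i j hij
  exact h3 (by simp) (by simp) hij

/-- The sorted points are the input points. -/
theorem mem_iff_of_sorted (hb : Set.range b = (B : Set (ℝ × ℝ))) (hr : Set.range r = (R : Set (ℝ × ℝ)))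
    {x y : ℕ → ℝ} {col : ℕ → ℕ}
    (hinj : ∀ i < n + n, ∀ j < n + n, i ≠ j → (inputPoint b r i).1 ≠ (inputPoint b r j).1)
    (hs : Sorted n (n + n) (fun j => (inputPoint b r j).1) (fun j => (inputPoint b r j).2) x y col
      (n + n)) :
    (∀ p, p ∈ B ↔ ∃ i < n + n, col i = 1 ∧ (x i, y i) = p) ∧
    (∀ p, p ∈ R ↔ ∃ i < n + n, col i ≠ 1 ∧ (x i, y i) = p) := by
  have hB : ∀ p, p ∈ B ↔ ∃ i, b i = p := fun p => by
    rw [← Finset.mem_coe, ← hb, Set.mem_range]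
  have hR : ∀ p, p ∈ R ↔ ∃ i, r i = p := fun p => by
    rw [← Finset.mem_coe, ← hr, Set.mem_range]
  set X : ℕ → ℝ := fun j => (inputPoint b r j).1 with hX
  have hpt : ∀ j < n + n, (x (rank (n + n) X j), y (rank (n + n) X j)) = inputPoint b r j := by
    intro j hj
    rw [hs.x_eq j hj, hs.y_eq j hj]
  constructor
  · intro p
    rw [hB]
    constructor
    · rintro ⟨j, rfl⟩
      have hj := j.isLt
      refine ⟨rank (n + n) X j, rank_lt (by omega), ?_, ?_⟩
      · rw [hs.col_eq _ (by omega), if_pos hj]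
      · rw [hpt _ (by omega), inputPoint_blue hj]
    · rintro ⟨i, hi, hc, rfl⟩
      obtain ⟨j, hj, rfl⟩ := rank_surj hinj hi
      rw [hs.col_eq j hj] at hc
      have hjn : j < n := by
        by_contra h
        simp [h] at hc
      exact ⟨⟨j, hjn⟩, by rw [hpt j hj, inputPoint_blue hjn]⟩
  · intro p
    rw [hR]
    constructor
    · rintro ⟨j, rfl⟩
      have hj := j.isLt
      refine ⟨rank (n + n) X (n + j), rank_lt (by omega), ?_, ?_⟩
      · rw [hs.col_eq _ (by omega), if_neg (by omega)]
        omega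
      · rw [hpt _ (by omega), inputPoint_red (by omega) (by omega)]
        congr 1
        ext
        simp
    · rintro ⟨i, hi, hc, rfl⟩
      obtain ⟨j, hj, rfl⟩ := rank_surj hinj hi
      rw [hs.col_eq j hj] at hc
      have hjn : ¬ j < n := by
        intro h
        simp [h] at hc
      exact ⟨⟨j - n, by omega⟩, by rw [hpt j hj, inputPoint_red hjn (by omega)]⟩

theorem genPos_of_generalPosition {S : Set (ℝ × ℝ)} (hS : GeneralPosition S) {N : ℕ} {x y : ℕ → ℝ}
    (hm : ∀ i < N, ∀ j < N, (x i < x j ↔ i < j)) (hmem : ∀ i < N, (x i, y i) ∈ S) : GenPos N x y := by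
  have hinj : ∀ i < N, ∀ j < N, i ≠ j → x i ≠ x j := by
    intro i hi j hj hne
    rcases lt_or_gt_of_ne hne with h | h
    · exact ((hm i hi j hj).2 h).ne
    · exact ((hm j hj i hi).2 h).ne'
  refine ⟨hinj, fun i hi j hj k hk hij hik hjk heq => ?_⟩
  have hne : ∀ i < N, ∀ j < N, i ≠ j → ((x i, y i) : ℝ × ℝ) ≠ (x j, y j) :=
    fun i hi j hj h heq => hinj i hi j hj h (Prod.ext_iff.1 heq).1
  exact hS.2.2 _ (hmem i hi) _ (hmem j hj) _ (hmem k hk) (hne i hi j hj hij) (hne j hj k hk hjk)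
    (hne i hi k hk hik) (collinear_of_slopeAt (hinj i hi j hj hij) (hinj i hi k hk hik) heq)

theorem runs_bowtieProg : ∃ K, ∀ (n : ℕ), 0 < n → ∀ (B R : Finset (ℝ × ℝ)), B.card = n → R.card = n →
    Disjoint B R → GeneralPosition ((B : Set (ℝ × ℝ)) ∪ (R : Set (ℝ × ℝ))) →
    ∀ (b r : Fin n → ℝ × ℝ), Set.range b = (B : Set (ℝ × ℝ)) → Set.range r = (R : Set (ℝ × ℝ)) →
    Runs bowtieProg (input b r) (K * (n + n + 1) ^ 2) fun s =>
      Optimal B R (outputFst s) (outputSnd s) := by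
  obtain ⟨K₁, hK₁⟩ := runs_sortProg
  obtain ⟨K₂, hK₂⟩ := runs_listsProg
  obtain ⟨K₃, hK₃⟩ := runs_splitsProg
  refine ⟨K₁ + (K₂ + (K₃ + outProg.time)), fun n hn B R hBn hRn hdisj hgp b r hb hr => ?_⟩
  have hbinj := injective_of_card hBn hb
  have hrinj := injective_of_card hRn hr
  have hmemb : ∀ i, b i ∈ B := fun i => by
    rw [← Finset.mem_coe, ← hb]; exact Set.mem_range_self i
  have hmemr : ∀ i, r i ∈ R := fun i => by
    rw [← Finset.mem_coe, ← hr]; exact Set.mem_range_self i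
  have hmem : ∀ j < n + n, inputPoint b r j ∈ (B : Set (ℝ × ℝ)) ∪ (R : Set (ℝ × ℝ)) := by
    intro j hj
    by_cases h : j < n
    · rw [inputPoint_blue h]; exact Or.inl (hmemb _)
    · rw [inputPoint_red h (by omega)]; exact Or.inr (hmemr _)
  have hinj : ∀ i < n + n, ∀ j < n + n, i ≠ j → (inputPoint b r i).1 ≠ (inputPoint b r j).1 := by
    intro i hi j hj hne heq
    have h := hgp.1 (hmem i hi) (hmem j hj) heq
    by_cases h1 : i < n <;> by_cases h2 : j < n
    · rw [inputPoint_blue h1, inputPoint_blue h2] at h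
      have := hbinj h
      simp only [Fin.mk.injEq] at this
      exact hne this
    · rw [inputPoint_blue h1, inputPoint_red h2 (by omega)] at h
      exact Finset.disjoint_left.1 hdisj (hmemb _) (h ▸ hmemr _)
    · rw [inputPoint_red h1 (by omega), inputPoint_blue h2] at h
      exact Finset.disjoint_left.1 hdisj (hmemb _) (h ▸ hmemr _)
    · rw [inputPoint_red h1 (by omega), inputPoint_red h2 (by omega)] at h
      have := hrinj h
      simp only [Fin.mk.injEq] at this
      omega
  have hcoord : ∀ j < n + n,
      (inputPoint b r j).1 = (if j < n then (input b r).realArr 0 j else (input b r).realArr 2 (j - n)) ∧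
      (inputPoint b r j).2 = (if j < n then (input b r).realArr 1 j else (input b r).realArr 3 (j - n)) := by
    intro j hj
    by_cases h : j < n
    · rw [inputPoint_blue h]
      simp [h, input]
    · have h' : j - n < n := by omega
      rw [inputPoint_red h h']
      simp [h, h', input]
  refine (Runs.seq (hK₁ n (n + n) _ _ (input b r) rfl rfl (fun j hj => (hcoord j hj).1)
    (fun j hj => (hcoord j hj).2) hinj).frame fun s₁ hs₁ =>
    (?_ : Runs _ _ (K₂ * (n + n + 1) ^ 2 + (K₃ * (n + n + 1) ^ 2 + outProg.time)) _)).mono ?_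
    fun _ h => h
  · obtain ⟨⟨x, y, col, hsort, hbase, hblue⟩, hf₁⟩ := hs₁
    have hm := hsort.mono hinj
    obtain ⟨hB, hR⟩ := mem_iff_of_sorted hb hr hinj hsort
    have hgp' : GenPos (n + n) x y := by
      refine genPos_of_generalPosition hgp hm fun i hi => ?_
      by_cases hc : col i = 1
      · exact Or.inl ((hB _).2 ⟨i, hi, hc, rfl⟩)
      · exact Or.inr ((hR _).2 ⟨i, hi, hc, rfl⟩)
    refine Runs.seq (hK₂ n (n + n) x y col s₁ hgp' hm hbase).frame fun s₂ hs₂ => ?_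
    obtain ⟨⟨hbase₂, hlists⟩, hf₂⟩ := hs₂
    have hbp := hf₂.arr aBlue (by decide)
    have hP : Points n (n + n) x y col (s₂.natArr aNx) (s₂.natArr aPv) (s₂.natArr aBlue) :=
      ⟨hgp', hm, hlists, by rw [hbp]; exact hblue⟩
    have hbest : s₂.nat vbest = 0 := by
      rw [hf₂.nat vbest (by decide), hf₁.nat vbest (by decide)]
      rfl
    refine Runs.seq (hK₃ n (n + n) x y col _ _ _ s₂ hP ⟨hbase₂, rfl, rfl, rfl⟩ hn (by omega) hbest)
      fun s₃ hs₃ => Runs.of_loopFree rfl ?_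
    obtain ⟨l₁, l₂, e₁, e₂, hlt, hfeas, hcard⟩ := run_outProg hP hs₃.env hs₃.held
    rw [e₁, e₂]
    refine ⟨⟨hlt, fun p hp => ?_⟩, fun k₁ k₂ hk => ?_⟩
    · obtain ⟨i, hi, hc, rfl⟩ := (hB p).1 hp
      exact mem_bowtie.2 (hfeas i hi hc)
    · have h1 := redOutliers_add_unsep hgp'.inj hR l₁ l₂
      have h2 := redOutliers_add_unsep hgp'.inj hR k₁ k₂
      obtain ⟨i, hi, c₁, b₁, m₁, c₂, b₂, m₂, hc₁, hc₂, hT₁, hT₂, hle⟩ :=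
        hP.blue.exists_tangents hn hgp' hm (m := k₁.slope) (a := k₁.intercept) (m' := k₂.slope)
          (a' := k₂.intercept) hk.1 fun d hd hc =>
            mem_bowtie.1 (hk.2 (Finset.mem_coe.2 ((hB _).2 ⟨d, hd, hc, rfl⟩)))
      have h3 := hs₃.bound i hi c₁ c₂ hc₁ hc₂ b₁ m₁ b₂ m₂ hT₁ hT₂
      omega
  · have : 1 ≤ (n + n + 1) ^ 2 := Nat.one_le_pow _ _ (by omega)
    nlinarith [Nat.zero_le outProg.time]

end

end Bowtie

theorem mainTheorem3 :
    ∃ (prog : RealRAM.Prog) (C : ℕ),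
      ∀ (n : ℕ), 0 < n →
      ∀ (B R : Finset (ℝ × ℝ)), B.card = n → R.card = n → Disjoint B R →
        Bowtie.GeneralPosition ((B : Set (ℝ × ℝ)) ∪ (R : Set (ℝ × ℝ))) →
      ∀ (b r : Fin n → ℝ × ℝ),
        Set.range b = (B : Set (ℝ × ℝ)) → Set.range r = (R : Set (ℝ × ℝ)) →
      ∃ (s : RealRAM.State) (t : ℕ),
        RealRAM.Exec prog (Bowtie.input b r) s t ∧ t ≤ C * n ^ 2 ∧
          Bowtie.Optimal B R (Bowtie.outputFst s) (Bowtie.outputSnd s) := by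
  obtain ⟨K, hK⟩ := Bowtie.runs_bowtieProg
  refine ⟨Bowtie.bowtieProg, 9 * K, fun n hn B R hB hR hd hg b r hb hr => ?_⟩
  obtain ⟨s, t, h1, h2, h3⟩ := hK n hn B R hB hR hd hg b r hb hr
  refine ⟨s, t, h1, h2.trans ?_, h3⟩
  have h4 : (n + n + 1) ^ 2 ≤ 9 * n ^ 2 := by nlinarith
  calc K * (n + n + 1) ^ 2 ≤ K * (9 * n ^ 2) := Nat.mul_le_mul_left _ h4
    _ = 9 * K * n ^ 2 := by ring
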